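/- Let $\lambda\le 2$. For a prime $p$, integers $n_b,m\ge 0$, a base polynomial $b=\sum_{i=0}^{n_b}\sum_{j=1}^{m}b_{ij}x^ix_j$ and univariate polynomials $f_z=\sum_{t=0}^{\lambda}f_{zt}x^t$ ($z=1,2$) over $\mathbb F_p$, the plain central maps are the $(n_b+\lambda+1)\times m$ coefficient matrices $P_z=(p_{ijz})$ of the products $b\,f_z$, that is, $p_{ijz}=\sum_{s+t=i}b_{sj}f_{zt}$. A pair $(g_1,g_2)$ of polynomials of degree at most $\lambda$ over $\mathbb F_p$ is called compatible with $(P_1,P_2)$ if there is some $b'=\sum_{i=0}^{n_b}\sum_{j=1}^{m}b'_{ij}x^ix_j$ such that $P_1,P_2$ are the coefficient matrices of $b'g_1,\,b'g_2$. (If $(g_1,g_2)$ is compatible, so is $(cg_1,cg_2)$ for every $c\in\mathbb F_p^{\times}$, so that $(f_1,f_2)$ can be recovered from $(P_1,P_2)$ at best up to a common nonzero scalar.) The coefficients of $f_1,f_2$ can be found from $p,n_b,m,P_1,P_2$ in time polynomial in the bit length of this input (thus in $n_b$, $m$ and $\log p$), in the following sense. (1) There is a deterministic polynomial-time algorithm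 which, whenever $f_1,f_2$ are determined by $P_1,P_2$ up to a common nonzero scalar (every pair compatible with $(P_1,P_2)$ is of the form $(cf_1,cf_2)$ with $c\in\mathbb F_p^{\times}$), outputs the coefficients of $(cf_1,cf_2)$ for some $c\in\mathbb F_p^{\times}$. (2) There is a randomized algorithm, running in polynomial time for every outcome of its coin flips, which for all plain central maps $P_1,P_2$ that are not both zero either outputs a list of pairs compatible with $(P_1,P_2)$ that contains every compatible pair up to a common nonzero scalar (in particular $(cf_1,cf_2)$ for some $c\in\mathbb F_p^{\times}$), or reports failure, the latter with probability at most $1/2$. Running times are bit costs, on a random access machine with logarithmic cost. -/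

import Mathlib

open scoped BigOperators

/-! ## A random access machine with logarithmic cost

Programs are structured programs over finitely many named, unbounded arrays of natural numbers
(a scalar variable is an array of which only entry `0` is used). Every operation is charged
according to the bit lengths of the numbers that it touches, so that running times agree with
those of multi-tape Turing machines up to a polynomial. -/

namespace Ram

/-- Expressions. Arrays are named by natural numbers that are fixed in the program text. -/
inductive Term : Type
  | const (n : ℕ) : Term
  | get (a : ℕ) (i : Term) : Term
  | add (u v : Term) : Term
  | sub (u v : Term) : Term
  | mul (u v : Term) : Term
  | div (u v : Term) : Term
  | mod (u v : Term) : Term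

/-- Programs: `store a i v` is the assignment `a[i] := v`; `cond e c d` runs `c` if `e ≠ 0` and `d`
otherwise; `loop e c` runs `c` as long as `e ≠ 0`. -/
inductive Prog : Type
  | skip : Prog
  | store (a : ℕ) (i v : Term) : Prog
  | seq (c d : Prog) : Prog
  | cond (e : Term) (c d : Prog) : Prog
  | loop (e : Term) (c : Prog) : Prog

/-- The memory: `s a i` is the entry with index `i` of the array `a`. -/
abbrev State : Type := ℕ → ℕ → ℕ

/-- The value of an expression; `sub` is truncated subtraction, `div` and `mod` are quotient and
remainder of natural numbers. -/
def Term.value (s : State) : Term → ℕ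
  | .const n => n
  | .get a i => s a (i.value s)
  | .add u v => u.value s + v.value s
  | .sub u v => u.value s - v.value s
  | .mul u v => u.value s * v.value s
  | .div u v => u.value s / v.value s
  | .mod u v => u.value s % v.value s

/-- The bit cost of evaluating an expression: linear in the bit lengths of the operands for memory
access, addition and subtraction; the product of the bit lengths for multiplication and division. -/
def Term.cost (s : State) : Term → ℕ
  | .const n => n.size + 1
  | .get a i => i.cost s + (i.value s).size + (s a (i.value s)).size + 1
  | .add u v => u.cost s + v.cost s + (u.value s).size + (v.value s).size + 1
  | .sub u v => u.cost s + v.cost s + (u.value s).size + (v.value s).size + 1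
  | .mul u v => u.cost s + v.cost s + ((u.value s).size + 1) * ((v.value s).size + 1)
  | .div u v => u.cost s + v.cost s + ((u.value s).size + 1) * ((v.value s).size + 1)
  | .mod u v => u.cost s + v.cost s + ((u.value s).size + 1) * ((v.value s).size + 1)

/-- The memory `s` after the assignment `a[i] := v`. -/
def State.write (s : State) (a i v : ℕ) : State :=
  Function.update s a (Function.update (s a) i v)

/-- `Exec c s s' t`: started in the memory `s`, the program `c` halts with the memory `s'` after
time exactly `t`. -/
inductive Exec : Prog → State → State → ℕ → Prop
  | skip (s : State) : Exec .skip s s 1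
  | store (s : State) (a : ℕ) (i v : Term) :
      Exec (.store a i v) s (s.write a (i.value s) (v.value s))
        (i.cost s + v.cost s + (i.value s).size + (v.value s).size + 1)
  | seq {c d : Prog} {s s' s'' : State} {t t' : ℕ} :
      Exec c s s' t → Exec d s' s'' t' → Exec (.seq c d) s s'' (t + t')
  | cond_true {e : Term} {c d : Prog} {s s' : State} {t : ℕ} :
      e.value s ≠ 0 → Exec c s s' t → Exec (.cond e c d) s s' (e.cost s + t + 1)
  | cond_false {e : Term} {c d : Prog} {s s' : State} {t : ℕ} :
      e.value s = 0 → Exec d s s' t → Exec (.cond e c d) s s' (e.cost s + t + 1)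
  | loop_true {e : Term} {c : Prog} {s s' s'' : State} {t t' : ℕ} :
      e.value s ≠ 0 → Exec c s s' t → Exec (.loop e c) s' s'' t' →
        Exec (.loop e c) s s'' (e.cost s + t + t' + 1)
  | loop_false {e : Term} {c : Prog} {s : State} :
      e.value s = 0 → Exec (.loop e c) s s (e.cost s + 1)

/-- The array that holds the list `l`: its length, followed by its entries. -/
def ofList (l : List ℕ) : ℕ → ℕ
  | 0 => l.length
  | i + 1 => l.getD i 0

/-- The list that is held by an array. -/
def toList (a : ℕ → ℕ) : List ℕ := (List.range (a 0)).map fun i => a (i + 1)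

/-- Initial memory: the input `x` is in array `0`, the auxiliary input `r` (the random bits of a
randomized computation) is in array `1`, and all else is `0`. -/
def initState (x r : List ℕ) : State
  | 0 => ofList x
  | 1 => ofList r
  | _ + 2 => fun _ => 0

/-- The number of bits of a list of natural numbers (plus one separator for each entry). -/
def bitSize (l : List ℕ) : ℕ := (l.map fun n => n.size + 1).sum

/-- On the input `x` and the auxiliary input `r`, the program `c` halts with the output `y` in
array `2`, and the running time together with the size of the output is at most `T`. -/
def Computes (c : Prog) (x r y : List ℕ) (T : ℕ) : Prop :=
  ∃ (s : State) (t : ℕ), Exec c (initState x r) s t ∧ toList (s 2) = y ∧ t + bitSize y ≤ T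

/-- The list of the bits of a string of `k` coin flips. -/
def coins {k : ℕ} (w : Fin k → Bool) : List ℕ := List.ofFn fun i => (w i).toNat

end Ram

/-! ## The plain central map -/

namespace HPPK

variable {K : Type*}

/-- The coefficient matrix `(p_{ij})` of the product `b(x, x₁, …, xₘ) f(x)`, where
`b = ∑ i ≤ nb, ∑ j, b_{ij} x ^ i x_j` and `f = ∑ t ≤ lam, f_t x ^ t`. -/
def centralMap [Semiring K] {nb m lam : ℕ} (b : Matrix (Fin (nb + 1)) (Fin m) K)
    (f : Fin (lam + 1) → K) : Matrix (Fin (nb + lam + 1)) (Fin m) K :=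
  fun i j => ∑ s : Fin (nb + 1), ∑ t : Fin (lam + 1),
    if (s : ℕ) + (t : ℕ) = (i : ℕ) then b s j * f t else 0

/-- The polynomial `∑ i < k, ∑ j, M_{ij} x ^ i x_j`; the variable `x` is `none`, and `x_j` is
`some j`. -/
noncomputable def bilinearPoly [CommSemiring K] {k m : ℕ} (M : Matrix (Fin k) (Fin m) K) :
    MvPolynomial (Option (Fin m)) K :=
  ∑ i : Fin k, ∑ j : Fin m, MvPolynomial.C (M i j) * MvPolynomial.X none ^ (i : ℕ)
    * MvPolynomial.X (some j)

/-- The polynomial `∑ t ≤ lam, f_t x ^ t`. -/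
noncomputable def univPoly [CommSemiring K] (m : ℕ) {lam : ℕ} (f : Fin (lam + 1) → K) :
    MvPolynomial (Option (Fin m)) K :=
  ∑ t : Fin (lam + 1), MvPolynomial.C (f t) * MvPolynomial.X none ^ (t : ℕ)

/-- The matrix `centralMap b f` is indeed the coefficient matrix of the product of polynomials. -/
theorem bilinearPoly_centralMap [CommSemiring K] {nb m lam : ℕ}
    (b : Matrix (Fin (nb + 1)) (Fin m) K) (f : Fin (lam + 1) → K) :
    bilinearPoly (centralMap b f) = bilinearPoly b * univPoly m f := by
  have key : ∀ (s : Fin (nb + 1)) (t : Fin (lam + 1)) (g : ℕ → MvPolynomial (Option (Fin m)) K),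
      (∑ i : Fin (nb + lam + 1), if (s : ℕ) + (t : ℕ) = (i : ℕ) then g i else 0)
        = g ((s : ℕ) + t) := by
    intro s t g
    have hst : (s : ℕ) + (t : ℕ) < nb + lam + 1 := by omega
    rw [Finset.sum_eq_single (⟨(s : ℕ) + t, hst⟩ : Fin (nb + lam + 1))]
    · simp
    · intro i _ hi
      rw [if_neg]
      intro h
      exact hi (Fin.ext h.symm)
    · simp
  have lhs : bilinearPoly (centralMap b f) = ∑ j : Fin m, ∑ s : Fin (nb + 1),
      ∑ t : Fin (lam + 1), ∑ i : Fin (nb + lam + 1), if (s : ℕ) + (t : ℕ) = (i : ℕ) then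
        MvPolynomial.C (b s j * f t) * MvPolynomial.X none ^ (i : ℕ) * MvPolynomial.X (some j)
        else 0 := by
    unfold bilinearPoly centralMap
    rw [Finset.sum_comm]
    refine Finset.sum_congr rfl fun j _ => ?_
    simp only [map_sum, Finset.sum_mul]
    rw [Finset.sum_comm]
    refine Finset.sum_congr rfl fun s _ => ?_
    rw [Finset.sum_comm]
    refine Finset.sum_congr rfl fun t _ => Finset.sum_congr rfl fun i _ => ?_
    split_ifs <;> simp
  rw [lhs]
  simp only [fun (j : Fin m) (s : Fin (nb + 1)) (t : Fin (lam + 1)) => key s t fun i =>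
    MvPolynomial.C (b s j * f t) * MvPolynomial.X none ^ i * MvPolynomial.X (some j)]
  unfold bilinearPoly univPoly
  rw [Finset.sum_comm, Finset.sum_mul]
  refine Finset.sum_congr rfl fun s _ => ?_
  rw [Finset.sum_mul]
  refine Finset.sum_congr rfl fun j _ => ?_
  rw [Finset.mul_sum]
  refine Finset.sum_congr rfl fun t _ => ?_
  rw [map_mul, pow_add]
  ring

/-- `(g₁, g₂)` is a pair of coefficient vectors behind the plain central maps `P₁`, `P₂`: for some
base polynomial `b`, `P₁` and `P₂` are the coefficient matrices of `b g₁` and `b g₂`. -/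
def IsKey [Semiring K] {nb m lam : ℕ} (P₁ P₂ : Matrix (Fin (nb + lam + 1)) (Fin m) K)
    (g₁ g₂ : Fin (lam + 1) → K) : Prop :=
  ∃ b : Matrix (Fin (nb + 1)) (Fin m) K, P₁ = centralMap b g₁ ∧ P₂ = centralMap b g₂

/-- `(g₁, g₂)` is `(c f₁, c f₂)` for a nonzero scalar `c`. -/
def ScalarEquiv [Semiring K] {lam : ℕ} (f₁ f₂ g₁ g₂ : Fin (lam + 1) → K) : Prop :=
  ∃ c : K, c ≠ 0 ∧ g₁ = c • f₁ ∧ g₂ = c • f₂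

/-- A vector over the prime field as the list of its least nonnegative residues. -/
def encodeVec {p k : ℕ} (f : Fin k → ZMod p) : List ℕ := List.ofFn fun i => (f i).val

/-- A pair of coefficient vectors as a list of natural numbers. -/
def encodePair {p k : ℕ} (f : (Fin k → ZMod p) × (Fin k → ZMod p)) : List ℕ :=
  encodeVec f.1 ++ encodeVec f.2

/-- A matrix over the prime field as the list of its entries, row by row. -/
def encodeMatrix {p k m : ℕ} (M : Matrix (Fin k) (Fin m) (ZMod p)) : List ℕ :=
  (List.ofFn fun i => encodeVec (M i)).flatten

/-- The input of the attack: the prime, the dimensions, and the two plain central maps. -/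
def encodeInput {p lam : ℕ} (nb m : ℕ)
    (P₁ P₂ : Matrix (Fin (nb + lam + 1)) (Fin m) (ZMod p)) : List ℕ :=
  [p, nb, m] ++ encodeMatrix P₁ ++ encodeMatrix P₂

/-- `L` lists, up to common nonzero scalars, exactly the pairs behind `P₁`, `P₂`. -/
def IsKeyList [Semiring K] {nb m lam : ℕ} (P₁ P₂ : Matrix (Fin (nb + lam + 1)) (Fin m) K)
    (L : List ((Fin (lam + 1) → K) × (Fin (lam + 1) → K))) : Prop :=
  (∀ g ∈ L, IsKey (nb := nb) P₁ P₂ g.1 g.2) ∧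
    ∀ g₁ g₂ : Fin (lam + 1) → K, IsKey (nb := nb) P₁ P₂ g₁ g₂ →
      ∃ g ∈ L, ScalarEquiv g₁ g₂ g.1 g.2

end HPPK

open Polynomial

/-! ### Notation for expressions and evaluation rules -/

namespace Ram

/-! Read the columns of the two matrices as polynomials `cs 0, …, cs (2m - 1)`. A pair (g₁, g₂) is
compatible exactly if cs i = β i · g₁ and cs (m + i) = β i · g₂ for all i < m, with deg β i ≤ nb
(`isKey_iff`). Choose j such that cs j and cs (m + j) are not both zero and divide them by their
gcd, which leaves a coprime pair (u, v). Then g₁ v = g₂ u, so every key is (k u, k v) with k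
dividing the gcd D of all columns. Conversely, once a key exists, a monic divisor e of D yields the
key (e u, e v) exactly if its degree lies in an interval given by lam, nb and the maximal length of
a column (`Admissible`, `Reduction.exists_admissible`, `Reduction.polyKey`). The upper end of the
interval is at most lam ≤ 2, so everything reduces to the divisors of D of degree at most two. These
are products of at most two irreducible factors of the squarefree polynomial gcd(D, X^(p²) - X),
called `smallPart D`.

Deterministic part. A gcd with X^p - X separates the linear from the quadratic factors. If the key
is unique, e is the only divisor of D of its degree. Exchanging one irreducible factor of e for
another one of the same degree then shows that every irreducible factor of D with the same degree as
a factor of e divides e. Hence the pieces that meet e divide e, and e is a product of two pieces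
without any further factorization (`exists_cons_of_candidates`).

Randomized part. Modulo an irreducible factor of `smallPart D` the trace X + X^p and the norm X ·
X^p are constants in the prime field, and the two constants determine the factor. The quadratic
character of T + c, for T the trace or the norm and c random, separates two factors with different
constants with probability at least 1/6 (`card_distinguishing`, `card_not_distinguishing_le`). With
16n numbers c of n binary digits, n being the bit length of the input, a union bound over the at
most n² pairs of factors leaves a failure probability of at most 1/2 (`two_mul_card_failure_le`). A
final check certifies that all nonconstant pieces are irreducible, so a wrong list is never output.

Running time. The predicate `wp` has a single parameter N that bounds both the bit lengths of stored
numbers and the iterations of each loop. By `wp_sound` every program with such a precondition runs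
in time polynomial in N, so each subroutine needs only functional correctness and linear or
quadratic bounds on lengths. -/

instance (n : ℕ) : OfNat Term n := ⟨.const n⟩
instance : Add Term := ⟨.add⟩
instance : Sub Term := ⟨.sub⟩
instance : Mul Term := ⟨.mul⟩
instance : Div Term := ⟨.div⟩
instance : Mod Term := ⟨.mod⟩

/-- The scalar variable that is stored in entry `0` of the array `a`. -/
abbrev var (a : ℕ) : Term := .get a 0

infixr:60 " ;; " => Prog.seq

@[simp] theorem value_const (s : State) (n : ℕ) : (Term.const n).value s = n := rfl
@[simp] theorem value_ofNat (s : State) (n : ℕ) : Term.value s (no_index (OfNat.ofNat n)) = OfNat.ofNat n := rfl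
@[simp] theorem value_get (s : State) (a : ℕ) (i : Term) :
    (Term.get a i).value s = s a (i.value s) := rfl
@[simp] theorem value_add (s : State) (u v : Term) :
    (u + v).value s = u.value s + v.value s := rfl
@[simp] theorem value_sub (s : State) (u v : Term) :
    (u - v).value s = u.value s - v.value s := rfl
@[simp] theorem value_mul (s : State) (u v : Term) :
    (u * v).value s = u.value s * v.value s := rfl
@[simp] theorem value_div (s : State) (u v : Term) :
    (u / v).value s = u.value s / v.value s := rfl
@[simp] theorem value_mod (s : State) (u v : Term) :
    (u % v).value s = u.value s % v.value s := rfl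

@[simp] theorem write_same (s : State) (a i v : ℕ) :
    s.write a i v a = Function.update (s a) i v := by simp [State.write]

@[simp] theorem write_ne (s : State) {a b : ℕ} (i v : ℕ) (h : b ≠ a) : s.write a i v b = s b := by
  simp [State.write, h]

/-! ### Weakest preconditions that control the running time -/

/-- All numbers in the memory have at most `N` bits. -/
def Bdd (N : ℕ) (s : State) : Prop := ∀ a i, s a i < 2 ^ N

theorem Bdd.write {N : ℕ} {s : State} (h : Bdd N s) (a i : ℕ) {v : ℕ} (hv : v < 2 ^ N) :
    Bdd N (s.write a i v) := by
  intro b j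
  by_cases hb : b = a
  · subst hb
    by_cases hj : j = i
    · subst hj; simpa using hv
    · simpa [Function.update_of_ne hj] using h b j
  · rw [write_ne _ _ _ hb]; exact h b j

theorem size_add_le (a b : ℕ) : (a + b).size ≤ a.size + b.size + 1 := by
  rw [Nat.size_le]
  have ha := Nat.lt_size_self a
  have hb := Nat.lt_size_self b
  have h1 : 2 ^ a.size ≤ 2 ^ (a.size + b.size) := Nat.pow_le_pow_right (by norm_num) (by omega)
  have h2 : 2 ^ b.size ≤ 2 ^ (a.size + b.size) := Nat.pow_le_pow_right (by norm_num) (by omega)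
  rw [pow_succ]; omega

theorem size_mul_le (a b : ℕ) : (a * b).size ≤ a.size + b.size := by
  rw [Nat.size_le, pow_add]
  exact Nat.mul_lt_mul'' (Nat.lt_size_self a) (Nat.lt_size_self b)

/-- In a memory of `N`-bit numbers, a fixed expression has a value of `O(N)` bits and can be
evaluated in time `O(N ^ 2)`. -/
theorem Term.exists_bound (e : Term) : ∃ C : ℕ, ∀ (N : ℕ) (s : State), 1 ≤ N → Bdd N s →
    (e.value s).size ≤ C * N ∧ e.cost s ≤ C * N ^ 2 := by
  have hN2 : ∀ N : ℕ, 1 ≤ N → N ≤ N ^ 2 ∧ 1 ≤ N ^ 2 := fun N h => by constructor <;> nlinarith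
  induction e with
  | const n =>
    refine ⟨n.size + 1, fun N s h1 _ => ⟨?_, ?_⟩⟩
    · simp only [Term.value]; nlinarith
    · simp only [Term.cost]; nlinarith [hN2 N h1]
  | get a i ih =>
    obtain ⟨C, hC⟩ := ih
    refine ⟨2 * C + 2, fun N s h1 hs => ?_⟩
    obtain ⟨h3, h4⟩ := hC N s h1 hs
    have h5 : (s a (i.value s)).size ≤ N := Nat.size_le.2 (hs _ _)
    have h6 := hN2 N h1
    refine ⟨?_, ?_⟩
    · simp only [Term.value]; nlinarith
    · simp only [Term.cost]; nlinarith
  | add u v hu hv | sub u v hu hv | mul u v hu hv | div u v hu hv | mod u v hu hv =>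
    obtain ⟨C, hC⟩ := hu
    obtain ⟨C', hC'⟩ := hv
    -- One constant serves all five operations. The term C C' comes from the product of bit lengths
    -- that is charged for multiplication and division.
    refine ⟨3 * C + 3 * C' + C * C' + 3, fun N s h1 hs => ?_⟩
    obtain ⟨h3, h4⟩ := hC N s h1 hs
    obtain ⟨h5, h6⟩ := hC' N s h1 hs
    have h7 := hN2 N h1
    have h10 : C * N * 1 ≤ C * N * N := Nat.mul_le_mul_left _ h1
    have h11 : C' * N * 1 ≤ C' * N * N := Nat.mul_le_mul_left _ h1
    refine ⟨?_, ?_⟩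
    · have h8 := size_add_le (u.value s) (v.value s)
      have h9 := size_mul_le (u.value s) (v.value s)
      have h12 : (u.value s - v.value s).size ≤ (u.value s).size := Nat.size_le_size (Nat.sub_le _ _)
      have h13 : (u.value s / v.value s).size ≤ (u.value s).size :=
        Nat.size_le_size (Nat.div_le_self _ _)
      have h14 : (u.value s % v.value s).size ≤ (u.value s).size :=
        Nat.size_le_size (Nat.mod_le _ _)
      have h15 : C * N + C' * N + N ≤ (3 * C + 3 * C' + C * C' + 3) * N := by nlinarith
      simp only [Term.value]
      omega
    · have h8 : ((u.value s).size + 1) * ((v.value s).size + 1) ≤ (C * N + 1) * (C' * N + 1) :=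
        Nat.mul_le_mul (by omega) (by omega)
      have h9 : (C * N + 1) * (C' * N + 1) = C * C' * N ^ 2 + C * N + C' * N + 1 := by ring
      simp only [Term.cost]
      nlinarith

/-- Weakest precondition: `c`, started in `s`, halts in a memory that satisfies `Q`; every loop
makes at most `N` iterations whenever it is entered, and only numbers of at most `N` bits are
stored. -/
def wp (N : ℕ) : Prog → (State → Prop) → State → Prop
  | .skip, Q, s => Q s
  | .store a i v, Q, s => v.value s < 2 ^ N ∧ Q (s.write a (i.value s) (v.value s))
  | .seq c d, Q, s => wp N c (wp N d Q) s
  | .cond e c d, Q, s => (e.value s ≠ 0 → wp N c Q s) ∧ (e.value s = 0 → wp N d Q s)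
  -- The index of the invariant is the number of iterations still allowed. It starts at N, and a
  -- nonzero guard forces it to be positive.
  | .loop e c, Q, s => ∃ I : ℕ → State → Prop, I N s ∧ ∀ k s, I k s →
      (e.value s = 0 → Q s) ∧ (e.value s ≠ 0 → ∃ k', k = k' + 1 ∧ wp N c (I k') s)

theorem wp_mono {N : ℕ} {c : Prog} {Q Q' : State → Prop} (h : ∀ s, Q s → Q' s) {s : State}
    (hs : wp N c Q s) : wp N c Q' s := by
  induction c generalizing Q Q' s with
  | skip => exact h _ hs
  | store a i v => exact ⟨hs.1, h _ hs.2⟩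
  | seq c d hc hd => exact hc (fun s hs => hd h hs) hs
  | cond e c d hc hd => exact ⟨fun he => hc h (hs.1 he), fun he => hd h (hs.2 he)⟩
  | loop e c hc =>
    obtain ⟨I, h1, h2⟩ := hs
    exact ⟨I, h1, fun k s hk => ⟨fun he => h _ ((h2 k s hk).1 he), (h2 k s hk).2⟩⟩

theorem wp_seq {N : ℕ} {c d : Prog} {P Q : State → Prop} {s : State} (h : wp N c P s)
    (h' : ∀ s', P s' → wp N d Q s') : wp N (c ;; d) Q s := wp_mono (c := c) h' h

/-- Programs with a weakest precondition for `N` run in time polynomial in `N`. -/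
theorem wp_sound (c : Prog) : ∃ T : Polynomial ℕ, ∀ (N : ℕ) (s : State) (Q : State → Prop),
    1 ≤ N → Bdd N s → wp N c Q s →
      ∃ s' t, Exec c s s' t ∧ t ≤ T.eval N ∧ Bdd N s' ∧ Q s' := by
  induction c with
  | skip => exact ⟨1, fun N s Q _ hs h => ⟨s, 1, .skip s, by simp, hs, h⟩⟩
  | store a i v =>
    obtain ⟨C, hC⟩ := i.exists_bound
    obtain ⟨C', hC'⟩ := v.exists_bound
    refine ⟨Polynomial.C (2 * C + 2 * C' + 1) * Polynomial.X ^ 2, fun N s Q hN hs h =>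
      ⟨_, _, .store s a i v, ?_, hs.write _ _ h.1, h.2⟩⟩
    have h1 := hC N s hN hs
    have h2 := hC' N s hN hs
    simp only [Polynomial.eval_mul, Polynomial.eval_C, Polynomial.eval_pow, Polynomial.eval_X]
    have h3 : C * N * 1 ≤ C * N * N := Nat.mul_le_mul_left _ hN
    have h4 : C' * N * 1 ≤ C' * N * N := Nat.mul_le_mul_left _ hN
    have h5 : 1 ≤ N ^ 2 := Nat.one_le_pow _ _ hN
    nlinarith
  | seq c d hc hd =>
    obtain ⟨T, hT⟩ := hc
    obtain ⟨T', hT'⟩ := hd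
    refine ⟨T + T', fun N s Q hN hs h => ?_⟩
    obtain ⟨s1, t1, e1, l1, b1, q1⟩ := hT N s _ hN hs h
    obtain ⟨s2, t2, e2, l2, b2, q2⟩ := hT' N s1 _ hN b1 q1
    exact ⟨s2, _, .seq e1 e2, by rw [Polynomial.eval_add]; omega, b2, q2⟩
  | cond e c d hc hd =>
    obtain ⟨C, hC⟩ := e.exists_bound
    obtain ⟨T, hT⟩ := hc
    obtain ⟨T', hT'⟩ := hd
    refine ⟨Polynomial.C C * Polynomial.X ^ 2 + T + T' + 1, fun N s Q hN hs h => ?_⟩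
    have h1 := (hC N s hN hs).2
    by_cases he : e.value s = 0
    · obtain ⟨s1, t1, e1, l1, b1, q1⟩ := hT' N s _ hN hs (h.2 he)
      exact ⟨s1, _, .cond_false he e1, by simp; omega, b1, q1⟩
    · obtain ⟨s1, t1, e1, l1, b1, q1⟩ := hT N s _ hN hs (h.1 he)
      exact ⟨s1, _, .cond_true he e1, by simp; omega, b1, q1⟩
  | loop e c hc =>
    obtain ⟨C, hC⟩ := e.exists_bound
    obtain ⟨T, hT⟩ := hc
    -- At most N iterations and one last evaluation of the guard. The polynomial T for the body is
    -- fixed before N and the state, so nested loops multiply polynomials.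
    refine ⟨(Polynomial.X + 1) * (Polynomial.C C * Polynomial.X ^ 2 + T + 1),
      fun N s Q hN hs h => ?_⟩
    obtain ⟨I, h1, h2⟩ := h
    suffices H : ∀ k s, Bdd N s → I k s → ∃ s' t, Exec (.loop e c) s s' t ∧
        t ≤ (k + 1) * (C * N ^ 2 + T.eval N + 1) ∧ Bdd N s' ∧ Q s' by simpa using H N s hs h1
    intro k
    induction k with
    | zero =>
      intro s hs hI
      have h3 := (hC N s hN hs).2
      by_cases he : e.value s = 0
      · exact ⟨s, _, .loop_false he, by omega, hs, (h2 _ _ hI).1 he⟩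
      · obtain ⟨k', hk, _⟩ := (h2 _ _ hI).2 he
        omega
    | succ k ih =>
      intro s hs hI
      have h3 := (hC N s hN hs).2
      by_cases he : e.value s = 0
      · exact ⟨s, _, .loop_false he, by nlinarith, hs, (h2 _ _ hI).1 he⟩
      · obtain ⟨k', hk, hw⟩ := (h2 _ _ hI).2 he
        obtain rfl : k' = k := by omega
        obtain ⟨s1, t1, e1, l1, b1, q1⟩ := hT N s _ hN hs hw
        obtain ⟨s2, t2, e2, l2, b2, q2⟩ := ih s1 b1 q1
        refine ⟨s2, _, .loop_true he e1 e2, ?_, b2, q2⟩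
        calc e.cost s + t1 + t2 + 1 ≤ C * N ^ 2 + T.eval N
              + (k' + 1) * (C * N ^ 2 + T.eval N + 1) + 1 := by omega
          _ = _ := by ring

/-! ### Frames and counted loops -/

/-- The memories `s` and `s'` differ at most in the arrays in `l`. -/
def Frame (l : List ℕ) (s s' : State) : Prop := ∀ a, a ∉ l → s' a = s a

theorem Frame.refl (l : List ℕ) (s : State) : Frame l s s := fun _ _ => rfl

theorem Frame.trans {l l' m : List ℕ} {s s' s'' : State} (h : Frame l s s') (h' : Frame l' s' s'')
    (hl : l ⊆ m) (hl' : l' ⊆ m) : Frame m s s'' := fun a ha => by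
  rw [h' a fun h => ha (hl' h), h a fun h => ha (hl h)]

theorem Frame.mono {l m : List ℕ} {s s' : State} (h : Frame l s s') (hl : l ⊆ m) : Frame m s s' :=
  fun a ha => h a fun h => ha (hl h)

theorem Frame.write {l : List ℕ} {s s' : State} (h : Frame l s s') {a : ℕ} (ha : a ∈ l)
    (i v : ℕ) : Frame l s (s'.write a i v) := fun b hb => by
  rw [write_ne _ _ _ (by rintro rfl; exact hb ha), h b hb]

/-- `for i < n do c`. -/
def forDo (i : ℕ) (n : Term) (c : Prog) : Prog :=
  .store i 0 0 ;; .loop (n - var i) (c ;; .store i 0 (var i + 1))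

/-- The bound n is an expression that is evaluated anew in every pass, so the invariant has to fix
its value n₀ along with the counter. The body may not change the counter. -/
theorem wp_forDo {N : ℕ} {i : ℕ} {n : Term} {c : Prog} {Q : State → Prop} {s : State}
    (I : ℕ → State → Prop) (n₀ : ℕ) (hn : n₀ ≤ N) (h0 : I 0 (s.write i 0 0))
    (hI : ∀ k s', k ≤ n₀ → I k s' → s' i 0 = k ∧ n.value s' = n₀)
    (hstep : ∀ k s', k < n₀ → I k s' → s' i 0 = k →
      wp N c (fun s'' => s'' i 0 = k ∧ I (k + 1) (s''.write i 0 (k + 1))) s')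
    (hQ : ∀ s', I n₀ s' → Q s') : wp N (forDo i n c) Q s := by
  have hN : N < 2 ^ N := Nat.lt_two_pow_self
  -- The allowance j only has to be at least the number n₀ - k of remaining passes, so it may start
  -- at any N ≥ n₀.
  refine ⟨by simp, fun j s' => ∃ k, k ≤ n₀ ∧ n₀ - k ≤ j ∧ I k s', ⟨0, by omega, by omega, h0⟩, ?_⟩
  rintro j s' ⟨k, hk, hj, hIk⟩
  obtain ⟨h1, h2⟩ := hI k s' hk hIk
  simp only [value_sub, value_get, value_ofNat, h1, h2]
  refine ⟨fun h => ?_, fun h => ?_⟩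
  · obtain rfl : k = n₀ := by omega
    exact hQ _ hIk
  · refine ⟨j - 1, by omega, ?_⟩
    refine wp_mono (c := c) (fun s'' h3 => ?_) (hstep k s' (by omega) hIk h1)
    refine ⟨?_, k + 1, by omega, by omega, ?_⟩
    · simp [h3.1]; omega
    · simpa [h3.1] using h3.2

/-- `for i < n do a[off + i] := v`. -/
def vec (i : ℕ) (n : Term) (a : ℕ) (off v : Term) : Prog := forDo i n (.store a (off + var i) v)

/-- The expression v may read the array a that is being written. The hypothesis `hv` therefore
provides that the entries not yet reached still have their old values, which allows updates in
place. -/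
theorem wp_vec {N : ℕ} {i : ℕ} {n : Term} {a : ℕ} {off v : Term} {Q : State → Prop} {s : State}
    (n₀ o : ℕ) (g : ℕ → ℕ) (hn : n₀ ≤ N) (hai : a ≠ i)
    (hv : ∀ k s', k ≤ n₀ → Frame [i, a] s s' → s' i 0 = k →
      (∀ j, (j < o ∨ o + k ≤ j) → s' a j = s a j) →
      n.value s' = n₀ ∧ off.value s' = o ∧ (k < n₀ → v.value s' = g k ∧ g k < 2 ^ N))
    (hQ : ∀ s', Frame [i, a] s s' →
      (∀ j, s' a j = if o ≤ j ∧ j < o + n₀ then g (j - o) else s a j) → Q s') :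
    wp N (vec i n a off v) Q s := by
  refine wp_forDo (fun k s' => s' i 0 = k ∧ Frame [i, a] s s' ∧
    ∀ j, s' a j = if o ≤ j ∧ j < o + k then g (j - o) else s a j) n₀ hn ?_ ?_ ?_ ?_
  · refine ⟨by simp, (Frame.refl _ _).write (by simp) _ _, fun j => ?_⟩
    rw [write_ne _ _ _ hai, if_neg (by omega)]
  · rintro k s' hk ⟨h1, h2, h3⟩
    exact ⟨h1, (hv k s' hk h2 h1 fun j hj => by rw [h3, if_neg (by omega)]).1⟩
  · rintro k s' hk ⟨h1, h2, h3⟩ -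
    obtain ⟨h4, h5, h6⟩ := hv k s' hk.le h2 h1 fun j hj => by rw [h3, if_neg (by omega)]
    obtain ⟨h7, h8⟩ := h6 hk
    refine ⟨by rw [h7]; exact h8, by rw [write_ne _ _ _ hai.symm]; exact h1, by simp,
      (h2.write (by simp) _ _).write (by simp) _ _, fun j => ?_⟩
    rw [write_ne _ _ _ hai, write_same]
    simp only [value_add, value_get, value_ofNat, h1, h5, h7]
    by_cases hj : j = o + k
    · subst hj; simp
    · rw [Function.update_of_ne hj, h3]
      congr 1
      simp only [eq_iff_iff]; omega
  · rintro s' ⟨_, h2, h3⟩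
    exact hQ s' h2 h3

/-! ### Arithmetic of polynomials over the prime field -/

/-- The prime, read off the input. -/
abbrev modulus : Term := .get 0 1

/-- The array `A` holds the polynomial `f`: entry `0` is a number `n` such that `f` has degree less
than `n`, and the entries `1, …, n` are the coefficients of `f`. -/
structure Rep {p : ℕ} (A : ℕ → ℕ) (f : (ZMod p)[X]) (n : ℕ) : Prop where
  len : A 0 = n
  coeff : ∀ i, i < n → A (i + 1) = (f.coeff i).val
  zero : ∀ i, n ≤ i → f.coeff i = 0

theorem Rep.congr {p : ℕ} {A A' : ℕ → ℕ} {f : (ZMod p)[X]} {n : ℕ} (h : Rep A f n)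
    (hA : ∀ i, i ≤ n → A' i = A i) : Rep A' f n :=
  ⟨by rw [hA _ (by omega), h.len], fun i hi => by rw [hA _ (by omega), h.coeff i hi], h.zero⟩

theorem mod_eq_val (p x : ℕ) : x % p = (x : ZMod p).val := (ZMod.val_natCast p x).symm

/-- Subtraction of natural numbers is truncated, so the programs represent -x by p - x. -/
theorem cast_sub_val {p : ℕ} [NeZero p] (x : ZMod p) : ((p - x.val : ℕ) : ZMod p) = -x := by
  rw [Nat.cast_sub (ZMod.val_lt x).le]; simp

/-- `a[offA ..] := b[offB ..]` for a polynomial in the block of `b` that starts at `offB`. -/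
def copy (i a : ℕ) (offA : Term) (b : ℕ) (offB : Term) : Prog :=
  vec i (.get b offB + 1) a offA (.get b (offB + var i))

/-- The n + 1 entries are the length and the n coefficients. That all entries outside the target
block are preserved matters where several blocks share one array. -/
theorem wp_copy {N p i a b : ℕ} [NeZero p] {offA offB : Term} {s : State} {Q : State → Prop}
    {f : (ZMod p)[X]} {n oA oB : ℕ} (hp : p < 2 ^ N) (hn : n + 1 ≤ N)
    (hai : a ≠ i) (hbi : b ≠ i) (hba : b ≠ a)
    (hA : ∀ s', Frame [i, a] s s' → offA.value s' = oA)
    (hB : ∀ s', Frame [i, a] s s' → offB.value s' = oB)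
    (hf : Rep (fun j => s b (oB + j)) f n)
    (hQ : ∀ s', Frame [i, a] s s' → Rep (fun j => s' a (oA + j)) f n →
      (∀ j, (j < oA ∨ oA + n < j) → s' a j = s a j) → Q s') :
    wp N (copy i a offA b offB) Q s := by
  have hb : ∀ s', Frame [i, a] s s' → s' b = s b := fun s' h => h b (by simp [hbi, hba])
  have h0 : s b oB = n := hf.len
  have hN : N < 2 ^ N := Nat.lt_two_pow_self
  refine wp_vec (n + 1) oA (fun k => s b (oB + k)) hn hai ?_ ?_
  · intro k s' hk hs' h1 h2
    refine ⟨by simp [hB s' hs', hb s' hs', h0], hA s' hs', fun hk' => ⟨?_, ?_⟩⟩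
    · simp [hB s' hs', hb s' hs', h1]
    · rcases k with _ | k
      · change s b oB < 2 ^ N
        omega
      · have := hf.coeff k (by omega)
        exact this ▸ (ZMod.val_lt _).trans hp
  · intro s' hs' h
    refine hQ s' hs' (hf.congr fun j hj => ?_) fun j hj => ?_
    · simp only [h]
      rw [if_pos (by omega)]
      congr 1; omega
    · rw [h, if_neg (by omega)]

theorem wp_copy_zero {N p i a b : ℕ} [NeZero p] {s : State} {f : (ZMod p)[X]} {n : ℕ}
    (hf : Rep (s b) f n) (hp : p < 2 ^ N) (hn : n + 1 ≤ N) (hai : a ≠ i) (hbi : b ≠ i)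
    (hba : b ≠ a) :
    wp N (copy i a 0 b 0) (fun s' => Frame [i, a] s s' ∧ Rep (s' a) f n) s :=
  wp_copy (oA := 0) (oB := 0) (n := n) hp hn hai hbi hba (fun _ _ => rfl) (fun _ _ => rfl)
    (by simpa using hf) fun _ h h' _ => ⟨h, by simpa using h'⟩

/-- The product of the polynomials in the arrays `a` and `b`, in the array `25`. -/
def mul (a b : ℕ) : Prog :=
  vec 23 (var a + var b) 25 1 0 ;; .store 25 0 (var a + var b - 1) ;;
  forDo 23 (var a) (vec 24 (var b) 25 (var 23 + 1)
    ((.get 25 (var 23 + 1 + var 24) + .get a (var 23 + 1) * .get b (var 24 + 1)) % modulus))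

theorem wp_mul {N p a b : ℕ} [NeZero p] {s : State} {f g : (ZMod p)[X]} {n m : ℕ}
    (hs : s 0 1 = p) (hp : p < 2 ^ N) (hn : n + m ≤ N) (ha : a ∉ [23, 24, 25])
    (hb : b ∉ [23, 24, 25]) (hf : Rep (s a) f n) (hg : Rep (s b) g m) :
    wp N (mul a b) (fun s' => Frame [23, 24, 25] s s' ∧ Rep (s' 25) (f * g) (n + m - 1)) s := by
  have hN : N < 2 ^ N := Nat.lt_two_pow_self
  simp only [List.mem_cons, List.not_mem_nil, or_false, not_or] at ha hb
  obtain ⟨ha1, ha2, ha3⟩ := ha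
  obtain ⟨hb1, hb2, hb3⟩ := hb
  have hfr : ∀ s', Frame [23, 24, 25] s s' → s' 0 = s 0 ∧ s' a = s a ∧ s' b = s b :=
    fun s' h => ⟨h 0 (by decide), h a (by simp [*]), h b (by simp [*])⟩
  refine wp_vec (n + m) 1 (fun _ => 0) hn (by decide) ?_ ?_
  · intro k s' hk h1 h2 h3
    obtain ⟨-, h4, h5⟩ := hfr s' (h1.mono (by simp))
    refine ⟨by simp [h4, h5, hf.len, hg.len], by simp, fun _ => by simp⟩
  intro s1 hs1 hs1'
  obtain ⟨h10, h1a, h1b⟩ := hfr s1 (hs1.mono (by simp))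
  refine ⟨by simp [h1a, h1b, hf.len, hg.len]; omega, ?_⟩
  simp only [value_sub, value_add, value_get, value_ofNat, h1a, h1b, hf.len, hg.len]
  set s2 := s1.write 25 0 (n + m - 1) with hs2
  have hs2f : Frame [23, 24, 25] s s2 := (hs1.mono (by simp)).write (by simp) _ _
  -- Schoolbook multiplication: after k rows the array holds the product of g with the part of f of
  -- degree less than k. One more entry is cleared than the final length n + m - 1 needs, which
  -- avoids a case distinction.
  refine wp_forDo (fun k s' => s' 23 0 = k ∧ Frame [23, 24, 25] s s' ∧ s' 25 0 = n + m - 1 ∧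
    ∀ j, j < n + m → s' 25 (j + 1) =
      (((∑ i ∈ Finset.range k, C (f.coeff i) * X ^ i) * g).coeff j).val) n (by omega) ?_ ?_ ?_ ?_
  · refine ⟨by simp, hs2f.write (by simp) _ _, by simp [hs2], fun j hj => ?_⟩
    rw [write_ne _ _ _ (by decide), hs2, write_same, Function.update_of_ne (by omega), hs1',
      if_pos (by omega)]
    simp
  · rintro k s' hk ⟨h1, h2, h3, h4⟩
    exact ⟨h1, by simp [(hfr s' h2).2.1, hf.len]⟩
  · rintro k s' hk ⟨h1, h2, h3, h4⟩ -
    obtain ⟨h50, h5a, h5b⟩ := hfr s' h2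
    refine wp_vec m (k + 1)
      (fun l => (((((∑ i ∈ Finset.range (k + 1), C (f.coeff i) * X ^ i) * g).coeff (k + l)).val)))
      (by omega) (by decide) ?_ ?_
    · intro l s'' hl h6 h7 h8
      have h6' : Frame [23, 24, 25] s s'' := h2.trans h6 (by simp) (by simp)
      obtain ⟨h90, h9a, h9b⟩ := hfr s'' h6'
      have h23 : s'' 23 = s' 23 := h6 23 (by decide)
      refine ⟨by simp [h9b, hg.len], by simp [h23, h1], fun hlm => ⟨?_, (ZMod.val_lt _).trans hp⟩⟩
      simp only [value_mod, value_add, value_mul, value_get, value_ofNat, h23, h1, h7, h9a, h9b, h90,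
        hs, hf.coeff k hk, hg.coeff l hlm]
      rw [mod_eq_val, h8 _ (by omega), show k + 1 + l = k + l + 1 by ring, h4 _ (by omega),
        Finset.sum_range_succ, add_mul, coeff_add, mul_assoc, coeff_C_mul, coeff_X_pow_mul',
        if_pos (by omega), Nat.add_sub_cancel_left]
      push_cast
      simp
    · intro s'' h6 h7
      refine ⟨by rw [h6 23 (by decide), h1], by simp,
        (h2.trans h6 (by simp) (by simp)).write (by simp) _ _, ?_, fun j hj => ?_⟩
      · rw [write_ne _ _ _ (by decide), h7, if_neg (by omega), h3]
      · rw [write_ne _ _ _ (by decide), h7]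
        split_ifs with h8
        · rw [show k + (j + 1 - (k + 1)) = j by omega]
        · rw [h4 j hj, Finset.sum_range_succ, add_mul, coeff_add, mul_assoc, coeff_C_mul,
            coeff_X_pow_mul']
          split_ifs with h9
          · rw [hg.zero _ (by omega)]; simp
          · simp
  · rintro s' ⟨h1, h2, h3, h4⟩
    have hsum : (∑ i ∈ Finset.range n, C (f.coeff i) * X ^ i) = f := by
      ext j
      simp only [finsetSum_coeff, coeff_C_mul, coeff_X_pow, mul_ite, mul_one, mul_zero,
        Finset.sum_ite_eq, Finset.mem_range]
      split_ifs with hj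
      · rfl
      · rw [hf.zero j (by omega)]
    rw [hsum] at h4
    refine ⟨h2, h3, fun i hi => h4 i (by omega), fun i hi => ?_⟩
    rw [coeff_mul]
    refine Finset.sum_eq_zero fun x hx => ?_
    rw [Finset.HasAntidiagonal.mem_antidiagonal] at hx
    by_cases h5 : n ≤ x.1
    · rw [hf.zero _ h5, zero_mul]
    · rw [hg.zero _ (by omega), mul_zero]

/-- Division with remainder of the polynomial in the array `25` by the monic polynomial of degree
`d` in the array `26`: afterwards, the first `d` coefficients in the array `25` are those of the
remainder, and the others are those of the quotient. -/
def divide : Prog :=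
  forDo 27 (var 25 + 1 - var 26) (
    .store 28 0 (var 25 - var 26 - var 27) ;; .store 29 0 (.get 25 (var 28 + var 26)) ;;
    vec 24 (var 26 - 1) 25 (var 28 + 1)
      ((.get 25 (var 28 + 1 + var 24) + (modulus - var 29) * .get 26 (var 24 + 1)) % modulus))

/-- Long division in place. Since g is monic, the leading coefficient of the current remainder is
the next coefficient of the quotient. It is left where it stands and only the d entries below it are
changed, so the quotient builds up from the top, shifted by d, above the shrinking remainder. -/
theorem wp_divide {N p : ℕ} [Fact p.Prime] {s : State} {f g : (ZMod p)[X]} {n d : ℕ}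
    (hs : s 0 1 = p) (hp : p < 2 ^ N) (hn : n ≤ N) (hd : d ≤ N) (hf : Rep (s 25) f n)
    (hg : Rep (s 26) g (d + 1)) (hgm : g.Monic) (hgd : g.natDegree = d) :
    wp N divide (fun s' => Frame [24, 25, 27, 28, 29] s s' ∧ s' 25 0 = n ∧
      (∀ i, i < n → i < d → s' 25 (i + 1) = ((f %ₘ g).coeff i).val) ∧
      (∀ i, i < n → d ≤ i → s' 25 (i + 1) = ((f /ₘ g).coeff (i - d)).val)) s := by
  have hN : N < 2 ^ N := Nat.lt_two_pow_self
  have hfr : ∀ s', Frame [24, 25, 27, 28, 29] s s' → s' 0 = s 0 ∧ s' 26 = s 26 :=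
    fun s' h => ⟨h 0 (by decide), h 26 (by decide)⟩
  have hgd1 : g.coeff d = 1 := by rw [← hgd]; exact hgm
  refine wp_forDo (fun t s' => s' 27 0 = t ∧ Frame [24, 25, 27, 28, 29] s s' ∧ s' 25 0 = n ∧
    ∃ q r : (ZMod p)[X], f = g * q + r ∧ (∀ i, n - t ≤ i → r.coeff i = 0) ∧
      (∀ i, i < n - t → s' 25 (i + 1) = (r.coeff i).val) ∧
      (∀ i, n - t ≤ i → i < n → s' 25 (i + 1) = (q.coeff (i - d)).val) ∧
      (∀ i, (i + d < n - t ∨ n ≤ i + d) → q.coeff i = 0)) (n - d) (by omega) ?_ ?_ ?_ ?_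
  · refine ⟨by simp, (Frame.refl _ _).write (by simp) _ _, by simp [hf.len], 0, f, by simp,
      fun i hi => hf.zero i hi, fun i hi => ?_, fun i hi hi' => by omega, by simp⟩
    rw [write_ne _ _ _ (by decide), hf.coeff i hi]
  · rintro k s' hk ⟨h1, h2, h3, h4⟩
    refine ⟨h1, ?_⟩
    simp only [value_sub, value_add, value_get, value_ofNat, h3, (hfr s' h2).2, hg.len]
    omega
  · rintro t s' ht ⟨h1, h2, h3, q, r, h4, h5, h6, h7, h8⟩ -
    obtain ⟨h90, h926⟩ := hfr s' h2
    obtain ⟨k, hk⟩ : ∃ k, k = n - (d + 1) - t := ⟨_, rfl⟩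
    have h10 : s' 25 (k + (d + 1)) = (r.coeff (k + d)).val := h6 (k + d) (by omega)
    refine ⟨?_, ?_⟩
    · simp only [value_sub, value_get, value_ofNat, h1, h3, h926, hg.len]; omega
    simp only [value_sub, value_get, value_ofNat, h1, h3, h926, hg.len, ← hk]
    refine ⟨?_, ?_⟩
    · simp [h926, hg.len, h10]
      exact (ZMod.val_lt _).trans hp
    simp only [value_add, value_get, value_ofNat, write_same, Function.update_self,
      write_ne _ _ _ (show (25 : ℕ) ≠ 28 by decide), write_ne _ _ _ (show (26 : ℕ) ≠ 28 by decide),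
      h926, hg.len, h10]
    set s1 := (s'.write 28 0 k).write 29 0 (r.coeff (k + d)).val with hs1
    have hs1f : Frame [24, 25, 27, 28, 29] s s1 := (h2.write (by simp) _ _).write (by simp) _ _
    set r' := r - C (r.coeff (k + d)) * (X ^ k * g) with hr'
    have hc : ∀ i, r'.coeff i =
        r.coeff i - r.coeff (k + d) * (if k ≤ i then g.coeff (i - k) else 0) := fun i => by
      rw [hr', coeff_sub, coeff_C_mul, coeff_X_pow_mul']
    refine wp_vec d (k + 1) (fun l => (r'.coeff (k + l)).val) hd (by decide) ?_ ?_
    · intro l s2 hl h11 h12 h13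
      have h14 : Frame [24, 25, 27, 28, 29] s s2 := hs1f.trans h11 (by simp) (by simp)
      have h28 : s2 28 0 = k := by rw [h11 28 (by decide), hs1]; simp
      have h29 : s2 29 0 = (r.coeff (k + d)).val := by rw [h11 29 (by decide), hs1]; simp
      obtain ⟨h20, h226⟩ := hfr s2 h14
      refine ⟨by simp [h226, hg.len], by simp [h28], fun hld =>
        ⟨?_, (ZMod.val_lt _).trans hp⟩⟩
      simp only [value_mod, value_add, value_mul, value_sub, value_get, value_ofNat, h28, h29, h20,
        h226, hs, h12, hg.coeff l (by omega)]
      rw [mod_eq_val, h13 _ (by omega), hs1, write_ne _ _ _ (by decide), write_ne _ _ _ (by decide),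
        show k + 1 + l = k + l + 1 by ring, h6 _ (by omega)]
      push_cast
      rw [cast_sub_val, hc, if_pos (by omega), Nat.add_sub_cancel_left]
      simp [sub_eq_add_neg]
    · intro s2 h11 h12
      have h25 : ∀ j, s1 25 j = s' 25 j := fun j => by
        rw [hs1, write_ne _ _ _ (by decide), write_ne _ _ _ (by decide)]
      have h27 : s2 27 0 = t := by rw [h11 27 (by decide), hs1]; simp [h1]
      have hw : ∀ j, s2.write 27 0 (t + 1) 25 j = s2 25 j := fun j => by simp
      refine ⟨h27, by simp,
        (hs1f.trans h11 (by simp) (by simp)).write (by simp) _ _, ?_,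
        q + C (r.coeff (k + d)) * X ^ k, r', ?_, fun i hi => ?_, fun i hi => ?_, fun i hi hi' => ?_,
        fun i hi => ?_⟩
      · rw [hw, h12, if_neg (by omega), h25, h3]
      · rw [h4, hr']; ring
      · rw [hc]
        rcases eq_or_lt_of_le (show k + d ≤ i by omega) with rfl | hlt
        · simp [hgd1]
        · rw [h5 i (by omega), if_pos (by omega), hg.zero _ (by omega)]; simp
      · rw [hw, h12]
        split_ifs with h13
        · congr 2; omega
        · rw [h25, h6 i (by omega), hc, if_neg (by omega)]; simp
      · rw [hw, h12, if_neg (by omega), h25]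
        rcases eq_or_ne i (k + d) with rfl | hne
        · rw [h6 _ (by omega)]
          simp [h8 k (by omega)]
        · rw [h7 i (by omega) hi']
          simp only [coeff_add, coeff_C_mul, coeff_X_pow]
          rw [if_neg (by omega)]; simp
      · simp only [coeff_add, coeff_C_mul, coeff_X_pow]
        rw [h8 i (by omega), if_neg (by omega)]; simp
  · rintro s' ⟨h1, h2, h3, q, r, h4, h5, h6, h7, h8⟩
    have hdeg : r.degree < g.degree := by
      rw [degree_eq_natDegree hgm.ne_zero, hgd, degree_lt_iff_coeff_zero]
      intro i hi
      rcases le_or_gt (n - (n - d)) i with h9 | h9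
      · exact h5 i h9
      · omega
    obtain ⟨h9, h10⟩ := div_modByMonic_unique q r hgm ⟨add_comm _ _, hdeg⟩
    rw [← h4] at h9 h10
    rw [h9, h10]
    exact ⟨h2, h3, fun i hi hi' => h6 i (by omega), fun i hi hi' => h7 i (by omega) hi⟩

/-- The product modulo the monic polynomial in the array `26` of the polynomials in the arrays `a`
and `b`, in the array `25`. -/
def mulMod (a b : ℕ) : Prog :=
  -- With truncated subtraction, x - (x - d) is the minimum of x and d.
  mul a b ;; divide ;; .store 25 0 (var 25 - (var 25 - (var 26 - 1)))

theorem wp_mulMod {N p a b : ℕ} [Fact p.Prime] {s : State} {f g h : (ZMod p)[X]} {n m d : ℕ}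
    (hs : s 0 1 = p) (hp : p < 2 ^ N) (hn : n + m ≤ N) (hd : d ≤ N) (ha : a ∉ [23, 24, 25])
    (hb : b ∉ [23, 24, 25]) (hf : Rep (s a) f n) (hg : Rep (s b) g m)
    (hh : Rep (s 26) h (d + 1)) (hhm : h.Monic) (hhd : h.natDegree = d) :
    wp N (mulMod a b) (fun s' => Frame [23, 24, 25, 27, 28, 29] s s' ∧
      Rep (s' 25) ((f * g) %ₘ h) (min (n + m - 1) d)) s := by
  have hN : N < 2 ^ N := Nat.lt_two_pow_self
  refine wp_seq (wp_mul hs hp hn ha hb hf hg) ?_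
  rintro s1 ⟨h1, h2⟩
  refine wp_seq (wp_divide (by rw [h1 0 (by decide), hs]) hp (by omega) hd h2
    (by rw [h1 26 (by decide)]; exact hh) hhm hhd) ?_
  rintro s2 ⟨h3, h4, h5, h6⟩
  have h26 : s2 26 0 = d + 1 := by rw [h3 26 (by decide), h1 26 (by decide), hh.len]
  refine ⟨by simp [h4, h26]; omega, ((h1.trans h3 (m := [23, 24, 25, 27, 28, 29]) (by simp) (by simp)).write
    (by simp) _ _), ?_, fun i hi => ?_, fun i hi => ?_⟩
  · simp [h4, h26]; omega
  · simp only [write_same, value_ofNat]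
    rw [Function.update_of_ne (by omega), h5 i (by omega) (by omega)]
  · rcases le_or_gt d i with h7 | h7
    · refine coeff_eq_zero_of_degree_lt ((degree_modByMonic_lt _ hhm).trans_le ?_)
      rw [degree_eq_natDegree hhm.ne_zero, hhd]
      exact_mod_cast h7
    · have h8 : (f * g) %ₘ h = f * g := by
        rw [modByMonic_eq_self_iff hhm, degree_eq_natDegree hhm.ne_zero, hhd,
          degree_lt_iff_coeff_zero]
        exact fun j hj => h2.zero j (by omega)
      rw [h8]
      exact h2.zero i (by omega)

/-! ### Exact lengths, normalization and greatest common divisors -/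

/-- One more than the degree of a nonzero polynomial, and `0` for the polynomial `0`. -/
noncomputable def plen {p : ℕ} (f : (ZMod p)[X]) : ℕ :=
  open Classical in if f = 0 then 0 else f.natDegree + 1

theorem plen_zero {p : ℕ} : plen (0 : (ZMod p)[X]) = 0 := if_pos rfl

theorem plen_of_ne {p : ℕ} {f : (ZMod p)[X]} (h : f ≠ 0) : plen f = f.natDegree + 1 := if_neg h

theorem plen_eq_zero {p : ℕ} {f : (ZMod p)[X]} : plen f = 0 ↔ f = 0 := by
  unfold plen
  split_ifs with h <;> simp [h]

theorem plen_le {p : ℕ} {f : (ZMod p)[X]} {n : ℕ} (h : ∀ i, n ≤ i → f.coeff i = 0) :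
    plen f ≤ n := by
  unfold plen
  split_ifs with h0
  · omega
  · by_contra! h1
    exact h0 (leadingCoeff_eq_zero.1 (h f.natDegree (by omega)))

theorem coeff_eq_zero_of_plen_le {p : ℕ} {f : (ZMod p)[X]} {i : ℕ} (h : plen f ≤ i) :
    f.coeff i = 0 := by
  unfold plen at h
  split_ifs at h with h0
  · simp [h0]
  · exact coeff_eq_zero_of_natDegree_lt (by omega)

theorem Rep.plen_le {p : ℕ} {A : ℕ → ℕ} {f : (ZMod p)[X]} {n : ℕ} (h : Rep A f n) :
    plen f ≤ n := Ram.plen_le h.zero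

theorem plen_eq {p : ℕ} {f : (ZMod p)[X]} {n : ℕ} (h : ∀ i, n ≤ i → f.coeff i = 0)
    (hn : n = 0 ∨ f.coeff (n - 1) ≠ 0) : plen f = n := by
  refine le_antisymm (plen_le h) ?_
  by_contra! h1
  rcases hn with hn | hn
  · omega
  · exact hn (coeff_eq_zero_of_plen_le (by omega))

/-- Drop the leading zeros of the polynomial in the array `a`. -/
def trim (a : ℕ) : Prog :=
  -- The guard is nonzero exactly if the length is positive and the top coefficient is zero.
  .loop (var a * (1 - .get a (var a))) (.store a 0 (var a - 1))

theorem wp_trim {N p a : ℕ} [NeZero p] {s : State} {f : (ZMod p)[X]} {n : ℕ} (hn : n ≤ N)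
    (hf : Rep (s a) f n) :
    wp N (trim a) (fun s' => Frame [a] s s' ∧ Rep (s' a) f (plen f)) s := by
  have hN : N < 2 ^ N := Nat.lt_two_pow_self
  refine ⟨fun k s' => ∃ n, n ≤ k ∧ n ≤ N ∧ Frame [a] s s' ∧ Rep (s' a) f n,
    ⟨n, hn, hn, Frame.refl _ _, hf⟩, ?_⟩
  rintro k s' ⟨n, hk, hnN, h1, h2⟩
  simp only [value_mul, value_get, value_sub, value_ofNat, h2.len]
  refine ⟨fun h => ⟨h1, ?_⟩, fun h => ?_⟩
  · have : plen f = n := plen_eq h2.zero (by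
      rcases Nat.eq_zero_or_pos n with h3 | h3
      · exact Or.inl h3
      · right
        intro h4
        have h5 := h2.coeff (n - 1) (by omega)
        rw [Nat.sub_add_cancel h3, h4, ZMod.val_zero] at h5
        rw [h5] at h
        simp at h
        omega)
    rw [this]; exact h2
  · have h3 : n ≠ 0 := fun h3 => by simp [h3] at h
    have h4 : s' a n = 0 := by
      by_contra h4
      rw [Nat.sub_eq_zero_of_le (by omega)] at h
      simp at h
    have h5 := h2.coeff (n - 1) (by omega)
    rw [Nat.sub_add_cancel (by omega), h4] at h5
    refine ⟨k - 1, by omega, by simp [h2.len]; omega, n - 1, by omega, by omega,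
      h1.write (by simp) _ _, by simp [h2.len], fun i hi => ?_, fun i hi => ?_⟩
    · simp [h2.coeff i (by omega)]
    · rcases eq_or_ne i (n - 1) with rfl | h6
      · exact (ZMod.val_eq_zero _).1 h5.symm
      · exact h2.zero i (by omega)

/-- For the polynomials `f` and `g` in the arrays `a` and `b`, the polynomial `f` is replaced by a
combination of `f` and `g` in which the leading terms cancel. -/
def eliminate (a b : ℕ) : Prog :=
  vec 12 (var a - 1) a 1 ((.get b (var b) * .get a (1 + var 12) + (modulus - .get a (var a)) *
    -- A switch in truncated arithmetic: the first factor is 0 below the degree shift of the second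
    -- polynomial, and 1 from there on.
    ((1 - ((var a - var b) - var 12)) * .get b (var 12 + 1 - (var a - var b)))) % modulus) ;;
  .store a 0 (var a - 1)

/-- Cross-multiplication by the two leading coefficients cancels the terms of degree n - 1 without
an inversion in the field. The top entry of f is read in every pass; it survives because only the n
- 1 lower entries are overwritten. -/
theorem wp_eliminate {N p a b : ℕ} [NeZero p] {s : State} {f g : (ZMod p)[X]} {n m : ℕ}
    (hs : s 0 1 = p) (hp : p < 2 ^ N) (hn : n ≤ N) (hab : b ≠ a) (ha : a ∉ [0, 12])
    (hb : b ≠ 12) (hm : 1 ≤ m) (hmn : m ≤ n) (hf : Rep (s a) f n) (hg : Rep (s b) g m) :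
    wp N (eliminate a b) (fun s' => Frame [12, a] s s' ∧ Rep (s' a)
      (C (g.coeff (m - 1)) * f - C (f.coeff (n - 1)) * (X ^ (n - m) * g)) (n - 1)) s := by
  have hN : N < 2 ^ N := Nat.lt_two_pow_self
  simp only [List.mem_cons, List.not_mem_nil, or_false, not_or] at ha
  set h := C (g.coeff (m - 1)) * f - C (f.coeff (n - 1)) * (X ^ (n - m) * g) with hh
  have hc : ∀ i, h.coeff i = g.coeff (m - 1) * f.coeff i -
      f.coeff (n - 1) * (if n - m ≤ i then g.coeff (i - (n - m)) else 0) := fun i => by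
    rw [hh, coeff_sub, coeff_C_mul, coeff_C_mul, coeff_X_pow_mul']
  have htop : s a n = (f.coeff (n - 1)).val := by
    have := hf.coeff (n - 1) (by omega)
    rwa [Nat.sub_add_cancel (by omega)] at this
  have htop' : s b m = (g.coeff (m - 1)).val := by
    have := hg.coeff (m - 1) (by omega)
    rwa [Nat.sub_add_cancel (by omega)] at this
  refine wp_vec (n - 1) 1 (fun i => (h.coeff i).val) (by omega) ha.2 ?_ ?_
  · intro k s' hk h1 h2 h3
    have hb' : s' b = s b := h1 b (by simp [hab, hb])
    have h0' : s' 0 = s 0 := h1 0 (by simp; omega)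
    have ha0 : s' a 0 = n := by rw [h3 0 (by omega), hf.len]
    refine ⟨by simp [ha0], rfl, fun hk' => ⟨?_, (ZMod.val_lt _).trans hp⟩⟩
    simp only [value_mod, value_add, value_mul, value_sub, value_get, value_ofNat, h2, hb', h0', hs,
      ha0, hg.len, htop']
    rw [h3 n (by omega), h3 (1 + k) (by omega), add_comm 1 k, hf.coeff k (by omega), htop,
      mod_eq_val, hc]
    congr 1
    push_cast
    rw [cast_sub_val]
    split_ifs with h4
    · rw [show n - m - k = 0 by omega, show k + 1 - (n - m) = k - (n - m) + 1 by omega,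
        hg.coeff _ (by omega)]
      simp [sub_eq_add_neg]
    · rw [show 1 - (n - m - k) = 0 by omega]
      simp
  · intro s' h1 h2
    have ha0 : s' a 0 = n := by rw [h2 0, if_neg (by omega), hf.len]
    refine ⟨by simp [ha0]; omega, h1.write (by simp) _ _, by simp [ha0], fun i hi => ?_,
      fun i hi => ?_⟩
    · simp only [write_same, value_ofNat]
      rw [Function.update_of_ne (by omega), h2, if_pos (by omega)]
      congr 2
    · rw [hc]
      rcases eq_or_ne i (n - 1) with rfl | h3
      · rw [if_pos (by omega), show n - 1 - (n - m) = m - 1 by omega]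
        ring
      · rw [hf.zero i (by omega)]
        split_ifs with h4
        · rw [hg.zero (i - (n - m)) (by omega)]; simp
        · simp

/-- Divide the polynomial in the array `10` by its leading coefficient. -/
def makeMonic : Prog :=
  .cond (var 10) (
    .store 15 0 (.get 10 (var 10)) ;; .store 16 0 (modulus - 2) ;; .store 17 0 1 ;;
    .loop (var 16) (
      .cond (var 16 % 2) (.store 17 0 (var 17 * var 15 % modulus)) .skip ;;
      .store 15 0 (var 15 * var 15 % modulus) ;; .store 16 0 (var 16 / 2)) ;;
    vec 12 (var 10) 10 1 (.get 10 (1 + var 12) * var 17 % modulus)) .skip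

theorem wp_makeMonic {N p : ℕ} [Fact p.Prime] {s : State} {f : (ZMod p)[X]}
    (hs : s 0 1 = p) (hp : p < 2 ^ N) (hn : plen f ≤ N) (hf : Rep (s 10) f (plen f)) :
    wp N makeMonic (fun s' => Frame [10, 12, 15, 16, 17] s s' ∧
      Rep (s' 10) (normalize f) (plen f)) s := by
  have hp2 : 2 ≤ p := (Fact.out : p.Prime).two_le
  have hN1 : 1 < 2 ^ N := by omega
  refine ⟨fun h => ?_, fun h => ?_⟩
  swap
  · have : f = 0 := plen_eq_zero.1 (by simpa [hf.len] using h)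
    exact ⟨Frame.refl _ _, by simpa [this] using hf⟩
  have hf0 : f ≠ 0 := fun h0 => by simp [hf.len, h0, plen_zero] at h
  have hlen := plen_of_ne hf0
  have htop : s 10 (plen f) = f.leadingCoeff.val := by rw [hlen, hf.coeff _ (by omega)]; rfl
  have hl0 : f.leadingCoeff ≠ 0 := leadingCoeff_ne_zero.2 hf0
  have hinv : f.leadingCoeff ^ (p - 2) = f.leadingCoeff⁻¹ := by
    refine eq_inv_of_mul_eq_one_left ?_
    rw [← pow_succ, show p - 2 + 1 = p - 1 by omega,
      ZMod.pow_card_sub_one_eq_one hl0]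
  have hlt : ∀ x : ZMod p, x.val < 2 ^ N := fun x => (ZMod.val_lt x).trans hp
  refine ⟨by simp [hf.len, htop, hlt], by simp [hs]; omega, by simpa using hN1, ?_⟩
  refine wp_seq (P := fun s' => Frame [15, 16, 17] s s' ∧ s' 17 0 = (f.leadingCoeff⁻¹).val) ?_ ?_
  -- Square and multiply for the exponent p - 2, which inverts the leading coefficient by Fermat.
  -- The invariant is r x^e = c⁻¹, and the bit length of e bounds the number of passes.
  · refine ⟨fun k s' => ∃ (x r : ZMod p) (e : ℕ), e < 2 ^ k ∧ e < 2 ^ N ∧ Frame [15, 16, 17] s s' ∧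
      s' 15 0 = x.val ∧ s' 16 0 = e ∧ s' 17 0 = r.val ∧ r * x ^ e = f.leadingCoeff⁻¹,
      ⟨f.leadingCoeff, 1, p - 2, by omega, by omega,
        (((Frame.refl _ _).write (by simp) _ _).write (by simp) _ _).write (by simp) _ _,
        by simp [hf.len, htop], by simp [hs], ?_, by rw [one_mul, hinv]⟩, ?_⟩
    · have : Fact (1 < p) := ⟨by omega⟩
      simp [ZMod.val_one]
    rintro k s' ⟨x, r, e, hk, heN, h1, h2, h3, h4, h5⟩
    simp only [value_get, value_ofNat, h3]
    refine ⟨fun he => ⟨h1, ?_⟩, fun he => ?_⟩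
    · rw [he, pow_zero, mul_one] at h5
      rw [h4, h5]
    obtain ⟨k, rfl⟩ : ∃ k', k = k' + 1 := by
      cases k with
      | zero => simp at hk; omega
      | succ k => exact ⟨k, rfl⟩
    refine ⟨k, rfl, ?_⟩
    refine wp_seq (P := fun s'' => ∃ r' : ZMod p, Frame [15, 16, 17] s s'' ∧ s'' 15 0 = x.val ∧
      s'' 16 0 = e ∧ s'' 17 0 = r'.val ∧ r' * (x * x) ^ (e / 2) = f.leadingCoeff⁻¹) ?_ ?_
    · refine ⟨fun he2 => ⟨?_, r * x, h1.write (by simp) _ _, by simp [h2], by simp [h3], ?_, ?_⟩,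
        fun he2 => ⟨r, h1, h2, h3, h4, ?_⟩⟩
      · simp only [value_mod, value_mul, value_get, value_ofNat, h1 0 (by decide), hs]
        exact (Nat.mod_lt _ (by omega)).trans hp
      · simp [h1 0, hs, h2, h4, mod_eq_val p]
      · simp only [value_mod, value_get, value_ofNat, h3] at he2
        rw [← h5, ← sq, ← pow_mul, mul_assoc, ← pow_succ', show 2 * (e / 2) + 1 = e by omega]
      · simp only [value_mod, value_get, value_ofNat, h3] at he2
        rw [← h5, ← sq, ← pow_mul, show 2 * (e / 2) = e by omega]
    · rintro s'' ⟨r', g1, g2, g3, g4, g5⟩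
      refine ⟨?_, ?_, x * x, r', e / 2, by rw [pow_succ] at hk; omega, by omega,
        (g1.write (by simp) _ _).write (by simp) _ _, ?_, by simp [g3], by simp [g4], g5⟩
      · simp only [value_mod, value_mul, value_get, value_ofNat, g1 0 (by decide), hs]
        exact (Nat.mod_lt _ (by omega)).trans hp
      · simp only [value_div, value_get, value_ofNat,
          write_ne _ _ _ (show (16 : ℕ) ≠ 15 by decide), g3]
        omega
      · simp [g1 0, hs, g2, mod_eq_val p]
  · rintro s1 ⟨h1, h2⟩
    have h10 : s1 10 = s 10 := h1 10 (by decide)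
    refine wp_vec (plen f) 1 (fun i => ((normalize f).coeff i).val) hn (by decide) ?_ ?_
    · intro k s' hk h3 h4 h5
      have h17 : s' 17 = s1 17 := h3 17 (by decide)
      have h0' : s' 0 = s 0 := by rw [h3 0 (by decide), h1 0 (by decide)]
      refine ⟨by simp [h5 0, h10, hf.len], rfl, fun hk' => ⟨?_, hlt _⟩⟩
      simp only [value_mod, value_add, value_mul, value_get, value_ofNat, h4, h17, h2, h0', hs]
      rw [h5 _ (by omega), h10, add_comm 1 k, hf.coeff k hk', mod_eq_val]
      simp [normalize_apply, hf0]
    · intro s' h3 h4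
      refine ⟨h1.trans h3 (by simp) (by simp), ?_, fun i hi => ?_, fun i hi => ?_⟩
      · rw [h4, if_neg (by omega), h10, hf.len]
      · rw [h4, if_pos (by omega)]; rfl
      · simp [normalize_apply, hf.zero i hi]

/-- The greatest common divisor that is monic or `0`. -/
noncomputable def mgcd {p : ℕ} [Fact p.Prime] (f g : (ZMod p)[X]) : (ZMod p)[X] :=
  open Classical in normalize (EuclideanDomain.gcd f g)

theorem dvd_mgcd {p : ℕ} [Fact p.Prime] {f g q : (ZMod p)[X]} :
    q ∣ mgcd f g ↔ q ∣ f ∧ q ∣ g := by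
  classical
  unfold mgcd
  rw [dvd_normalize_iff]
  exact ⟨fun h => ⟨h.trans (EuclideanDomain.gcd_dvd_left _ _),
    h.trans (EuclideanDomain.gcd_dvd_right _ _)⟩, fun h => EuclideanDomain.dvd_gcd h.1 h.2⟩

/-- A polynomial is determined up to a unit by its divisors, so the Euclidean loop only has to
preserve the set of common divisors. -/
theorem normalize_eq_mgcd {p : ℕ} [Fact p.Prime] {f g h : (ZMod p)[X]}
    (H : ∀ q, q ∣ h ↔ q ∣ f ∧ q ∣ g) : normalize h = mgcd f g := by
  classical
  have h1 : h ∣ mgcd f g := dvd_mgcd.2 ((H h).1 dvd_rfl)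
  have h2 : mgcd f g ∣ h := (H _).2 (dvd_mgcd.1 dvd_rfl)
  unfold mgcd at *
  rw [← normalize_idem (EuclideanDomain.gcd f g)]
  exact normalize_eq_normalize h1 h2

theorem monic_mgcd {p : ℕ} [Fact p.Prime] {f g : (ZMod p)[X]} (h : mgcd f g ≠ 0) :
    (mgcd f g).Monic := by
  classical
  unfold mgcd at *
  exact monic_normalize fun h0 => h (by rw [h0, normalize_zero])

theorem plen_normalize {p : ℕ} [Fact p.Prime] (f : (ZMod p)[X]) : plen (normalize f) = plen f := by
  classical
  by_cases h : f = 0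
  · simp [h]
  · rw [plen_of_ne h, plen_of_ne (by simpa using h), natDegree_eq_of_degree_eq degree_normalize]

/-- The monic greatest common divisor of the polynomials in the arrays `10` and `11`, in the
array `10`. -/
def gcd : Prog :=
  .loop (var 10 * var 11)
    (.cond (.get 11 (var 11))
      (.cond (.get 10 (var 10))
        (.cond (var 10 + 1 - var 11) (eliminate 10 11) (eliminate 11 10))
        (.store 10 0 (var 10 - 1)))
      (.store 11 0 (var 11 - 1))) ;;
  .cond (var 10) .skip (copy 12 10 0 11 0) ;; trim 10 ;; makeMonic

/-- The constant c is a unit, and the subtracted term is a multiple of g. -/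
theorem dvd_eliminate {p : ℕ} [Fact p.Prime] {f g q : (ZMod p)[X]} {c d : ZMod p} (hc : c ≠ 0)
    (k : ℕ) : q ∣ C c * f - C d * (X ^ k * g) ∧ q ∣ g ↔ q ∣ f ∧ q ∣ g := by
  refine and_congr_left fun hg => ?_
  rw [dvd_sub_left ((hg.mul_left _).mul_left _)]
  exact (IsUnit.map C hc.isUnit).dvd_mul_left

theorem Rep.store_len {p : ℕ} {s : State} {a : ℕ} {f : (ZMod p)[X]} {n : ℕ} [NeZero p]
    (h : Rep (s a) f n) (hn : n ≠ 0) (h0 : s a n = 0) :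
    Rep (s.write a 0 (n - 1) a) f (n - 1) := by
  refine ⟨by simp, fun i hi => by simp [h.coeff i (by omega)], fun i hi => ?_⟩
  rcases eq_or_ne i (n - 1) with rfl | h6
  · have h5 := h.coeff (n - 1) (by omega)
    rw [Nat.sub_add_cancel (by omega), h0] at h5
    exact (ZMod.val_eq_zero _).1 h5.symm
  · exact h.zero i (by omega)

theorem Rep.top_ne_zero {p : ℕ} {A : ℕ → ℕ} {f : (ZMod p)[X]} {n : ℕ}
    (h : Rep A f n) (hn : n ≠ 0) (h0 : A n ≠ 0) : f.coeff (n - 1) ≠ 0 := by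
  intro h1
  have h5 := h.coeff (n - 1) (by omega)
  rw [Nat.sub_add_cancel (by omega), h1, ZMod.val_zero] at h5
  exact h0 h5

/-- Every pass shortens one of the two polynomials by one, either by dropping a vanishing leading
coefficient or by an elimination. The sum of the lengths therefore bounds the passes. When one
polynomial has length 0, the other one has the required divisors. -/
theorem wp_gcd {N p : ℕ} [Fact p.Prime] {s : State} {f g : (ZMod p)[X]} {n m : ℕ}
    (hs : s 0 1 = p) (hp : p < 2 ^ N) (hn : n + m + 1 ≤ N) (hf : Rep (s 10) f n)
    (hg : Rep (s 11) g m) :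
    wp N gcd (fun s' => Frame [10, 11, 12, 15, 16, 17] s s' ∧
      Rep (s' 10) (mgcd f g) (plen (mgcd f g))) s := by
  have hN : N < 2 ^ N := Nat.lt_two_pow_self
  refine wp_seq (P := fun s' => ∃ a b n m, (n = 0 ∨ m = 0) ∧ n + m + 1 ≤ N ∧
    Frame [10, 11, 12] s s' ∧ Rep (s' 10) a n ∧ Rep (s' 11) b m ∧
    ∀ q, q ∣ a ∧ q ∣ b ↔ q ∣ f ∧ q ∣ g) ?_ ?_
  · refine ⟨fun k s' => ∃ a b n m, n + m + 1 ≤ N ∧ n + m ≤ k ∧ Frame [10, 11, 12] s s' ∧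
      Rep (s' 10) a n ∧ Rep (s' 11) b m ∧ ∀ q, q ∣ a ∧ q ∣ b ↔ q ∣ f ∧ q ∣ g,
      ⟨f, g, n, m, hn, by omega, Frame.refl _ _, hf, hg, fun q => Iff.rfl⟩, ?_⟩
    rintro k s' ⟨a, b, n, m, h1, h2, h3, h4, h5, h6⟩
    simp only [value_mul, value_get, value_ofNat, h4.len, h5.len]
    refine ⟨fun h => ⟨a, b, n, m, by simpa using h, h1, h3, h4, h5, h6⟩, fun h => ?_⟩
    have hn0 : n ≠ 0 := fun h0 => by simp [h0] at h
    have hm0 : m ≠ 0 := fun h0 => by simp [h0] at h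
    have hs' : s' 0 1 = p := by rw [h3 0 (by decide), hs]
    refine ⟨k - 1, by omega, fun hb => ⟨fun ha => ⟨fun hd => ?_, fun hd => ?_⟩, fun ha => ?_⟩,
      fun hb => ?_⟩
    · simp only [value_add, value_sub, value_get, value_ofNat, h4.len, h5.len] at ha hb hd
      refine wp_mono ?_ (wp_eliminate hs' hp (by omega) (by decide) (by decide) (by decide)
        (by omega) (by omega) h4 h5)
      rintro s'' ⟨h7, h8⟩
      refine ⟨_, b, n - 1, m, by omega, by omega, h3.trans h7 (by simp) (by simp), h8,
        by rw [h7 11 (by decide)]; exact h5, fun q => ?_⟩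
      rw [← h6, dvd_eliminate (h5.top_ne_zero hm0 hb)]
    · simp only [value_add, value_sub, value_get, value_ofNat, h4.len, h5.len] at ha hb hd
      refine wp_mono ?_ (wp_eliminate hs' hp (by omega) (by decide) (by decide) (by decide)
        (by omega) (by omega) h5 h4)
      rintro s'' ⟨h7, h8⟩
      refine ⟨a, _, n, m - 1, by omega, by omega, h3.trans h7 (by simp) (by simp),
        by rw [h7 10 (by decide)]; exact h4, h8, fun q => ?_⟩
      rw [← h6, and_comm, dvd_eliminate (h4.top_ne_zero hn0 ha), and_comm]
    · simp only [value_get, value_ofNat, h4.len] at ha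
      refine ⟨by simp [h4.len]; omega, a, b, n - 1, m, by omega, by omega,
        h3.write (by simp) _ _, ?_, by simpa using h5, h6⟩
      simpa [h4.len] using h4.store_len hn0 ha
    · simp only [value_get, value_ofNat, h5.len] at hb
      refine ⟨by simp [h5.len]; omega, a, b, n, m - 1, by omega, by omega,
        h3.write (by simp) _ _, by simpa using h4, ?_, h6⟩
      simpa [h5.len] using h5.store_len hm0 hb
  · rintro s1 ⟨a, b, n, m, h0, h1, h2, h3, h4, h5⟩
    refine wp_seq (P := fun s' => ∃ c n, n ≤ N ∧ Frame [10, 11, 12] s s' ∧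
      Rep (s' 10) c n ∧ ∀ q, q ∣ c ↔ q ∣ f ∧ q ∣ g) ?_ ?_
    · refine ⟨fun h => ?_, fun h => ?_⟩
      · simp only [value_get, value_ofNat, h3.len] at h
        have hm : m = 0 := by omega
        have hb : b = 0 := by ext i; simp [h4.zero i (by omega)]
        exact ⟨a, n, by omega, h2, h3, fun q => by rw [← h5, hb]; simp⟩
      · simp only [value_get, value_ofNat, h3.len] at h
        have ha : a = 0 := by ext i; simp [h3.zero i (by omega)]
        refine wp_copy (n := m) (oA := 0) (oB := 0) (f := b) hp (by omega) (by decide) (by decide)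
          (by decide) (fun _ _ => rfl) (fun _ _ => rfl) (by simpa using h4) ?_
        intro s' h6 h7 h8
        exact ⟨b, m, by omega, h2.trans h6 (by simp) (by simp), by simpa using h7,
          fun q => by rw [← h5, ha]; simp⟩
    · rintro s2 ⟨c, n, hn, h6, h7, h8⟩
      refine wp_seq (wp_trim hn h7) ?_
      rintro s3 ⟨h9, h10⟩
      have h11 := h6.trans h9 (m := [10, 11, 12]) (by simp) (by simp)
      refine wp_mono ?_ (wp_makeMonic (by rw [h11 0 (by decide), hs]) hp
        (h7.plen_le.trans hn) h10)
      rintro s4 ⟨h12, h13⟩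
      refine ⟨h11.trans h12 (by simp) (by simp), ?_⟩
      rw [← normalize_eq_mgcd h8, plen_normalize]
      exact h13

/-! ### Modular powers, linear shifts and quotients -/

/-- The power with exponent `var 32` of the polynomial in the array `31`, modulo the monic
polynomial in the array `26`, in the array `30`. -/
def powMod : Prog :=
  .store 30 0 1 ;; .store 30 1 1 ;;
  .loop (var 32) (
    .cond (var 32 % 2) (mulMod 30 31 ;; copy 33 30 0 25 0) .skip ;;
    mulMod 31 31 ;; copy 33 31 0 25 0 ;; .store 32 0 (var 32 / 2))

theorem mul_modByMonic_left {R : Type*} [CommRing R] {h : R[X]} (hh : h.Monic) (f g : R[X]) :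
    ((f %ₘ h) * g) %ₘ h = (f * g) %ₘ h := by
  refine modByMonic_eq_of_dvd_sub hh ⟨-(f /ₘ h * g), ?_⟩
  have := modByMonic_add_div f h
  linear_combination g * this

theorem pow_modByMonic {R : Type*} [CommRing R] {h : R[X]} (hh : h.Monic) (f : R[X]) (n : ℕ) :
    (f %ₘ h) ^ n %ₘ h = f ^ n %ₘ h := by
  induction n with
  | zero => simp
  | succ n ih =>
    rw [pow_succ', mul_modByMonic_left hh, mul_comm, ← mul_modByMonic_left hh, ih,
      mul_modByMonic_left hh, ← pow_succ]

/-- Square and multiply, with all intermediate lengths bounded by L. The exponent must be nonzero: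
the accumulator starts with an unreduced 1, which is wrong as a remainder if h = 1. -/
theorem wp_powMod {N p : ℕ} [Fact p.Prime] {s : State} {f h : (ZMod p)[X]} {n d e L : ℕ}
    (hs : s 0 1 = p) (hp : p < 2 ^ N) (hL : 2 * L + 1 ≤ N) (hL1 : 1 ≤ L) (hn : n ≤ L) (hd : d ≤ L)
    (hf : Rep (s 31) f n) (hh : Rep (s 26) h (d + 1)) (hhm : h.Monic) (hhd : h.natDegree = d)
    (he : s 32 0 = e) (he0 : e ≠ 0) (heN : e < 2 ^ N) :
    wp N powMod (fun s' => Frame [23, 24, 25, 27, 28, 29, 30, 31, 32, 33] s s' ∧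
      ∃ l ≤ L, Rep (s' 30) (f ^ e %ₘ h) l) s := by
  have hN : N < 2 ^ N := Nat.lt_two_pow_self
  set F := [23, 24, 25, 27, 28, 29, 30, 31, 32, 33] with hF
  have hone : ((1 : ZMod p)).val = 1 := by
    have : Fact (1 < p) := ⟨(Fact.out : p.Prime).one_lt⟩
    exact ZMod.val_one p
  refine ⟨by simp; omega, by simp; omega, ?_⟩
  set s₁ := ((s.write 30 0 1).write 30 1 1) with hs₁
  have hs₁F : Frame F s s₁ := ((Frame.refl _ _).write (by simp [hF]) _ _).write (by simp [hF]) _ _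
  -- The last clause records that the accumulator is reduced when the exponent is used up. This
  -- holds because the last pass has exponent 1, hence multiplies and reduces.
  refine ⟨fun k s' => ∃ (x r : (ZMod p)[X]) (n l e' : ℕ), e' < 2 ^ k ∧ e' < 2 ^ N ∧ Frame F s s' ∧
    n ≤ L ∧ l ≤ L ∧ Rep (s' 31) x n ∧ Rep (s' 30) r l ∧ s' 32 0 = e' ∧
    (r * x ^ e') %ₘ h = f ^ e %ₘ h ∧ (e' = 0 → r %ₘ h = r),
    ⟨f, 1, n, 1, e, heN, heN, hs₁F, hn, hL1, by simpa [hs₁] using hf, ?_, by simpa [hs₁] using he,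
      by rw [one_mul], fun h0 => absurd h0 he0⟩, ?_⟩
  · refine ⟨by simp, fun i hi => ?_, fun i hi => ?_⟩
    · obtain rfl : i = 0 := by omega
      simp [hone]
    · rw [coeff_one, if_neg (by omega)]
  rintro k s' ⟨x, r, n, l, e', hk, heN', h1, hn, hl, h2, h3, h4, h5, h6⟩
  simp only [value_get, value_ofNat, h4]
  refine ⟨fun h0 => ⟨h1, l, hl, ?_⟩, fun h0 => ?_⟩
  · have h7 := h6 h0
    rw [h0, pow_zero, mul_one, h7] at h5
    rwa [← h5]
  obtain ⟨k, rfl⟩ : ∃ k', k = k' + 1 := by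
    cases k with
    | zero => simp at hk; omega
    | succ k => exact ⟨k, rfl⟩
  refine ⟨k, rfl, ?_⟩
  have h26 : ∀ s', Frame F s s' → Rep (s' 26) h (d + 1) := fun s' hs' => by
    rw [hs' 26 (by decide)]; exact hh
  have h01 : ∀ s', Frame F s s' → s' 0 1 = p := fun s' hs' => by rw [hs' 0 (by decide), hs]
  have hmm : ∀ q : (ZMod p)[X], (q %ₘ h) %ₘ h = q %ₘ h := fun q => by
    rw [modByMonic_eq_self_iff hhm]; exact degree_modByMonic_lt _ hhm
  refine wp_seq (P := fun s'' => ∃ (r' : (ZMod p)[X]) (l' : ℕ), Frame F s s'' ∧ l' ≤ L ∧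
    Rep (s'' 31) x n ∧ Rep (s'' 30) r' l' ∧ s'' 32 0 = e' ∧
      (r' * (x * x) ^ (e' / 2)) %ₘ h = f ^ e %ₘ h ∧ (e' / 2 = 0 → r' %ₘ h = r')) ?_ ?_
  · refine ⟨fun he2 => ?_, fun he2 => ⟨r, l, h1, hl, h2, h3, h4, ?_, ?_⟩⟩
    · simp only [value_mod, value_get, value_ofNat, h4] at he2
      refine wp_seq (wp_mulMod (h01 _ h1) hp (by omega) (by omega) (by decide) (by decide) h3 h2
        (h26 _ h1) hhm hhd) ?_
      rintro s2 ⟨g1, g2⟩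
      have g1' : Frame F s s2 := h1.trans g1 (by simp) (by simp [hF])
      refine wp_mono ?_ (wp_copy_zero g2 hp (by omega) (by decide) (by decide) (by decide))
      rintro s3 ⟨g3, g4⟩
      refine ⟨_, _, g1'.trans g3 (by simp) (by simp [hF]), ?_, ?_, g4, ?_, ?_, fun _ => hmm _⟩
      · omega
      · rw [g3 31 (by decide), g1 31 (by decide)]; exact h2
      · rw [g3 32 (by decide), g1 32 (by decide)]; exact h4
      · rw [mul_modByMonic_left hhm, ← h5, ← sq, ← pow_mul, mul_assoc, ← pow_succ',
          show 2 * (e' / 2) + 1 = e' by omega]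
    · simp only [value_mod, value_get, value_ofNat, h4] at he2
      rw [← h5, ← sq, ← pow_mul, show 2 * (e' / 2) = e' by omega]
    · simp only [value_mod, value_get, value_ofNat, h4] at he2
      intro he3
      exact h6 (by omega)
  · rintro s2 ⟨r', l', g1, g2, g3, g4, g5, g6, g7⟩
    refine wp_seq (wp_mulMod (h01 _ g1) hp (by omega) (by omega) (by decide) (by decide) g3 g3
      (h26 _ g1) hhm hhd) ?_
    rintro s3 ⟨g8, g9⟩
    refine wp_seq (wp_copy_zero g9 hp (by omega) (by decide) (by decide) (by decide)) ?_
    rintro s4 ⟨g10, g11⟩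
    have g12 : Frame F s s4 := (g1.trans g8 (m := F) (by simp) (by simp [hF])).trans g10 (by simp)
      (by simp [hF])
    have g13 : s4 32 0 = e' := by rw [g10 32 (by decide), g8 32 (by decide), g5]
    have g14 : s4 30 = s2 30 := by rw [g10 30 (by decide), g8 30 (by decide)]
    refine ⟨by simp [g13]; omega, _, r', min (n + n - 1) d, l', e' / 2, by rw [pow_succ] at hk; omega, by omega,
      g12.write (by simp [hF]) _ _, by omega, g2, by simpa using g11, by simpa [g14] using g4,
      by simp [g13], ?_, g7⟩
    rw [mul_comm, ← mul_modByMonic_left hhm, pow_modByMonic hhm, mul_modByMonic_left hhm, mul_comm,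
      g6]

/-- In the array `a`, the sum of the polynomial in the array `b` and of `c₀ + c₁ X`. -/
def addLinear (i a b : ℕ) (c₀ c₁ : Term) : Prog :=
  -- For index i and length n, the factors 1 - (1 - (n - i)), 1 - i and i (2 - i) are the indicators
  -- of i < n, i = 0 and i = 1.
  vec i (var b + 2) a 1 (((1 - (1 - (var b - var i))) * .get b (1 + var i) + (1 - var i) * c₀ +
    var i * (2 - var i) * c₁) % modulus) ;; .store a 0 (var b + 2)

theorem wp_addLinear {N p i a b : ℕ} [NeZero p] {c₀ c₁ : Term} {s : State} {f : (ZMod p)[X]}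
    {n x₀ x₁ : ℕ} (hs : s 0 1 = p) (hp : p < 2 ^ N) (hn : n + 2 ≤ N) (hab : b ≠ a) (hai : a ≠ i)
    (hbi : b ≠ i) (ha : a ≠ 0) (hi : i ≠ 0) (hf : Rep (s b) f n)
    (hc₀ : ∀ s', Frame [i, a] s s' → c₀.value s' = x₀)
    (hc₁ : ∀ s', Frame [i, a] s s' → c₁.value s' = x₁) :
    wp N (addLinear i a b c₀ c₁) (fun s' => Frame [i, a] s s' ∧
      Rep (s' a) (f + C (x₀ : ZMod p) + C (x₁ : ZMod p) * X) (n + 2)) s := by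
  have hN : N < 2 ^ N := Nat.lt_two_pow_self
  refine wp_seq (P := fun s' => Frame [i, a] s s' ∧ ∀ j, s' a j = if 1 ≤ j ∧ j < 1 + (n + 2) then
    ((f + C (x₀ : ZMod p) + C (x₁ : ZMod p) * X).coeff (j - 1)).val else s a j) ?_ ?_
  · refine wp_vec (n + 2) 1 (fun j => ((f + C (x₀ : ZMod p) + C (x₁ : ZMod p) * X).coeff j).val) hn
      hai ?_ fun s' h h' => ⟨h, h'⟩
    intro k s' hk h1 h2 h3
    have hb' : s' b = s b := h1 b (by simp [hab, hbi])
    have h0' : s' 0 = s 0 := h1 0 (by simp; omega)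
    refine ⟨by simp [hb', hf.len], rfl, fun hk' => ⟨?_, (ZMod.val_lt _).trans hp⟩⟩
    simp only [value_mod, value_add, value_mul, value_sub, value_get, value_ofNat, h2, hb', h0', hs,
      hf.len, hc₀ s' h1, hc₁ s' h1]
    have h4 : (1 - (1 - (n - k))) * s b (1 + k) = (f.coeff k).val := by
      rcases lt_or_ge k n with h | h
      · rw [show 1 - (1 - (n - k)) = 1 by omega, one_mul, add_comm, hf.coeff k h]
      · rw [show 1 - (1 - (n - k)) = 0 by omega, hf.zero k h]; simp
    rw [h4, mod_eq_val]
    congr 1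
    rw [coeff_add, coeff_add, coeff_C, coeff_C_mul, coeff_X]
    rcases k with _ | _ | k
    · simp
    · simp
    · simp
  · rintro s' ⟨h1, h2⟩
    have hb' : s' b = s b := h1 b (by simp [hab, hbi])
    refine ⟨by simp [hb', hf.len]; omega, h1.write (by simp) _ _, by simp [hb', hf.len],
      fun j hj => ?_, fun j hj => ?_⟩
    · simp only [write_same, value_ofNat]
      rw [Function.update_of_ne (by omega), h2, if_pos (by omega)]
      rfl
    · rw [coeff_add, coeff_add, coeff_C, coeff_C_mul, coeff_X, hf.zero j (by omega),
        if_neg (by omega), if_neg (by omega)]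
      simp

/-- The quotient of the polynomial in the array `25` by the monic polynomial in the array `26`, in
the array `a`. -/
def quotientTo (a : ℕ) : Prog :=
  divide ;; vec 12 (var 25 + 1 - var 26) a 1 (.get 25 (var 26 + var 12)) ;;
  .store a 0 (var 25 + 1 - var 26) ;; trim a

theorem wp_quotientTo {N p a : ℕ} [Fact p.Prime] {s : State} {f g : (ZMod p)[X]} {n d : ℕ}
    (hs : s 0 1 = p) (hp : p < 2 ^ N) (hn : n ≤ N) (hd : d ≤ N)
    (ha : a ∉ [12, 24, 25, 26, 27, 28, 29])
    (hf : Rep (s 25) f n) (hg : Rep (s 26) g (d + 1)) (hgm : g.Monic) (hgd : g.natDegree = d) :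
    wp N (quotientTo a) (fun s' => Frame [12, 24, 25, 27, 28, 29, a] s s' ∧
      Rep (s' a) (f /ₘ g) (plen (f /ₘ g))) s := by
  have hN : N < 2 ^ N := Nat.lt_two_pow_self
  simp only [List.mem_cons, List.not_mem_nil, or_false, not_or] at ha
  refine wp_seq (wp_divide hs hp hn hd hf hg hgm hgd) ?_
  rintro s1 ⟨h1, h2, h3, h4⟩
  have h26 : s1 26 0 = d + 1 := by rw [h1 26 (by decide), hg.len]
  have hz : ∀ j, n - d ≤ j → (f /ₘ g).coeff j = 0 := fun j hj => by
    rcases eq_or_ne (f /ₘ g) 0 with h0 | h0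
    · rw [h0, coeff_zero]
    refine coeff_eq_zero_of_natDegree_lt ?_
    rw [natDegree_divByMonic f hgm, hgd]
    have hf0 : f ≠ 0 := fun h => h0 (by rw [h, zero_divByMonic])
    have h5 := hf.plen_le
    rw [plen_of_ne hf0] at h5
    rcases Nat.lt_or_ge f.natDegree d with h6 | h6
    · exfalso
      apply h0
      rw [divByMonic_eq_zero_iff hgm, degree_eq_natDegree hf0, degree_eq_natDegree hgm.ne_zero, hgd]
      exact_mod_cast h6
    · omega
  refine wp_seq (P := fun s' => Frame [12, a] s1 s' ∧ ∀ j, s' a j = if 1 ≤ j ∧ j < 1 + (n - d) then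
    ((f /ₘ g).coeff (j - 1)).val else s1 a j) ?_ ?_
  · refine wp_vec (n - d) 1 (fun j => ((f /ₘ g).coeff j).val) (by omega) ha.1 ?_
      fun s' h h' => ⟨h, h'⟩
    intro k s' hk g1 g2 g3
    have g25 : s' 25 = s1 25 := g1 25 (by simp; omega)
    have g26 : s' 26 = s1 26 := g1 26 (by simp; omega)
    refine ⟨by simp [g25, g26, h26, h2], rfl, fun hk' => ⟨?_, (ZMod.val_lt _).trans hp⟩⟩
    simp only [value_add, value_get, value_ofNat, g2, g25, g26, h26]
    rw [show d + 1 + k = d + k + 1 by ring, h4 _ (by omega) (by omega), Nat.add_sub_cancel_left]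
  · rintro s2 ⟨g1, g2⟩
    have g25 : s2 25 = s1 25 := g1 25 (by simp; omega)
    have g26 : s2 26 = s1 26 := g1 26 (by simp; omega)
    refine ⟨by simp [g25, g26, h26, h2]; omega, ?_⟩
    refine wp_mono ?_ (wp_trim (f := f /ₘ g) (n := n - d) (by omega) ⟨?_, fun j hj => ?_, hz⟩)
    · rintro s3 ⟨g3, g4⟩
      refine ⟨?_, g4⟩
      have g5 : Frame [12, a] s1 s3 := (g1.write (by simp) _ _).trans g3 (by simp) (by simp)
      exact h1.trans g5 (by simp) (by simp)
    · simp [g25, g26, h26, h2]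
    · simp only [write_same, value_ofNat]
      rw [Function.update_of_ne (by omega), g2, if_pos (by omega)]
      rfl

/-! ### Refinement of a partial factorization -/

/-- `F 0 = 1, F 1, …, F (n - 1)` are monic polynomials with product `E`, and all but possibly the
first two are nonconstant. -/
structure Factorization {p : ℕ} (E : (ZMod p)[X]) (F : ℕ → (ZMod p)[X]) (n : ℕ) : Prop where
  two_le : 2 ≤ n
  zero : F 0 = 1
  monic : ∀ i < n, (F i).Monic
  prod : ∏ i ∈ Finset.range n, F i = E
  pos : ∀ i, 2 ≤ i → i < n → 1 ≤ (F i).natDegree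

theorem Factorization.dvd {p : ℕ} {E : (ZMod p)[X]} {F : ℕ → (ZMod p)[X]} {n i : ℕ}
    (h : Factorization E F n) (hi : i < n) : F i ∣ E :=
  h.prod ▸ Finset.dvd_prod_of_mem F (Finset.mem_range.2 hi)

theorem Factorization.monic_prod {p : ℕ} {E : (ZMod p)[X]} {F : ℕ → (ZMod p)[X]} {n : ℕ}
    (h : Factorization E F n) : E.Monic :=
  h.prod ▸ monic_prod_of_monic _ _ fun i hi => h.monic i (Finset.mem_range.1 hi)

theorem Factorization.exists_dvd {p : ℕ} [Fact p.Prime] {E q : (ZMod p)[X]}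
    {F : ℕ → (ZMod p)[X]} {n : ℕ} (h : Factorization E F n) (hq : Irreducible q) (hqE : q ∣ E) :
    ∃ i < n, q ∣ F i := by
  rw [← h.prod, hq.prime.dvd_finsetProd_iff] at hqE
  obtain ⟨i, hi, h1⟩ := hqE
  exact ⟨i, Finset.mem_range.1 hi, h1⟩

/-- The degrees add up to that of E, and all but the first two are positive. This bounds the loops
over the list of pieces. -/
theorem Factorization.le {p : ℕ} {E : (ZMod p)[X]} {F : ℕ → (ZMod p)[X]} {n : ℕ}
    (h : Factorization E F n) : n ≤ E.natDegree + 2 := by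
  have h1 := natDegree_prod_of_monic (Finset.range n) F
    fun i hi => h.monic i (Finset.mem_range.1 hi)
  rw [h.prod] at h1
  obtain ⟨k, rfl⟩ : ∃ k, n = k + 2 := ⟨n - 2, by have := h.two_le; omega⟩
  rw [Finset.sum_range_succ', Finset.sum_range_succ'] at h1
  have h2 : ∑ _i ∈ Finset.range k, 1 ≤ ∑ i ∈ Finset.range k, (F (i + 1 + 1)).natDegree :=
    Finset.sum_le_sum fun i hi => h.pos _ (by omega) (by have := Finset.mem_range.1 hi; omega)
  simp at h2
  omega

/-- The cofactor is appended at the end, so that the other indices keep their meaning. The index 0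
is never affected, as F 0 = 1 has no nonconstant factor. -/
theorem Factorization.split {p : ℕ} {E : (ZMod p)[X]} {F : ℕ → (ZMod p)[X]} {n i : ℕ}
    [Fact p.Prime]
    (h : Factorization E F n) (hi : i < n) {g g' : (ZMod p)[X]} (hg : g.Monic) (hg' : g'.Monic)
    (hgg : g * g' = F i) (h1 : 1 ≤ g.natDegree) (h1' : 1 ≤ g'.natDegree) :
    Factorization E (Function.update (Function.update F i g) n g') (n + 1) := by
  have h0 : i ≠ 0 := by
    rintro rfl
    have := hg.natDegree_mul hg'
    rw [hgg, h.zero, natDegree_one] at this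
    omega
  have h2 := h.two_le
  refine ⟨by omega, ?_, fun j hj => ?_, ?_, fun j hj hj' => ?_⟩
  · rw [Function.update_of_ne (by omega), Function.update_of_ne (by omega), h.zero]
  · rcases eq_or_ne j n with rfl | hjn
    · simpa using hg'
    rw [Function.update_of_ne hjn]
    rcases eq_or_ne j i with rfl | hji
    · simpa using hg
    rw [Function.update_of_ne hji]
    exact h.monic j (by omega)
  · rw [Finset.prod_range_succ, Function.update_self, ← h.prod]
    have h3 : ∏ j ∈ Finset.range n, Function.update (Function.update F i g) n g' j =
        ∏ j ∈ Finset.range n, Function.update F i g j :=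
      Finset.prod_congr rfl fun j hj => Function.update_of_ne (Finset.mem_range.1 hj).ne _ _
    rw [h3, Finset.prod_update_of_mem (Finset.mem_range.2 hi), mul_right_comm, hgg,
      ← Finset.erase_eq, Finset.mul_prod_erase _ _ (Finset.mem_range.2 hi)]
  · rcases eq_or_ne j n with rfl | hjn
    · simpa using h1'
    rw [Function.update_of_ne hjn]
    rcases eq_or_ne j i with rfl | hji
    · simpa using h1
    rw [Function.update_of_ne hji]
    exact h.pos j hj (by omega)

/-- `G` does not distinguish the irreducible factors of `f`. -/
def Resolved {p : ℕ} (G f : (ZMod p)[X]) : Prop :=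
  ∀ q q', Irreducible q → Irreducible q' → q ∣ f → q' ∣ f → (q ∣ G ↔ q' ∣ G)

/-- What one test has achieved is not lost when pieces are split further. -/
theorem Resolved.mono {p : ℕ} {G f g : (ZMod p)[X]} (h : Resolved G f) (hg : g ∣ f) :
    Resolved G g := fun q q' hq hq' h1 h2 => h q q' hq hq' (h1.trans hg) (h2.trans hg)

theorem resolved_of_dvd {p : ℕ} {G f : (ZMod p)[X]} (h : f ∣ G) : Resolved G f :=
  fun _ _ _ _ h1 h2 => ⟨fun _ => h2.trans h, fun _ => h1.trans h⟩

/-- Splitting f into gcd(f, G) and its cofactor resolves both: `resolved_of_dvd` applies to the gcd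
and, for squarefree f, this lemma to the cofactor. -/
theorem resolved_of_not_dvd {p : ℕ} {G f : (ZMod p)[X]}
    (h : ∀ q, Irreducible q → q ∣ f → ¬ q ∣ G) : Resolved G f :=
  fun q q' hq hq' h1 h2 => ⟨fun h3 => absurd h3 (h q hq h1), fun h3 => absurd h3 (h q' hq' h2)⟩

/-- The arrays `40` and `41` hold a list of polynomials, in blocks of length `W`, and its length. -/
structure Pieces {p : ℕ} (W : ℕ) (s : State) (F : ℕ → (ZMod p)[X]) (n : ℕ) : Prop where
  len : s 41 0 = n
  rep : ∀ i < n, Rep (fun j => s 40 (i * W + j)) (F i) (plen (F i))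

theorem Pieces.congr {p W : ℕ} {s s' : State} {F : ℕ → (ZMod p)[X]} {n : ℕ} (h : Pieces W s F n)
    (h0 : s' 40 = s 40) (h1 : s' 41 = s 41) : Pieces W s' F n :=
  ⟨by rw [h1, h.len], fun i hi => by rw [h0]; exact h.rep i hi⟩

/-- The length of the blocks in which the list of factors is stored. -/
abbrev width (lam : ℕ) : Term := .get 0 2 + .const (lam + 3)

/-- Split the polynomials in the list by the polynomial in the array `a`. -/
def refine (lam a : ℕ) : Prog :=
  -- The number of pieces is saved first, so that the cofactors appended on the way are not visited
  -- again.
  .store 63 0 (var 41) ;;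
  forDo 42 (var 63) (
    copy 12 10 0 40 (var 42 * width lam) ;; copy 12 11 0 a 0 ;; gcd ;;
    -- Nonzero exactly if the gcd is a nonconstant proper factor of the piece.
    .cond ((var 10 - 1) * (.get 40 (var 42 * width lam) - var 10)) (
      copy 12 26 0 10 0 ;; copy 12 25 0 40 (var 42 * width lam) ;; quotientTo 64 ;;
      copy 12 40 (var 41 * width lam) 64 0 ;; copy 12 40 (var 42 * width lam) 10 0 ;;
      .store 41 0 (var 41 + 1)) .skip)

/-- A trivial gcd needs no splitting: either f and G have no common irreducible factor, or f divides
G. -/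
theorem resolved_mgcd_of_plen {p : ℕ} [Fact p.Prime] {f G : (ZMod p)[X]} (hf : f.Monic)
    (h : plen (mgcd f G) ≤ 1 ∨ plen f ≤ plen (mgcd f G)) : Resolved G f := by
  have h0 : mgcd f G ≠ 0 := fun h0 => hf.ne_zero (zero_dvd_iff.1 (h0 ▸ (dvd_mgcd.1 dvd_rfl).1))
  rw [plen_of_ne h0, plen_of_ne hf.ne_zero] at h
  rcases h with h | h
  · refine resolved_of_not_dvd fun q hq h1 h2 => ?_
    have h3 := natDegree_le_of_dvd (dvd_mgcd.2 ⟨h1, h2⟩) h0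
    have := hq.natDegree_pos
    omega
  · refine resolved_of_dvd ?_
    have h1 : f = mgcd f G := eq_of_monic_of_dvd_of_natDegree_le (monic_mgcd h0) hf
      (dvd_mgcd.1 dvd_rfl).1 (by omega)
    exact h1.dvd.trans (dvd_mgcd.1 dvd_rfl).2

theorem block_disjoint {W i j a b : ℕ} (hij : i ≠ j) (ha : a < W) (hb : b < W) :
    i * W + a ≠ j * W + b := by
  rcases lt_or_gt_of_ne hij with h | h
  · have := Nat.mul_le_mul_right W (show i + 1 ≤ j from h)
    rw [add_mul] at this
    omega
  · have := Nat.mul_le_mul_right W (show j + 1 ≤ i from h)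
    rw [add_mul] at this
    omega

set_option maxHeartbeats 1000000 in
-- After k passes the pieces resolved by G are those with index less than k and the appended ones,
-- with index at least n. Older tests in `Gs` stay resolved since pieces are only replaced by
-- divisors.
theorem wp_refine {N p lam nb a nG : ℕ} [Fact p.Prime] {s : State} {E G : (ZMod p)[X]}
    {F : ℕ → (ZMod p)[X]} {n : ℕ} {Gs : Set (ZMod p)[X]} (hs : s 0 1 = p) (hnb : s 0 2 = nb)
    (hp : p < 2 ^ N) (hN : 4 * (nb + lam + 5) ≤ N)
    (ha : a ∉ [0, 10, 11, 12, 15, 16, 17, 24, 25, 26, 27, 28, 29, 40, 41, 42, 63, 64])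
    (hE : Squarefree E) (hEd : E.natDegree < nb + lam + 1) (hnG : nG ≤ nb + lam + 8)
    (hG : Rep (s a) G nG) (hP : Pieces (nb + lam + 3) s F n) (hF : Factorization E F n)
    (hGs : ∀ g ∈ Gs, ∀ i < n, Resolved g (F i)) :
    wp N (refine lam a) (fun s' =>
      Frame [10, 11, 12, 15, 16, 17, 24, 25, 26, 27, 28, 29, 40, 41, 42, 63, 64] s s' ∧
      ∃ (F' : ℕ → (ZMod p)[X]) (n' : ℕ), Pieces (nb + lam + 3) s' F' n' ∧ Factorization E F' n' ∧
        ∀ g ∈ insert G Gs, ∀ i < n', Resolved g (F' i)) s := by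
  have hN2 : N < 2 ^ N := Nat.lt_two_pow_self
  set fr := [10, 11, 12, 15, 16, 17, 24, 25, 26, 27, 28, 29, 40, 41, 42, 63, 64] with hfr
  set W := nb + lam + 3 with hW
  have ha' : a ∉ fr := fun h => ha (List.mem_cons_of_mem _ h)
  have ha12 : a ≠ 12 := fun h => ha (by simp [h, hfr])
  have ha11 : a ≠ 11 := fun h => ha (by simp [h, hfr])
  have hplen : ∀ (f : (ZMod p)[X]), f ∣ E → plen f ≤ nb + lam + 1 := fun f hf => by
    unfold plen
    split_ifs
    · omega
    · have := natDegree_le_of_dvd hf hE.ne_zero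
      omega
  refine ⟨by simp [hP.len]; have := hF.le; omega, ?_⟩
  refine wp_forDo (fun k s' => s' 42 0 = k ∧ Frame fr s s' ∧ s' 63 0 = n ∧
    ∃ (F' : ℕ → (ZMod p)[X]) (n' : ℕ), n ≤ n' ∧ Pieces W s' F' n' ∧ Factorization E F' n' ∧
      (∀ g ∈ Gs, ∀ i < n', Resolved g (F' i)) ∧ ∀ i < n', i < k ∨ n ≤ i → Resolved G (F' i)) n
    (by have := hF.le; omega) ?_ ?_ ?_ ?_
  · exact ⟨by simp, ((Frame.refl _ _).write (by simp [hfr]) _ _).write (by simp [hfr]) _ _,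
      by simp [hP.len], F, n, le_rfl, hP.congr (by simp) (by simp), hF, hGs,
      fun i hi hi' => by omega⟩
  · rintro k s' hk ⟨h1, h2, h3, -⟩
    exact ⟨h1, h3⟩
  swap
  · rintro s' ⟨-, h1, -, F', n', h3, h4, h5, h6, h7⟩
    refine ⟨h1, F', n', h4, h5, fun g hg i hi => ?_⟩
    rcases hg with rfl | hg
    · exact h7 i hi (by omega)
    · exact h6 g hg i hi
  rintro k s' hk ⟨h1, h2, h3, F', n', h4, h5, h6, h7, h8⟩ -
  have hkn : k < n' := by omega
  have h0 : ∀ {s'}, Frame fr s s' → s' 0 = s 0 := fun h => h 0 (by decide)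
  have hFk := hplen _ (h6.dvd hkn)
  have hmon := h6.monic k hkn
  set h := mgcd (F' k) G with hh
  have hhF : h ∣ F' k := (dvd_mgcd.1 dvd_rfl).1
  have hne : h ≠ 0 := fun h0 => hmon.ne_zero (zero_dvd_iff.1 (h0 ▸ hhF))
  have hhm : h.Monic := monic_mgcd hne
  have hhl : plen h ≤ nb + lam + 1 := hplen _ (hhF.trans (h6.dvd hkn))
  have hfac : h * (F' k /ₘ h) = F' k := by
    have h9 := modByMonic_add_div (F' k) h
    rwa [(modByMonic_eq_zero_iff_dvd hhm).2 hhF, zero_add] at h9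
  refine wp_seq (P := fun s2 => Frame [10, 12] s' s2 ∧ Rep (s2 10) (F' k) (plen (F' k))) ?_ ?_
  · refine wp_copy (n := plen (F' k)) (oA := 0) (oB := k * W) hp (by omega) (by decide) (by decide)
      (by decide) (fun _ _ => rfl) (fun s2 hs2 => ?_) (h5.rep k hkn)
      fun s2 g1 g2 _ => ⟨g1.mono (by simp), by simpa using g2⟩
    simp [hs2 42 (by decide), hs2 0 (by decide), h1, h0 h2, hnb, hW]
    left; omega
  rintro s2 ⟨g1, g2⟩
  have ha2 : s2 a = s a := by
    rw [g1 a (fun h => ha' (by simp at h; rcases h with h | h <;> simp [h, hfr])), h2 a ha']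
  refine wp_seq (wp_copy_zero (n := nG) (f := G) (by rw [ha2]; exact hG) hp (by omega) (by decide)
    ha12 ha11) ?_
  rintro s3 ⟨g3, g4⟩
  have gs3 : Frame [10, 11, 12] s' s3 := g1.trans g3 (by simp) (by simp)
  refine wp_seq (wp_gcd (n := plen (F' k)) (m := nG) (by rw [gs3 0 (by decide), h0 h2, hs]) hp (by omega)
    (by rw [g3 10 (by decide)]; exact g2) g4) ?_
  rintro s4 ⟨g5, g6⟩
  rw [← hh] at g6
  have gs4 : Frame [10, 11, 12, 15, 16, 17] s' s4 := gs3.trans g5 (by simp) (by simp)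
  have gs4' : Frame fr s s4 := h2.trans gs4 (by simp) (by simp [hfr])
  have h42 : s4 42 0 = k := by rw [gs4 42 (by decide), h1]
  have hpc4 : Pieces W s4 F' n' := h5.congr (gs4 40 (by decide)) (gs4 41 (by decide))
  have hwid : ∀ {s'}, Frame fr s s' → (width lam).value s' = W := fun hs' => by
    simp [h0 hs', hnb, hW]; omega
  have h40 : s4 40 (k * W) = plen (F' k) := (hpc4.rep k hkn).len
  refine ⟨fun hc => ?_, fun hc => ?_⟩
  swap
  · refine ⟨h42, by simp, gs4'.write (by simp [hfr]) _ _, ?_, F', n', h4,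
      hpc4.congr (by simp) (by simp), h6, h7, fun i hi hi' => ?_⟩
    · rw [write_ne _ _ _ (by decide), gs4 63 (by decide), h3]
    rcases eq_or_ne i k with rfl | hik
    · refine resolved_mgcd_of_plen hmon ?_
      rw [← hh]
      simp only [value_mul, value_sub, value_get, value_ofNat, hwid gs4', h42, h40, g6.len] at hc
      rcases Nat.mul_eq_zero.1 hc with hc | hc
      · left; omega
      · right; omega
    · exact h8 i hi (by omega)
  simp only [value_mul, value_sub, value_get, value_ofNat, hwid gs4', h42, h40, g6.len] at hc
  have hc1 : 2 ≤ plen h := by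
    by_contra hc'
    rw [show plen h - 1 = 0 by omega, zero_mul] at hc
    exact hc rfl
  have hc2 : plen h < plen (F' k) := by
    by_contra hc'
    rw [show plen (F' k) - plen h = 0 by omega, mul_zero] at hc
    exact hc rfl
  have hpl := plen_of_ne hne
  have hpl' := plen_of_ne hmon.ne_zero
  have hqm : (F' k /ₘ h).Monic := hhm.of_mul_monic_left (hfac.symm ▸ hmon)
  have hdeg := hhm.natDegree_mul hqm
  rw [hfac] at hdeg
  have hsplit := h6.split hkn hhm hqm hfac (by omega) (by omega)
  have hql : plen (F' k /ₘ h) ≤ nb + lam + 1 :=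
    hplen _ ((Dvd.intro_left _ hfac).trans (h6.dvd hkn))
  refine wp_seq (wp_copy_zero g6 hp (by omega) (by decide) (by decide) (by decide)) ?_
  rintro s5 ⟨e1, e2⟩
  have gs5 : Frame [10, 11, 12, 15, 16, 17, 26] s' s5 := gs4.trans e1 (by simp) (by simp)
  have gs5' : Frame fr s s5 := h2.trans gs5 (by simp) (by simp [hfr])
  refine wp_seq (P := fun s6 => Frame [12, 25] s5 s6 ∧ Rep (s6 25) (F' k) (plen (F' k))) ?_ ?_
  · refine wp_copy (n := plen (F' k)) (oA := 0) (oB := k * W) hp (by omega) (by decide) (by decide)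
      (by decide) (fun _ _ => rfl) (fun s6 hs6 => ?_)
      (by rw [gs5 40 (by decide)]; exact h5.rep k hkn)
      fun s6 g1 g2 _ => ⟨g1, by simpa using g2⟩
    rw [value_mul, hwid (gs5'.trans hs6 (by simp) (by simp [hfr])), value_get, value_ofNat,
      hs6 42 (by decide), gs5 42 (by decide), h1]
  rintro s6 ⟨e3, e4⟩
  have gs6 : Frame [10, 11, 12, 15, 16, 17, 25, 26] s' s6 := gs5.trans e3 (by simp) (by simp)
  have gs6' : Frame fr s s6 := h2.trans gs6 (by simp) (by simp [hfr])
  refine wp_seq (wp_quotientTo (g := h) (d := h.natDegree) (by rw [h0 gs6', hs]) hp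
    (show plen (F' k) ≤ N by omega) (by omega) (by decide) e4
    (by rw [e3 26 (by decide), ← hpl]; exact e2) hhm rfl) ?_
  rintro s7 ⟨e5, e6⟩
  have gs7 : Frame [10, 11, 12, 15, 16, 17, 24, 25, 26, 27, 28, 29, 64] s' s7 :=
    gs6.trans e5 (by simp) (by simp)
  have gs7' : Frame fr s s7 := h2.trans gs7 (by simp) (by simp [hfr])
  have h10 : Rep (s7 10) h (plen h) := by
    rw [e5 10 (by decide), e3 10 (by decide), e1 10 (by decide)]; exact g6
  have hpc7 : Pieces W s7 F' n' := h5.congr (gs7 40 (by decide)) (gs7 41 (by decide))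
  refine wp_seq (P := fun s8 => Frame [12, 40] s7 s8 ∧
    Rep (fun j => s8 40 (n' * W + j)) (F' k /ₘ h) (plen (F' k /ₘ h)) ∧
    (∀ j, (j < n' * W ∨ n' * W + plen (F' k /ₘ h) < j) → s8 40 j = s7 40 j)) ?_ ?_
  · refine wp_copy (n := plen (F' k /ₘ h)) (oA := n' * W) (oB := 0) hp (by omega) (by decide)
      (by decide) (by decide) (fun s8 hs8 => ?_) (fun _ _ => rfl) (by simpa using e6)
      fun s8 f1 f2 f3 => ⟨f1, f2, f3⟩
    rw [value_mul, hwid (gs7'.trans hs8 (by simp) (by simp [hfr])), value_get, value_ofNat,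
      hs8 41 (by decide), hpc7.len]
  rintro s8 ⟨f1, f2, f3⟩
  have gs8' : Frame fr s s8 := gs7'.trans f1 (by simp) (by simp [hfr])
  refine wp_seq (P := fun s9 => Frame [12, 40] s8 s9 ∧
    Rep (fun j => s9 40 (k * W + j)) h (plen h) ∧
    (∀ j, (j < k * W ∨ k * W + plen h < j) → s9 40 j = s8 40 j)) ?_ ?_
  · refine wp_copy (n := plen h) (oA := k * W) (oB := 0) hp (by omega) (by decide)
      (by decide) (by decide) (fun s9 hs9 => ?_) (fun _ _ => rfl)
      (by simpa [f1 10 (by decide)] using h10) fun s9 f1 f2 f3 => ⟨f1, f2, f3⟩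
    rw [value_mul, hwid (gs8'.trans hs9 (by simp) (by simp [hfr])), value_get, value_ofNat,
      hs9 42 (by decide), f1 42 (by decide), gs7 42 (by decide), h1]
  rintro s9 ⟨i1, i2, i3⟩
  have gs9' : Frame fr s s9 := gs8'.trans i1 (by simp) (by simp [hfr])
  have h41 : s9 41 0 = n' := by rw [i1 41 (by decide), f1 41 (by decide), hpc7.len]
  refine ⟨by simp [h41]; have := hsplit.le; omega, ?_⟩
  refine ⟨?_, by simp, (gs9'.write (by simp [hfr]) _ _).write (by simp [hfr]) _ _, ?_, _, n' + 1,
    by omega, ⟨by simp [h41], fun i hi => ?_⟩, hsplit, fun g hg i hi => ?_, fun i hi hi' => ?_⟩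
  · rw [write_ne _ _ _ (by decide), i1 42 (by decide), f1 42 (by decide), gs7 42 (by decide), h1]
  · rw [write_ne _ _ _ (by decide), write_ne _ _ _ (by decide), i1 63 (by decide),
      f1 63 (by decide), gs7 63 (by decide), h3]
  · rw [write_ne _ _ _ (by decide), write_ne _ _ _ (by decide)]
    have hout : ∀ {i j l : ℕ}, i ≠ j → l ≤ nb + lam + 1 → ∀ t, t ≤ nb + lam + 1 →
        (i * W + t < j * W ∨ j * W + l < i * W + t) := fun {i j l} hij hl t ht => by
      by_contra! h9
      exact block_disjoint (W := W) (a := t) (b := i * W + t - j * W) hij (by omega) (by omega)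
        (by omega)
    rcases eq_or_ne i n' with rfl | hin
    · rw [Function.update_self]
      exact f2.congr fun t ht => i3 _ (hout (by omega) hhl t (by omega))
    rw [Function.update_of_ne hin]
    rcases eq_or_ne i k with rfl | hik
    · rw [Function.update_self]
      exact i2
    rw [Function.update_of_ne hik]
    have hil := hplen _ (h6.dvd (show i < n' by omega))
    refine (hpc7.rep i (by omega)).congr fun t ht => ?_
    rw [i3 _ (hout hik hhl t (by omega)), f3 _ (hout hin hql t (by omega))]
  · rcases eq_or_ne i n' with rfl | hin
    · rw [Function.update_self]
      exact (h7 g hg k hkn).mono (Dvd.intro_left _ hfac)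
    rw [Function.update_of_ne hin]
    rcases eq_or_ne i k with rfl | hik
    · rw [Function.update_self]
      exact (h7 g hg i hkn).mono hhF
    rw [Function.update_of_ne hik]
    exact h7 g hg i (by omega)
  · rcases eq_or_ne i n' with rfl | hin
    · rw [Function.update_self]
      -- A common irreducible factor of the cofactor and G divides the gcd as well, so its square
      -- divides the squarefree E.
      refine resolved_of_not_dvd fun q hq hq1 hq2 => ?_
      have hq3 : q ∣ h := dvd_mgcd.2 ⟨hq1.trans (Dvd.intro_left _ hfac), hq2⟩
      have hE' : h * (F' k /ₘ h) ∣ E := by rw [hfac]; exact h6.dvd hkn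
      exact hq.not_isUnit (hE q ((mul_dvd_mul hq3 hq1).trans hE'))
    rw [Function.update_of_ne hin]
    rcases eq_or_ne i k with rfl | hik
    · rw [Function.update_self]
      exact resolved_of_dvd (dvd_mgcd.1 dvd_rfl).2
    rw [Function.update_of_ne hik]
    exact h8 i (by omega) (by omega)

/-! ### Reading the input: gcd and coprime parts of the columns -/

/-- The array `A` holds a prime `p`, dimensions `nb` and `m`, and the coefficients of two families
of `m` polynomials of degree at most `nb + lam`, the families `cs 0, …, cs (m - 1)` and
`cs m, …, cs (2 m - 1)`. -/
structure Input {p : ℕ} (lam nb m : ℕ) (cs : ℕ → (ZMod p)[X]) (A : ℕ → ℕ) : Prop where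
  prime_eq : A 1 = p
  nb_eq : A 2 = nb
  m_eq : A 3 = m
  -- The matrices are stored row by row behind the entries for length, p, nb and m; c / m selects
  -- the matrix and c % m the column.
  coeff : ∀ c < m + m, ∀ i < nb + lam + 1,
    A (4 + c / m * ((nb + lam + 1) * m) + c % m + i * m) = ((cs c).coeff i).val
  zero : ∀ c < m + m, ∀ i, nb + lam + 1 ≤ i → (cs c).coeff i = 0

/-- The number of coefficients of the input polynomials. -/
abbrev rows (lam : ℕ) : Term := .get 0 2 + .const (lam + 1)

/-- The number of polynomials in each family of the input. -/
abbrev cols : Term := .get 0 3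

/-- Load the input polynomial with the index `var 50` into the array `11`. -/
def loadColumn (lam : ℕ) : Prog :=
  vec 12 (rows lam) 11 1
    (.get 0 (4 + var 50 / cols * (rows lam * cols) + var 50 % cols + var 12 * cols)) ;;
  .store 11 0 (rows lam)

theorem wp_loadColumn {N p lam nb m c : ℕ} [NeZero p] {s : State} {cs : ℕ → (ZMod p)[X]}
    (hI : Input lam nb m cs (s 0)) (hp : p < 2 ^ N) (hN : nb + lam + 1 ≤ N) (hc : s 50 0 = c)
    (hcm : c < m + m) :
    wp N (loadColumn lam) (fun s' => Frame [11, 12] s s' ∧ Rep (s' 11) (cs c) (nb + lam + 1)) s := by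
  have hN2 : N < 2 ^ N := Nat.lt_two_pow_self
  refine wp_seq (P := fun s' => Frame [11, 12] s s' ∧ ∀ j, s' 11 j =
    if 1 ≤ j ∧ j < 1 + (nb + lam + 1) then ((cs c).coeff (j - 1)).val else s 11 j) ?_ ?_
  · refine wp_vec (nb + lam + 1) 1 (fun j => ((cs c).coeff j).val) hN (by decide) ?_
      fun s' h h' => ⟨h.mono (by simp), h'⟩
    intro k s' hk h1 h2 h3
    have h0 : s' 0 = s 0 := h1 0 (by decide)
    have h50 : s' 50 0 = c := by rw [h1 50 (by decide), hc]
    refine ⟨?_, rfl, fun hk' => ⟨?_, (ZMod.val_lt _).trans hp⟩⟩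
    · simp only [value_add, value_get, value_ofNat, value_const, h0, hI.nb_eq]; ring
    · simp only [value_add, value_get, value_ofNat, value_const, value_div, value_mod, value_mul, h0,
        hI.nb_eq, hI.m_eq, h50, h2]
      exact hI.coeff c hcm k hk'
  · rintro s' ⟨h1, h2⟩
    have h0 : s' 0 = s 0 := h1 0 (by decide)
    refine ⟨by simp [h0, hI.nb_eq]; omega, h1.write (by simp) _ _, ?_, fun i hi => ?_, hI.zero c hcm⟩
    · simp [h0, hI.nb_eq, add_assoc]
    · simp only [write_same, value_ofNat]
      rw [Function.update_of_ne (by omega), h2, if_pos (by omega)]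
      rfl

/-- The monic greatest common divisor of all input polynomials, in the array `45`, the maximum of
their lengths, in `var 51`, and an index, in `var 52`, such that not both input polynomials with
this index are zero. -/
def scan (lam : ℕ) : Prog :=
  .store 10 0 0 ;; .store 51 0 0 ;; .store 52 0 0 ;;
  forDo 50 (cols + cols) (
    loadColumn lam ;; trim 11 ;;
    .cond (var 11) (.store 52 0 (var 50 % cols) ;;
      .cond (var 11 - var 51) (.store 51 0 (var 11)) .skip) .skip ;;
    gcd) ;;
  copy 12 45 0 10 0

theorem wp_scan {N p lam nb m : ℕ} [Fact p.Prime] {s : State} {cs : ℕ → (ZMod p)[X]}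
    (hI : Input lam nb m cs (s 0)) (hp : p < 2 ^ N) (hN : 4 * (nb + lam + m + 5) ≤ N) :
    wp N (scan lam) (fun s' => Frame [10, 11, 12, 15, 16, 17, 45, 50, 51, 52] s s' ∧
      ∃ (D : (ZMod p)[X]) (M j : ℕ), Rep (s' 45) D (plen D) ∧ s' 51 0 = M ∧ s' 52 0 = j ∧
        (∀ q, q ∣ D ↔ ∀ i < m + m, q ∣ cs i) ∧ (D ≠ 0 → D.Monic) ∧ (∀ i < m + m, plen (cs i) ≤ M) ∧
        (M = 0 ∨ ∃ i < m + m, plen (cs i) = M) ∧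
        ((∃ i < m + m, cs i ≠ 0) → j < m ∧ (cs j ≠ 0 ∨ cs (m + j) ≠ 0))) s := by
  have hN2 : N < 2 ^ N := Nat.lt_two_pow_self
  set fr := [10, 11, 12, 15, 16, 17, 45, 50, 51, 52] with hfr
  have hlen : ∀ i < m + m, plen (cs i) ≤ nb + lam + 1 := fun i hi => plen_le (hI.zero i hi)
  refine ⟨by simp, by simp, by simp, ?_⟩
  refine wp_seq (P := fun s' => Frame fr s s' ∧
      ∃ (D : (ZMod p)[X]) (M j : ℕ), Rep (s' 10) D (plen D) ∧ s' 51 0 = M ∧ s' 52 0 = j ∧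
        (∀ q, q ∣ D ↔ ∀ i < m + m, q ∣ cs i) ∧ (D ≠ 0 → D.Monic) ∧ (∀ i < m + m, plen (cs i) ≤ M) ∧
        (M = 0 ∨ ∃ i < m + m, plen (cs i) = M) ∧ plen D ≤ nb + lam + 1 ∧
        ((∃ i < m + m, cs i ≠ 0) → j < m ∧ (cs j ≠ 0 ∨ cs (m + j) ≠ 0))) ?_ ?_
  swap
  · rintro s1 ⟨h1, D, M, j, h2, h3, h4, h5, h6, h7, h8, h9, h10⟩
    refine wp_mono ?_ (wp_copy_zero h2 hp (by omega) (by decide) (by decide) (by decide))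
    rintro s2 ⟨h11, h12⟩
    exact ⟨h1.trans h11 (by simp) (by simp [hfr]), D, M, j, h12, by rw [h11 51 (by decide), h3],
      by rw [h11 52 (by decide), h4], h5, h6, h7, h8, h10⟩
  refine wp_forDo (fun k s' => s' 50 0 = k ∧ Frame fr s s' ∧
      ∃ (D : (ZMod p)[X]) (M j : ℕ), Rep (s' 10) D (plen D) ∧ s' 51 0 = M ∧ s' 52 0 = j ∧
        (∀ q, q ∣ D ↔ ∀ i < k, q ∣ cs i) ∧ (D ≠ 0 → D.Monic) ∧ (∀ i < k, plen (cs i) ≤ M) ∧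
        (M = 0 ∨ ∃ i < k, plen (cs i) = M) ∧ plen D ≤ nb + lam + 1 ∧
        ((∃ i < k, cs i ≠ 0) → j < m ∧ (cs j ≠ 0 ∨ cs (m + j) ≠ 0))) (m + m) (by omega) ?_ ?_ ?_ ?_
  · refine ⟨by simp, ((((Frame.refl _ _).write (by simp [hfr]) _ _).write (by simp [hfr]) _ _).write
      (by simp [hfr]) _ _).write (by simp [hfr]) _ _, 0, 0, 0, ⟨by simp [plen_zero], ?_, by simp⟩,
      by simp, by simp, by simp, by simp, by simp, Or.inl rfl, by simp [plen_zero], by simp⟩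
    intro i hi
    simp [plen_zero] at hi
  · rintro k s' hk ⟨h1, h2, -⟩
    refine ⟨h1, ?_⟩
    simp [h2 0 (by decide), hI.m_eq]
  swap
  · rintro s' ⟨-, h⟩
    exact h
  rintro k s' hk ⟨h1, h2, D, M, j, h3, h4, h5, h6, h7, h8, h9, h10, h11⟩ -
  have hI' : Input lam nb m cs (s' 0) := by rw [h2 0 (by decide)]; exact hI
  refine wp_seq (wp_loadColumn hI' hp (by omega) h1 hk) ?_
  rintro s1 ⟨g1, g2⟩
  refine wp_seq (wp_trim (by omega) g2) ?_
  rintro s2 ⟨g3, g4⟩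
  have g5 : Frame [11, 12] s' s2 := g1.trans g3 (by simp) (by simp)
  have hlk := hlen k hk
  have g0 : ∀ s2, Frame [11, 12] s' s2 → s2 0 = s 0 := fun s2 h => by
    rw [h 0 (by decide), h2 0 (by decide)]
  refine wp_seq (P := fun s3 => Frame [51, 52] s2 s3 ∧ ∃ M j, s3 51 0 = M ∧ s3 52 0 = j ∧
    (∀ i < k + 1, plen (cs i) ≤ M) ∧ (M = 0 ∨ ∃ i < k + 1, plen (cs i) = M) ∧
    ((∃ i < k + 1, cs i ≠ 0) → j < m ∧ (cs j ≠ 0 ∨ cs (m + j) ≠ 0))) ?_ ?_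
  · refine ⟨fun hc => ?_, fun hc => ?_⟩
    · simp only [value_get, value_ofNat, g4.len] at hc
      have hne : cs k ≠ 0 := fun h => hc (by rw [h, plen_zero])
      have hm : 0 < m := by omega
      have hj : k % m < m ∧ (cs (k % m) ≠ 0 ∨ cs (m + k % m) ≠ 0) := by
        refine ⟨Nat.mod_lt _ hm, ?_⟩
        rcases Nat.lt_or_ge k m with hkm | hkm
        · rw [Nat.mod_eq_of_lt hkm]
          exact Or.inl hne
        · rw [Nat.mod_eq_sub_mod hkm, Nat.mod_eq_of_lt (by omega), Nat.add_sub_cancel' hkm]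
          exact Or.inr hne
      have h52 : (var 50 % cols).value s2 = k % m := by
        simp [g5 50 (by decide), h1, g0 _ g5, hI.m_eq]
      have h51 : ∀ i j, (var 11 - var 51).value (s2.write 52 i j) = plen (cs k) - M := fun i j => by
        simp [g4.len, g5 51 (by decide), h4]
      refine ⟨by rw [h52]; omega, fun hc2 => ⟨by simp [g4.len]; omega, ?_⟩, fun hc2 => ?_⟩
      · rw [h51] at hc2
        refine ⟨((Frame.refl _ _).write (by simp) _ _).write (by simp) _ _, plen (cs k), k % m,
          by simp [g4.len], ?_, fun i hi => ?_, Or.inr ⟨k, by omega, rfl⟩, fun _ => hj⟩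
        · rw [write_ne _ _ _ (by decide), write_same, h52]; simp
        · rcases Nat.lt_or_ge i k with hik | hik
          · have := h8 i hik
            omega
          · obtain rfl : i = k := by omega
            exact le_rfl
      · rw [h51] at hc2
        refine ⟨(Frame.refl _ _).write (by simp) _ _, M, k % m,
          by simp [g5 51 (by decide), h4], ?_, fun i hi => ?_, ?_, fun _ => hj⟩
        · rw [write_same, h52]; simp
        · rcases Nat.lt_or_ge i k with hik | hik
          · exact h8 i hik
          · obtain rfl : i = k := by omega
            omega
        · exact h9.imp_right fun ⟨i, hi, h⟩ => ⟨i, by omega, h⟩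
    · simp only [value_get, value_ofNat, g4.len] at hc
      have hz : cs k = 0 := plen_eq_zero.1 hc
      refine ⟨Frame.refl _ _, M, j, by rw [g5 51 (by decide), h4], by rw [g5 52 (by decide), h5],
        fun i hi => ?_, h9.imp_right fun ⟨i, hi, h⟩ => ⟨i, by omega, h⟩, fun ⟨i, hi, hne⟩ => h11
          ⟨i, ?_, hne⟩⟩
      · rcases Nat.lt_or_ge i k with hik | hik
        · exact h8 i hik
        · obtain rfl : i = k := by omega
          omega
      · rcases Nat.lt_or_ge i k with hik | hik
        · exact hik
        · obtain rfl : i = k := by omega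
          exact absurd hz hne
  rintro s3 ⟨g6, M', j', g7, g8, g9, g10, g11⟩
  have g12 : Frame [11, 12, 51, 52] s' s3 := g5.trans g6 (by simp) (by simp)
  refine wp_mono ?_ (wp_gcd (n := plen D) (m := plen (cs k)) (f := D) (g := cs k)
    (by rw [g12 0 (by decide), h2 0 (by decide), hI.prime_eq]) hp (by omega)
    (by rw [g12 10 (by decide)]; exact h3) (by rw [g6 11 (by decide)]; exact g4))
  rintro s4 ⟨g13, g14⟩
  have g15 : Frame [10, 11, 12, 15, 16, 17, 51, 52] s' s4 := g12.trans g13 (by simp) (by simp)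
  have hdvd : ∀ q, q ∣ mgcd D (cs k) ↔ ∀ i < k + 1, q ∣ cs i := fun q => by
    rw [dvd_mgcd, h6]
    refine ⟨fun h i hi => ?_, fun h => ⟨fun i hi => h i (by omega), h k (by omega)⟩⟩
    rcases Nat.lt_or_ge i k with hik | hik
    · exact h.1 i hik
    · obtain rfl : i = k := by omega
      exact h.2
  refine ⟨by rw [g15 50 (by decide), h1], by simp,
    (h2.trans g15 (by simp) (by simp [hfr])).write (by simp [hfr]) _ _,
    mgcd D (cs k), M', j', by simpa using g14, ?_, ?_, hdvd, monic_mgcd, g9, g10, ?_, g11⟩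
  · rw [write_ne _ _ _ (by decide), g13 51 (by decide), g7]
  · rw [write_ne _ _ _ (by decide), g13 52 (by decide), g8]
  · rcases eq_or_ne (cs k) 0 with hz | hz
    · rcases eq_or_ne D 0 with hz' | hz'
      · rw [hz, hz', plen_eq_zero.2]
        · omega
        · exact zero_dvd_iff.1 (dvd_mgcd.2 ⟨dvd_rfl, dvd_rfl⟩)
      · have hd : mgcd D (cs k) ∣ D := (dvd_mgcd.1 dvd_rfl).1
        rw [plen_of_ne (fun h => hz' (zero_dvd_iff.1 (h ▸ hd)))]
        rw [plen_of_ne hz'] at h10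
        have := natDegree_le_of_dvd hd hz'
        omega
    · have hd : mgcd D (cs k) ∣ cs k := (dvd_mgcd.1 dvd_rfl).2
      rw [plen_of_ne (fun h => hz (zero_dvd_iff.1 (h ▸ hd)))]
      rw [plen_of_ne hz] at hlk
      have := natDegree_le_of_dvd hd hz
      omega

/-- For the index `j` in `var 52`, the quotients of the input polynomials with the indices `j` and
`m + j` by their greatest common divisor, in the arrays `46` and `47`, and the maximum of their
lengths, in `var 53`. -/
def ratio (lam : ℕ) : Prog :=
  .store 50 0 (var 52) ;; loadColumn lam ;; copy 12 10 0 11 0 ;;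
  .store 50 0 (cols + var 52) ;; loadColumn lam ;; gcd ;; copy 12 26 0 10 0 ;;
  .store 50 0 (var 52) ;; loadColumn lam ;; copy 12 25 0 11 0 ;; quotientTo 46 ;;
  .store 50 0 (cols + var 52) ;; loadColumn lam ;; copy 12 25 0 11 0 ;; quotientTo 47 ;;
  .store 53 0 (var 46) ;; .cond (var 47 - var 46) (.store 53 0 (var 47)) .skip

theorem plen_divByMonic_le {p : ℕ} [Fact p.Prime] {f g : (ZMod p)[X]} (hg : g.Monic) :
    plen (f /ₘ g) ≤ plen f := by
  rcases eq_or_ne (f /ₘ g) 0 with h0 | h0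
  · simp [h0, plen_zero]
  have hf : f ≠ 0 := fun h => h0 (by rw [h, zero_divByMonic])
  rw [plen_of_ne h0, plen_of_ne hf, natDegree_divByMonic _ hg]
  omega

theorem wp_ratio {N p lam nb m j : ℕ} [Fact p.Prime] {s : State} {cs : ℕ → (ZMod p)[X]}
    (hI : Input lam nb m cs (s 0)) (hp : p < 2 ^ N) (hN : 4 * (nb + lam + m + 5) ≤ N)
    (hj : s 52 0 = j) (hjm : j < m) (hne : cs j ≠ 0 ∨ cs (m + j) ≠ 0) :
    wp N (ratio lam)
      (fun s' => Frame [10, 11, 12, 15, 16, 17, 24, 25, 26, 27, 28, 29, 46, 47, 50, 53] s s' ∧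
        Rep (s' 46) (cs j /ₘ mgcd (cs j) (cs (m + j)))
          (plen (cs j /ₘ mgcd (cs j) (cs (m + j)))) ∧
        Rep (s' 47) (cs (m + j) /ₘ mgcd (cs j) (cs (m + j)))
          (plen (cs (m + j) /ₘ mgcd (cs j) (cs (m + j)))) ∧
        s' 53 0 = max (plen (cs j /ₘ mgcd (cs j) (cs (m + j))))
          (plen (cs (m + j) /ₘ mgcd (cs j) (cs (m + j))))) s := by
  have hN2 : N < 2 ^ N := Nat.lt_two_pow_self
  set fr := [10, 11, 12, 15, 16, 17, 24, 25, 26, 27, 28, 29, 46, 47, 50, 53] with hfr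
  set a := cs j with ha
  set b := cs (m + j) with hb
  set h := mgcd a b with hh
  have hal : plen a ≤ nb + lam + 1 := plen_le (hI.zero j (by omega))
  have hbl : plen b ≤ nb + lam + 1 := plen_le (hI.zero (m + j) (by omega))
  have hha : h ∣ a := (dvd_mgcd.1 dvd_rfl).1
  have hhb : h ∣ b := (dvd_mgcd.1 dvd_rfl).2
  have hh0 : h ≠ 0 := fun h0 => by
    rw [h0] at hha hhb
    rcases hne with hne | hne
    · exact hne (zero_dvd_iff.1 hha)
    · exact hne (zero_dvd_iff.1 hhb)
  have hhm : h.Monic := monic_mgcd hh0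
  have hpl := plen_of_ne hh0
  have hhl : h.natDegree ≤ nb + lam := by
    rcases hne with hne | hne
    · have := natDegree_le_of_dvd hha hne
      rw [plen_of_ne hne] at hal
      omega
    · have := natDegree_le_of_dvd hhb hne
      rw [plen_of_ne hne] at hbl
      omega
  have key : ∀ (c : ℕ) (t : Term) (Q : State → Prop) (s' : State) (d : Prog), Frame fr s s' →
      c < m + m → t.value s' = c → (∀ s'', Frame [11, 12, 50] s' s'' →
        Rep (s'' 11) (cs c) (nb + lam + 1) → wp N d Q s'') →
      wp N (.store 50 0 t ;; loadColumn lam ;; d) Q s' := by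
    intro c t Q s' d h1 hc ht h2
    refine ⟨by rw [ht]; omega, ?_⟩
    rw [ht]
    refine wp_seq (wp_loadColumn (c := c) (nb := nb) (m := m) (cs := cs) ?_ hp (by omega) (by simp) hc) ?_
    · rw [write_ne _ _ _ (by decide), h1 0 (by decide)]; exact hI
    rintro s'' ⟨h3, h4⟩
    exact h2 s'' (((Frame.refl _ _).write (by simp) _ _).trans h3 (l := [50]) (by simp)
      (by simp)) h4
  refine key j _ _ _ _ (Frame.refl _ _) (by omega) (by simp [hj]) fun s1 f1 r1 => ?_
  refine wp_seq (wp_copy_zero r1 hp (by omega) (by decide) (by decide) (by decide)) ?_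
  rintro s2 ⟨f2, r2⟩
  have g2 : Frame [10, 11, 12, 50] s s2 := f1.trans f2 (by simp) (by simp)
  refine key (m + j) _ _ _ _ (g2.mono (by simp [hfr])) (by omega)
    (by simp [g2 0 (by decide), g2 52 (by decide), hI.m_eq, hj]) fun s3 f3 r3 => ?_
  have g3 : Frame [10, 11, 12, 50] s s3 := g2.trans f3 (by simp) (by simp)
  refine wp_seq (wp_gcd (n := nb + lam + 1) (m := nb + lam + 1) (by rw [g3 0 (by decide), hI.prime_eq]) hp (by omega)
    (by rw [f3 10 (by decide)]; exact r2) r3) ?_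
  rintro s4 ⟨f4, r4⟩
  have g4 : Frame [10, 11, 12, 15, 16, 17, 50] s s4 := g3.trans f4 (by simp) (by simp)
  rw [← ha, ← hb, ← hh] at r4
  refine wp_seq (wp_copy_zero r4 hp (by omega) (by decide) (by decide) (by decide)) ?_
  rintro s5 ⟨f5, r5⟩
  have g5 : Frame [10, 11, 12, 15, 16, 17, 26, 50] s s5 := g4.trans f5 (by simp) (by simp)
  refine key j _ _ _ _ (g5.mono (by simp [hfr])) (by omega)
    (by simp [g5 52 (by decide), hj]) fun s6 f6 r6 => ?_
  refine wp_seq (wp_copy_zero r6 hp (by omega) (by decide) (by decide) (by decide)) ?_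
  rintro s7 ⟨f7, r7⟩
  have f67 : Frame [11, 12, 25, 50] s5 s7 := f6.trans f7 (by simp) (by simp)
  have g7 : Frame [10, 11, 12, 15, 16, 17, 25, 26, 50] s s7 := g5.trans f67 (by simp) (by simp)
  have r26 : Rep (s7 26) h (h.natDegree + 1) := by rw [f67 26 (by decide), ← hpl]; exact r5
  refine wp_seq (wp_quotientTo (by rw [g7 0 (by decide), hI.prime_eq]) hp (by omega) (by omega)
    (by decide) r7 r26 hhm rfl) ?_
  rintro s8 ⟨f8, r8⟩
  have g8 : Frame [10, 11, 12, 15, 16, 17, 24, 25, 26, 27, 28, 29, 46, 50] s s8 :=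
    g7.trans f8 (by simp) (by simp)
  refine key (m + j) _ _ _ _ (g8.mono (by simp [hfr])) (by omega)
    (by simp [g8 0 (by decide), g8 52 (by decide), hI.m_eq, hj]) fun s9 f9 r9 => ?_
  refine wp_seq (wp_copy_zero r9 hp (by omega) (by decide) (by decide) (by decide)) ?_
  rintro s10 ⟨f10, r10⟩
  have f9' : Frame [11, 12, 25, 50] s8 s10 := f9.trans f10 (by simp) (by simp)
  have g10 : Frame [10, 11, 12, 15, 16, 17, 24, 25, 26, 27, 28, 29, 46, 50] s s10 :=
    g8.trans f9' (by simp) (by simp)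
  refine wp_seq (wp_quotientTo (by rw [g10 0 (by decide), hI.prime_eq]) hp (by omega)
    (show h.natDegree ≤ N by omega)
    (by decide) r10 (by rw [f9' 26 (by decide), f8 26 (by decide)]; exact r26) hhm rfl) ?_
  rintro s11 ⟨f11, r11⟩
  rw [← hb] at r11
  have g11 : Frame fr s s11 := g10.trans f11 (by simp [hfr]) (by simp [hfr])
  have r46 : Rep (s11 46) (a /ₘ h) (plen (a /ₘ h)) := by
    rw [f11 46 (by decide), f9' 46 (by decide)]; exact r8
  have hqa : plen (a /ₘ h) ≤ nb + lam + 1 := (plen_divByMonic_le hhm).trans hal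
  have hqb : plen (b /ₘ h) ≤ nb + lam + 1 := (plen_divByMonic_le hhm).trans hbl
  refine ⟨by simp [r46.len]; omega, fun hc => ⟨?_, ?_⟩, fun hc => ?_⟩
  · simp [r11.len]; omega
  · simp only [value_sub, value_get, value_ofNat, write_ne _ _ _ (show (47 : ℕ) ≠ 53 by decide),
      write_ne _ _ _ (show (46 : ℕ) ≠ 53 by decide), r46.len, r11.len] at hc
    refine ⟨(g11.write (by simp [hfr]) _ _).write (by simp [hfr]) _ _, by simpa using r46,
      by simpa using r11, ?_⟩
    simp [r11.len]
    omega
  · simp only [value_sub, value_get, value_ofNat, write_ne _ _ _ (show (47 : ℕ) ≠ 53 by decide),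
      write_ne _ _ _ (show (46 : ℕ) ≠ 53 by decide), r46.len, r11.len] at hc
    refine ⟨g11.write (by simp [hfr]) _ _, by simpa using r46,
      by simpa using r11, ?_⟩
    simp [r46.len]
    omega

/-! ### Small factors, traces, norms and test polynomials -/

section Polynomials

variable {p : ℕ} [Fact p.Prime]

/-- The `p`-th power of the variable modulo `D`. -/
noncomputable def frob (D : (ZMod p)[X]) : (ZMod p)[X] := X ^ p %ₘ D

/-- The product of the irreducible factors of `D` of degree at most two. -/
noncomputable def smallPart (D : (ZMod p)[X]) : (ZMod p)[X] := mgcd D (frob D ^ p %ₘ D - X)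

/-- A polynomial that is divisible by the linear factors of `D` only. -/
noncomputable def splitter (D : (ZMod p)[X]) : (ZMod p)[X] := frob D - X

/-- The trace `x + x ^ p` modulo `D`. -/
noncomputable def traceMod (D : (ZMod p)[X]) : (ZMod p)[X] := frob D + X

/-- The norm `x * x ^ p` modulo `D`. -/
noncomputable def normMod (D : (ZMod p)[X]) : (ZMod p)[X] := (frob D * X) %ₘ D

/-- The exponent of the quadratic character, or `1` if this is `0`. -/
def charExp (p : ℕ) : ℕ := (p - 1) / 2 + (1 - (p - 1) / 2)

/-- A polynomial that is divisible by those factors of `D` modulo which `T + c` is a nonzero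
square. -/
noncomputable def testPoly (D T : (ZMod p)[X]) (c : ℕ) : (ZMod p)[X] :=
  (T + C (c : ZMod p)) ^ charExp p %ₘ D - 1

theorem dvd_sub_modByMonic {D : (ZMod p)[X]} (f : (ZMod p)[X]) : D ∣ f - f %ₘ D :=
  ⟨f /ₘ D, by linear_combination -modByMonic_add_div f D⟩

theorem smallPart_dvd (D : (ZMod p)[X]) : smallPart D ∣ D := (dvd_mgcd.1 dvd_rfl).1

/-- Modulo a divisor of D, the p-th power of `frob D` is X^(p²). Two modular powers with exponent p
thus replace one with exponent p². -/
theorem dvd_smallPart {D q : (ZMod p)[X]} (hq : q ∣ D) :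
    q ∣ smallPart D ↔ q ∣ X ^ p ^ 2 - X := by
  have h1 : q ∣ X ^ p ^ 2 - frob D ^ p := by
    rw [sq, pow_mul]
    exact (hq.trans (dvd_sub_modByMonic _)).trans (sub_dvd_pow_sub_pow _ _ p)
  have h2 : q ∣ frob D ^ p - frob D ^ p %ₘ D := hq.trans (dvd_sub_modByMonic _)
  unfold smallPart
  rw [dvd_mgcd, and_iff_right hq, ← dvd_add_right (dvd_add h1 h2)]
  ring_nf

/-- It divides X^(p²) - X, which is separable. -/
theorem squarefree_smallPart (D : (ZMod p)[X]) : Squarefree (smallPart D) := by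
  have h : smallPart D ∣ X ^ p ^ 2 - X := (dvd_smallPart (smallPart_dvd D)).1 dvd_rfl
  exact (galois_poly_separable p (p ^ 2) (dvd_pow_self p two_ne_zero)).squarefree.squarefree_of_dvd h

theorem cast_pred_prime : ((p - 1 : ℕ) : ZMod p) = -1 := by
  rw [Nat.cast_pred (Fact.out : p.Prime).pos]; simp

end Polynomials

/-! ### Initial splitting by degree, and splitting by a quadratic character -/

theorem Frame.write_trans {l l' m : List ℕ} {s s' s'' : State} {a i v : ℕ} (h : Frame l s s')
    (h' : Frame l' (s'.write a i v) s'') (hl : l ⊆ m) (hl' : l' ⊆ m) (ha : a ∈ m) : Frame m s s'' :=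
  ((h.mono hl).write ha i v).trans h' (fun _ h => h) hl'

/-- The power with exponent `t` of the polynomial in the array `a`, modulo the monic polynomial in
the array `26`, in the array `30`. -/
def powerOf (a : ℕ) (t : Term) : Prog := copy 12 31 0 a 0 ;; .store 32 0 t ;; powMod

theorem wp_powerOf {N p a : ℕ} [Fact p.Prime] {t : Term} {s : State} {f h : (ZMod p)[X]}
    {n d e L : ℕ} (hs : s 0 1 = p) (hp : p < 2 ^ N) (hL : 2 * L + 1 ≤ N) (hL1 : 1 ≤ L) (hn : n ≤ L)
    (hd : d ≤ L) (ha : a ∉ [12, 31]) (hf : Rep (s a) f n) (hh : Rep (s 26) h (d + 1))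
    (hhm : h.Monic) (hhd : h.natDegree = d) (ht : ∀ s', Frame [12, 31] s s' → t.value s' = e)
    (he0 : e ≠ 0) (heN : e < 2 ^ N) :
    wp N (powerOf a t) (fun s' => Frame [12, 23, 24, 25, 27, 28, 29, 30, 31, 32, 33] s s' ∧
      ∃ l ≤ L, Rep (s' 30) (f ^ e %ₘ h) l) s := by
  simp only [List.mem_cons, List.not_mem_nil, or_false, not_or] at ha
  refine wp_seq (wp_copy_zero hf hp (by omega) (by decide) ha.1 ha.2) ?_
  rintro s1 ⟨h1, h2⟩
  refine ⟨by rw [ht s1 h1]; exact heN, ?_⟩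
  rw [ht s1 h1]
  refine wp_mono ?_ (wp_powMod (f := f) (h := h) (n := n) (d := d) (e := e) (L := L)
    (by rw [write_ne _ _ _ (by decide), h1 0 (by decide), hs]) hp hL hL1 hn hd
    (by rw [write_ne _ _ _ (by decide)]; exact h2)
    (by rw [write_ne _ _ _ (by decide), h1 26 (by decide)]; exact hh) hhm hhd (by simp) he0 heN)
  rintro s2 ⟨h3, h4⟩
  exact ⟨h1.write_trans h3 (by simp) (by simp) (by simp), h4⟩

/-- For the monic polynomial `D` in the array `45`, prepare the splitting of its factors of degree
at most two. -/
def setup (lam : ℕ) : Prog :=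
  -- The arrays 61 and 68 are filled with the polynomials X and 1.
  .store 61 0 2 ;; .store 61 1 0 ;; .store 61 2 1 ;; .store 68 0 1 ;; .store 68 1 1 ;;
  copy 12 26 0 45 0 ;;
  powerOf 61 modulus ;; copy 12 48 0 30 0 ;;
  powerOf 48 modulus ;; addLinear 12 11 30 0 (modulus - 1) ;; copy 12 10 0 45 0 ;; gcd ;;
  .store 40 0 1 ;; .store 40 1 1 ;; copy 12 40 (width lam) 10 0 ;; .store 41 0 2 ;;
  addLinear 12 49 48 0 (modulus - 1) ;; addLinear 12 60 48 0 1 ;;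
  mulMod 48 61 ;; copy 12 62 0 25 0 ;; refine lam 49

theorem rep_one {p : ℕ} [Fact p.Prime] {A : ℕ → ℕ} (h0 : A 0 = 1) (h1 : A 1 = 1) :
    Rep A (1 : (ZMod p)[X]) 1 := by
  have : Fact (1 < p) := ⟨(Fact.out : p.Prime).one_lt⟩
  refine ⟨h0, fun i hi => ?_, fun i hi => ?_⟩
  · obtain rfl : i = 0 := by omega
    simp [h1, ZMod.val_one]
  · rw [coeff_one, if_neg (by omega)]

theorem rep_X {p : ℕ} [Fact p.Prime] {A : ℕ → ℕ} (h0 : A 0 = 2) (h1 : A 1 = 0) (h2 : A 2 = 1) :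
    Rep A (X : (ZMod p)[X]) 2 := by
  have : Fact (1 < p) := ⟨(Fact.out : p.Prime).one_lt⟩
  refine ⟨h0, fun i hi => ?_, fun i hi => ?_⟩
  · interval_cases i
    · simp [h1]
    · simp [h2, ZMod.val_one]
  · rw [coeff_X, if_neg (by omega)]

set_option maxHeartbeats 1000000 in
theorem wp_setup {N p lam nb : ℕ} [Fact p.Prime] {s : State} {D : (ZMod p)[X]} (hs : s 0 1 = p)
    (hnb : s 0 2 = nb) (hp : p < 2 ^ N) (hN : 4 * (nb + lam + 5) ≤ N)
    (hD : Rep (s 45) D (plen D)) (hDm : D.Monic) (hDd : D.natDegree < nb + lam + 1) :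
    wp N (setup lam) (fun s' =>
      Frame [10, 11, 12, 15, 16, 17, 23, 24, 25, 26, 27, 28, 29, 30, 31, 32, 33, 40, 41, 42, 48, 49,
        60, 61, 62, 63, 64, 68] s s' ∧
      Rep (s' 68) (1 : (ZMod p)[X]) 1 ∧
      (∃ l ≤ nb + lam + 4, Rep (s' 49) (splitter D) l) ∧
      (∃ l ≤ nb + lam + 4, Rep (s' 60) (traceMod D) l) ∧
      (∃ l ≤ nb + lam + 4, Rep (s' 62) (normMod D) l) ∧
      ∃ (F : ℕ → (ZMod p)[X]) (n : ℕ), Pieces (nb + lam + 3) s' F n ∧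
        Factorization (smallPart D) F n ∧ ∀ i < n, Resolved (splitter D) (F i)) s := by
  have hN2 : N < 2 ^ N := Nat.lt_two_pow_self
  have hp0 : p ≠ 0 := (Fact.out : p.Prime).ne_zero
  set fr := [10, 11, 12, 15, 16, 17, 23, 24, 25, 26, 27, 28, 29, 30, 31, 32, 33, 40, 41, 42, 48, 49,
        60, 61, 62, 63, 64, 68] with hfr
  have hDl := plen_of_ne hDm.ne_zero
  have hmod : ∀ {s1 s2 : State} {l : List ℕ}, Frame fr s s1 → Frame [12, 31] s1 s2 →
      (modulus).value s2 = p := fun h h' => by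
    simp [h' 0 (by decide), h 0 (by decide), hs]
  have hE : smallPart D ≠ 0 := (squarefree_smallPart D).ne_zero
  have hEl : plen (smallPart D) ≤ nb + lam + 1 := by
    rw [plen_of_ne hE]
    have := natDegree_le_of_dvd (smallPart_dvd D) hDm.ne_zero
    omega
  refine ⟨by simp; omega, by simp, by simp; omega, by simp; omega, by simp; omega, ?_⟩
  set s₁ := (((((s.write 61 0 2).write 61 1 0).write 61 2 1).write 68 0 1).write 68 1 1) with hs₁
  have g₁ : Frame fr s s₁ := (((((Frame.refl _ _).write (by simp [hfr]) _ _).write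
    (by simp [hfr]) _ _).write (by simp [hfr]) _ _).write (by simp [hfr]) _ _).write
    (by simp [hfr]) _ _
  have r61 : Rep (s₁ 61) (X : (ZMod p)[X]) 2 := by
    refine rep_X ?_ ?_ ?_ <;> simp [hs₁]
  have r68 : Rep (s₁ 68) (1 : (ZMod p)[X]) 1 := by
    refine rep_one ?_ ?_ <;> simp [hs₁]
  have r45 : Rep (s₁ 45) D (plen D) := by simpa [hs₁] using hD
  change wp N _ _ s₁
  refine wp_seq (wp_copy_zero r45 hp (by omega) (by decide) (by decide) (by decide)) ?_
  rintro s2 ⟨f2, r26⟩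
  have g2 : Frame fr s s2 := g₁.trans f2 (by simp) (by simp [hfr])
  rw [hDl] at r26
  refine wp_seq (wp_powerOf (a := 61) (f := X) (L := nb + lam + 2) (d := D.natDegree) (h := D)
    (by rw [g2 0 (by decide), hs]) hp (by omega) (by omega) (show 2 ≤ nb + lam + 2 by omega)
    (by omega) (by decide)
    (by rw [f2 61 (by decide)]; exact r61) r26 hDm rfl
    (fun s' h => hmod (l := []) g2 h) hp0 hp) ?_
  rintro s3 ⟨f3, l3, hl3, r30⟩
  have g3 : Frame fr s s3 := g2.trans f3 (by simp) (by simp [hfr])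
  refine wp_seq (wp_copy_zero r30 hp (by omega) (by decide) (by decide) (by decide)) ?_
  rintro s4 ⟨f4, r48⟩
  have g4 : Frame fr s s4 := g3.trans f4 (by simp) (by simp [hfr])
  change Rep (s4 48) (frob D) l3 at r48
  have r26' : Rep (s4 26) D (D.natDegree + 1) := by
    rw [f4 26 (by decide), f3 26 (by decide)]; exact r26
  refine wp_seq (wp_powerOf (a := 48) (L := nb + lam + 2) (d := D.natDegree) (h := D)
    (by rw [g4 0 (by decide), hs]) hp (by omega) (by omega) hl3
    (by omega) (by decide) r48 r26' hDm rfl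
    (fun s' h => hmod (l := []) g4 h) hp0 hp) ?_
  rintro s5 ⟨f5, l5, hl5, r30'⟩
  have g5 : Frame fr s s5 := g4.trans f5 (by simp) (by simp [hfr])
  refine wp_seq (wp_addLinear (x₀ := 0) (x₁ := p - 1) (by rw [g5 0 (by decide), hs]) hp
    (show l5 + 2 ≤ N by omega)
    (by decide) (by decide) (by decide) (by decide) (by decide) r30' (fun _ _ => rfl)
    (fun s' h => by simp [h 0 (by decide), g5 0 (by decide), hs])) ?_
  rintro s6 ⟨f6, r11⟩
  have g6 : Frame fr s s6 := g5.trans f6 (by simp) (by simp [hfr])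
  have he : frob D ^ p %ₘ D + C ((0 : ℕ) : ZMod p) + C ((p - 1 : ℕ) : ZMod p) * X =
      frob D ^ p %ₘ D - X := by
    rw [cast_pred_prime]; simp; ring
  rw [he] at r11
  refine wp_seq (wp_copy_zero (f := D) (n := plen D) (by rw [g6 45 (by decide)]; exact hD) hp
    (by omega) (by decide) (by decide) (by decide)) ?_
  rintro s7 ⟨f7, r10⟩
  have g7 : Frame fr s s7 := g6.trans f7 (by simp) (by simp [hfr])
  refine wp_seq (wp_gcd (n := plen D) (m := l5 + 2) (by rw [g7 0 (by decide), hs]) hp (by omega) r10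
    (by rw [f7 11 (by decide)]; exact r11)) ?_
  rintro s8 ⟨f8, r10'⟩
  change Rep (s8 10) (smallPart D) (plen (smallPart D)) at r10'
  have f48 : Frame [10, 11, 12, 15, 16, 17, 23, 24, 25, 27, 28, 29, 30, 31, 32, 33] s4 s8 :=
    ((f5.trans f6 (m := [11, 12, 23, 24, 25, 27, 28, 29, 30, 31, 32, 33]) (by simp) (by simp)).trans
      f7 (m := [10, 11, 12, 23, 24, 25, 27, 28, 29, 30, 31, 32, 33]) (by simp) (by simp)).trans f8
      (by simp) (by simp)
  have g8 : Frame fr s s8 := g4.trans f48 (by simp) (by simp [hfr])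
  refine ⟨by simp; omega, by simp; omega, ?_⟩
  set s9 := (s8.write 40 0 1).write 40 1 1 with hs9
  have f9 : Frame [40] s8 s9 := ((Frame.refl _ _).write (by simp) _ _).write (by simp) _ _
  have g9 : Frame fr s s9 := g8.trans f9 (by simp) (by simp [hfr])
  change wp N _ _ s9
  refine wp_seq (P := fun s10 => Frame [12, 40] s9 s10 ∧
    Rep (fun j => s10 40 (nb + lam + 3 + j)) (smallPart D) (plen (smallPart D)) ∧
    Rep (s10 40) (1 : (ZMod p)[X]) 1) ?_ ?_
  · refine wp_copy (oA := nb + lam + 3) (oB := 0) (n := plen (smallPart D)) hp (by omega)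
      (by decide) (by decide) (by decide) (fun s' h => ?_) (fun _ _ => rfl)
      (by simpa [f9 10 (by decide)] using r10') fun s10 h1 h2 h3 => ⟨h1, h2, ?_⟩
    · simp [h 0 (by decide), g9 0 (by decide), hnb]; omega
    · refine rep_one ?_ ?_
      · rw [h3 _ (by omega), hs9]; simp
      · rw [h3 _ (by omega), hs9]; simp
  rintro s10 ⟨f10, r40, r40'⟩
  refine ⟨by simp; omega, ?_⟩
  set s11 := s10.write 41 0 2 with hs11
  have f11 : Frame [12, 40, 41] s8 s11 := (f9.trans f10 (m := [12, 40, 41]) (by simp)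
    (by simp)).write (by simp) _ _
  have g11 : Frame fr s s11 := g8.trans f11 (by simp) (by simp [hfr])
  change wp N _ _ s11
  have r48' : Rep (s11 48) (frob D) l3 := by rw [f11 48 (by decide), f48 48 (by decide)]; exact r48
  refine wp_seq (wp_addLinear (x₀ := 0) (x₁ := p - 1) (by rw [g11 0 (by decide), hs]) hp
    (show l3 + 2 ≤ N by omega)
    (by decide) (by decide) (by decide) (by decide) (by decide) r48' (fun _ _ => rfl)
    (fun s' h => by simp [h 0 (by decide), g11 0 (by decide), hs])) ?_
  rintro s12 ⟨f12, r49⟩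
  have g12 : Frame fr s s12 := g11.trans f12 (by simp) (by simp [hfr])
  have he : frob D + C ((0 : ℕ) : ZMod p) + C ((p - 1 : ℕ) : ZMod p) * X = splitter D := by
    rw [cast_pred_prime, splitter]; simp; ring
  rw [he] at r49
  refine wp_seq (wp_addLinear (x₀ := 0) (x₁ := 1) (by rw [g12 0 (by decide), hs]) hp
    (show l3 + 2 ≤ N by omega) (by decide) (by decide) (by decide) (by decide) (by decide)
    (by rw [f12 48 (by decide)]; exact r48') (fun _ _ => rfl) (fun _ _ => rfl)) ?_
  rintro s13 ⟨f13, r60⟩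
  have f13' : Frame [12, 49, 60] s11 s13 := f12.trans f13 (by simp) (by simp)
  have g13 : Frame fr s s13 := g11.trans f13' (by simp) (by simp [hfr])
  have he : frob D + C ((0 : ℕ) : ZMod p) + C ((1 : ℕ) : ZMod p) * X = traceMod D := by
    rw [traceMod]; simp
  rw [he] at r60
  refine wp_seq (wp_mulMod (n := l3) (m := 2) (d := D.natDegree) (h := D)
    (by rw [g13 0 (by decide), hs]) hp (by omega) (by omega) (by decide) (by decide)
    (by rw [f13' 48 (by decide)]; exact r48')
    (by rw [f13' 61 (by decide), f11 61 (by decide), f48 61 (by decide), f4 61 (by decide),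
      f3 61 (by decide), f2 61 (by decide)]; exact r61)
    (by rw [f13' 26 (by decide), f11 26 (by decide), f48 26 (by decide)]; exact r26')
    hDm rfl) ?_
  rintro s14 ⟨f14, r25⟩
  have g14 : Frame fr s s14 := g13.trans f14 (by simp) (by simp [hfr])
  change Rep (s14 25) (normMod D) _ at r25
  refine wp_seq (wp_copy_zero r25 hp (by omega) (by decide) (by decide) (by decide)) ?_
  rintro s15 ⟨f15, r62⟩
  have f15' : Frame [12, 23, 24, 25, 27, 28, 29, 62] s13 s15 := f14.trans f15 (by simp) (by simp)
  have g15 : Frame fr s s15 := g13.trans f15' (by simp) (by simp [hfr])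
  have f16 : Frame [12, 23, 24, 25, 27, 28, 29, 49, 60, 62] s11 s15 :=
    f13'.trans f15' (by simp) (by simp)
  have r49' : Rep (s15 49) (splitter D) (l3 + 2) := by
    rw [f15' 49 (by decide), f13 49 (by decide)]; exact r49
  -- The list starts as 1, `smallPart D`. The entry 1 is padding: it gives every product of at most
  -- two pieces the form F i · F j. The second entry may be constant, which is why `Factorization`
  -- demands positive degrees only from index 2 on.
  have hfac : Factorization (smallPart D) (fun i => if i = 0 then 1 else smallPart D) 2 := by
    refine ⟨le_rfl, by simp, fun i hi => ?_, by simp [Finset.prod_range_succ], fun i hi hi' => by omega⟩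
    split_ifs
    · exact monic_one
    · exact monic_mgcd hE
  refine wp_mono ?_ (wp_refine (lam := lam) (nb := nb) (a := 49) (nG := l3 + 2) (n := 2)
    (Gs := ∅) (by rw [g15 0 (by decide), hs])
    (by rw [g15 0 (by decide), hnb]) hp hN (by decide) (squarefree_smallPart D)
    (by rw [plen_of_ne hE] at hEl; omega) (by omega) r49' ⟨?_, ?_⟩ hfac (by simp))
  · rintro s17 ⟨f17, F, n, h1, h2, h3⟩
    refine ⟨g15.trans f17 (by simp) (by simp [hfr]), ?_, ⟨l3 + 2, by omega, ?_⟩,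
      ⟨l3 + 2, by omega, ?_⟩, ⟨min (l3 + 2 - 1) D.natDegree, by omega, ?_⟩, F, n, h1, h2, h3 _ (Set.mem_insert _ _)⟩
    · rw [f17 68 (by decide), f16 68 (by decide), f11 68 (by decide), f48 68 (by decide),
        f4 68 (by decide), f3 68 (by decide), f2 68 (by decide)]
      exact r68
    · rw [f17 49 (by decide)]; exact r49'
    · rw [f17 60 (by decide), f15' 60 (by decide)]; exact r60
    · rw [f17 62 (by decide)]; exact r62
  · rw [f16 41 (by decide), hs11]; simp
  · intro i hi
    have h40 : s15 40 = s10 40 := by rw [f16 40 (by decide), hs11]; simp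
    rw [h40]
    interval_cases i
    · simpa [plen_of_ne] using r40'
    · simpa using r40

/-- Split the list of factors by the quadratic character of `T + c`, where `T` is the polynomial in
the array `a` and `c` is `var 56`. -/
def trial (lam a : ℕ) : Prog :=
  copy 12 26 0 45 0 ;; addLinear 12 66 a (var 56) 0 ;;
  -- The second summand is 0 for odd p and 1 for p = 2, where (p - 1) / 2 = 0 would give an exponent
  -- that distinguishes nothing.
  powerOf 66 ((modulus - 1) / 2 + (1 - (modulus - 1) / 2)) ;;
  addLinear 12 65 30 (modulus - 1) 0 ;; refine lam 65

theorem wp_trial {N p lam nb a l c n : ℕ} [Fact p.Prime] {s : State} {D T : (ZMod p)[X]}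
    {F : ℕ → (ZMod p)[X]} {Gs : Set (ZMod p)[X]} (hs : s 0 1 = p)
    (hnb : s 0 2 = nb) (hp : p < 2 ^ N) (hN : 4 * (nb + lam + 5) ≤ N)
    (hD : Rep (s 45) D (plen D)) (hDm : D.Monic) (hDd : D.natDegree < nb + lam + 1)
    (ha : a ∉ [0, 12, 26, 66]) (hT : Rep (s a) T l) (hl : l ≤ nb + lam + 4) (hc : s 56 0 = c)
    (hP : Pieces (nb + lam + 3) s F n) (hF : Factorization (smallPart D) F n)
    (hGs : ∀ g ∈ Gs, ∀ i < n, Resolved g (F i)) :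
    wp N (trial lam a) (fun s' =>
      Frame [10, 11, 12, 15, 16, 17, 23, 24, 25, 26, 27, 28, 29, 30, 31, 32, 33, 40, 41, 42, 63, 64,
        65, 66] s s' ∧
      ∃ (F' : ℕ → (ZMod p)[X]) (n' : ℕ), Pieces (nb + lam + 3) s' F' n' ∧
        Factorization (smallPart D) F' n' ∧
        ∀ g ∈ insert (testPoly D T c) Gs, ∀ i < n', Resolved g (F' i)) s := by
  have hN2 : N < 2 ^ N := Nat.lt_two_pow_self
  set fr := [10, 11, 12, 15, 16, 17, 23, 24, 25, 26, 27, 28, 29, 30, 31, 32, 33, 40, 41, 42, 63, 64,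
        65, 66] with hfr
  have hDl := plen_of_ne hDm.ne_zero
  simp only [List.mem_cons, List.not_mem_nil, or_false, not_or] at ha
  have hE : smallPart D ≠ 0 := (squarefree_smallPart D).ne_zero
  have hp2 := (Fact.out : p.Prime).two_le
  refine wp_seq (wp_copy_zero hD hp (by omega) (by decide) (by decide) (by decide)) ?_
  rintro s2 ⟨f2, r26⟩
  rw [hDl] at r26
  refine wp_seq (wp_addLinear (x₀ := c) (x₁ := 0) (f := T) (n := l) (by rw [f2 0 (by decide), hs])
    hp (by omega) ha.2.2.2 (by decide) ha.2.1 (by decide) (by decide)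
    (by rw [f2 a (by simp; omega)]; exact hT)
    (fun s' h => by simp [h 56 (by decide), f2 56 (by decide), hc]) (fun _ _ => rfl)) ?_
  rintro s3 ⟨f3, r66⟩
  have g3 : Frame [12, 26, 66] s s3 := f2.trans f3 (by simp) (by simp)
  have he : T + C (c : ZMod p) + C ((0 : ℕ) : ZMod p) * X = T + C (c : ZMod p) := by simp
  rw [he] at r66
  refine wp_seq (wp_powerOf (a := 66) (L := nb + lam + 6) (e := charExp p) (d := D.natDegree)
    (h := D) (by rw [g3 0 (by decide), hs]) hp (by omega) (by omega) (show l + 2 ≤ _ by omega)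
    (by omega) (by decide) r66 (by rw [f3 26 (by decide)]; exact r26) hDm rfl
    (fun s' h => by simp [h 0 (by decide), g3 0 (by decide), hs, charExp])
    (by unfold charExp; omega) (by unfold charExp; omega)) ?_
  rintro s4 ⟨f4, l4, hl4, r30⟩
  have g4 : Frame fr s s4 := g3.trans f4 (by simp [hfr]) (by simp [hfr])
  refine wp_seq (wp_addLinear (x₀ := p - 1) (x₁ := 0) (by rw [g4 0 (by decide), hs]) hp
    (show l4 + 2 ≤ N by omega) (by decide) (by decide) (by decide) (by decide) (by decide) r30
    (fun s' h => by simp [h 0 (by decide), g4 0 (by decide), hs]) (fun _ _ => rfl)) ?_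
  rintro s5 ⟨f5, r65⟩
  have f5' : Frame [12, 23, 24, 25, 26, 27, 28, 29, 30, 31, 32, 33, 65, 66] s s5 :=
    (g3.trans f4 (m := [12, 23, 24, 25, 26, 27, 28, 29, 30, 31, 32, 33, 66]) (by simp)
      (by simp)).trans f5 (by simp) (by simp)
  have g5 : Frame fr s s5 := f5'.mono (by simp [hfr])
  have he : (T + C (c : ZMod p)) ^ charExp p %ₘ D + C ((p - 1 : ℕ) : ZMod p) +
      C ((0 : ℕ) : ZMod p) * X = testPoly D T c := by
    rw [cast_pred_prime, testPoly]; simp; ring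
  rw [he] at r65
  refine wp_mono ?_ (wp_refine (lam := lam) (nb := nb) (a := 65) (nG := l4 + 2) (n := n)
    (Gs := Gs) (by rw [g5 0 (by decide), hs])
    (by rw [g5 0 (by decide), hnb]) hp hN (by decide) (squarefree_smallPart D)
    ((natDegree_le_of_dvd (smallPart_dvd D) hDm.ne_zero).trans_lt hDd) (by omega) r65
    (hP.congr (f5' 40 (by decide)) (f5' 41 (by decide))) hF hGs)
  rintro s6 ⟨f6, h6⟩
  exact ⟨g5.trans f6 (by simp) (by simp [hfr]), h6⟩

/-! ### Random trials -/

/-- The number with the `n` binary digits in the `k`-th block of the array `A`. -/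
def coinValue (A : ℕ → ℕ) (n k : ℕ) : ℕ := ∑ i ∈ Finset.range n, A (k * n + i + 1) * 2 ^ i

/-- The polynomials by which the factors of `D` have been split after `k` trials. -/
def tests {p : ℕ} [Fact p.Prime] (D : (ZMod p)[X]) (A : ℕ → ℕ) (n k : ℕ) : Set (ZMod p)[X] :=
  {g | g = splitter D ∨ ∃ j < k, g = testPoly D (traceMod D) (coinValue A n j) ∨
    g = testPoly D (normMod D) (coinValue A n j)}

/-- Split the list of factors by `16 n` trials, if there are `16 n ^ 2` coin flips. -/
def randomize (lam : ℕ) : Prog :=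
  -- The number n is recovered from the number 16 n² of coin flips by a linear search.
  .store 54 0 0 ;; .loop (.get 1 0 - 16 * var 54 * var 54) (.store 54 0 (var 54 + 1)) ;;
  forDo 55 (16 * var 54) (
    .store 56 0 0 ;;
    -- Horner's rule, from the highest digit of the block downwards.
    forDo 57 (var 54) (.store 56 0 (2 * var 56 + .get 1 (var 55 * var 54 + var 54 - var 57))) ;;
    trial lam 60 ;; trial lam 62)

set_option maxHeartbeats 1000000 in
theorem wp_randomize {N p lam nb n k l l' : ℕ} [Fact p.Prime] {s : State} {D : (ZMod p)[X]}
    {F : ℕ → (ZMod p)[X]} (hs : s 0 1 = p)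
    (hnb : s 0 2 = nb) (hp : p < 2 ^ N) (hN : 4 * (nb + lam + 5) ≤ N)
    (hD : Rep (s 45) D (plen D)) (hDm : D.Monic) (hDd : D.natDegree < nb + lam + 1)
    (hl : l ≤ nb + lam + 4) (hT : Rep (s 60) (traceMod D) l)
    (hl' : l' ≤ nb + lam + 4) (hT' : Rep (s 62) (normMod D) l')
    (hP : Pieces (nb + lam + 3) s F k) (hF : Factorization (smallPart D) F k)
    (hG : ∀ i < k, Resolved (splitter D) (F i))
    (hn : s 1 0 = 16 * n * n) (hnN : 16 * n + 1 ≤ N) (hbit : ∀ i, s 1 (i + 1) ≤ 1) :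
    wp N (randomize lam) (fun s' =>
      Frame [10, 11, 12, 15, 16, 17, 23, 24, 25, 26, 27, 28, 29, 30, 31, 32, 33, 40, 41, 42, 54, 55,
        56, 57, 63, 64, 65, 66] s s' ∧
      ∃ (F' : ℕ → (ZMod p)[X]) (k' : ℕ), Pieces (nb + lam + 3) s' F' k' ∧
        Factorization (smallPart D) F' k' ∧
        ∀ g ∈ tests D (s 1) n (16 * n), ∀ i < k', Resolved g (F' i)) s := by
  have hN2 : N < 2 ^ N := Nat.lt_two_pow_self
  set fr := [10, 11, 12, 15, 16, 17, 23, 24, 25, 26, 27, 28, 29, 30, 31, 32, 33, 40, 41, 42, 54, 55,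
        56, 57, 63, 64, 65, 66] with hfr
  refine ⟨by simp, ?_⟩
  refine wp_seq (P := fun s' => Frame [54] s s' ∧ s' 54 0 = n) ?_ ?_
  · refine ⟨fun j s' => Frame [54] s s' ∧ ∃ t, s' 54 0 = t ∧ t ≤ n ∧ n - t ≤ j,
      ⟨(Frame.refl _ _).write (by simp) _ _, 0, by simp, by omega, by omega⟩, ?_⟩
    rintro j s' ⟨h1, t, h2, h3, h4⟩
    simp only [value_sub, value_mul, value_get, value_ofNat, h1 1 (by decide), hn, h2]
    refine ⟨fun h => ⟨h1, ?_⟩, fun h => ?_⟩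
    · by_contra hne
      have h5 : t * t < n * n := Nat.mul_self_lt_mul_self (by omega)
      rw [mul_assoc, mul_assoc] at h
      omega
    · have h5 : t ≠ n := fun h5 => by subst h5; omega
      exact ⟨j - 1, by omega, by simp [h2]; omega, h1.write (by simp) _ _, t + 1, by simp [h2],
        by omega, by omega⟩
  rintro s1 ⟨h1, h54⟩
  refine wp_forDo (fun j s' => s' 55 0 = j ∧ Frame fr s s' ∧ s' 54 0 = n ∧
    ∃ (F' : ℕ → (ZMod p)[X]) (k' : ℕ), Pieces (nb + lam + 3) s' F' k' ∧
        Factorization (smallPart D) F' k' ∧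
        ∀ g ∈ tests D (s 1) n j, ∀ i < k', Resolved g (F' i)) (16 * n) (by omega) ?_ ?_ ?_ ?_
  · refine ⟨by simp, (h1.mono (by simp [hfr])).write (by simp [hfr]) _ _, by simpa using h54, F, k,
      hP.congr ?_ ?_, hF, fun g hg i hi => ?_⟩
    · rw [write_ne _ _ _ (by decide), h1 40 (by decide)]
    · rw [write_ne _ _ _ (by decide), h1 41 (by decide)]
    · rcases hg with rfl | ⟨j, hj, -⟩
      · exact hG i hi
      · omega
  · rintro j s' hj ⟨g1, g2, g3, -⟩
    exact ⟨g1, by simp [g3]⟩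
  swap
  · rintro s' ⟨-, g2, -, h⟩
    exact ⟨g2, h⟩
  rintro j s2 hj ⟨g1, g2, g3, F₁, k₁, g4, g5, g6⟩ -
  refine ⟨by simp, ?_⟩
  refine wp_seq (P := fun s' => Frame [56, 57] s2 s' ∧ s' 56 0 = coinValue (s 1) n j) ?_ ?_
  · refine wp_forDo (fun t s' => s' 57 0 = t ∧ Frame [56, 57] s2 s' ∧
      s' 56 0 = ∑ i ∈ Finset.range t, s 1 (j * n + (n - t) + i + 1) * 2 ^ i) n (by omega) ?_ ?_ ?_ ?_
    · exact ⟨by simp, ((Frame.refl _ _).write (by simp) _ _).write (by simp) _ _, by simp⟩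
    · rintro t s' ht ⟨i1, i2, i3⟩
      exact ⟨i1, by simp [i2 54 (by decide), g3]⟩
    · rintro t s' ht ⟨i1, i2, i3⟩ -
      have hb : ∀ t (B : ℕ → ℕ), (∀ i, B i ≤ 1) →
          ∑ i ∈ Finset.range t, B i * 2 ^ i < 2 ^ t := fun t B hB => by
        induction t with
        | zero => simp
        | succ t ih =>
          rw [Finset.sum_range_succ, pow_succ]
          have := Nat.mul_le_mul_right (2 ^ t) (hB t)
          omega
      have hv : (2 * var 56 + .get 1 (var 55 * var 54 + var 54 - var 57) : Term).value s' =
          ∑ i ∈ Finset.range (t + 1), s 1 (j * n + (n - (t + 1)) + i + 1) * 2 ^ i := by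
        simp only [value_add, value_mul, value_sub, value_get, value_ofNat, i1, i3,
          i2 55 (by decide), i2 54 (by decide), g1, g3, i2 1 (by decide), g2 1 (by decide)]
        rw [Finset.sum_range_succ', Finset.mul_sum]
        congr 1
        · refine Finset.sum_congr rfl fun i _ => ?_
          rw [show j * n + (n - (t + 1)) + (i + 1) + 1 = j * n + (n - t) + i + 1 by omega, pow_succ]
          ring
        · rw [show j * n + (n - (t + 1)) + 0 + 1 = j * n + n - t by omega]
          simp
      refine ⟨?_, by simp [i1], by simp, (i2.write (by simp) _ _).write (by simp) _ _, ?_⟩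
      · rw [hv]
        refine (hb (t + 1) _ fun i => hbit _).trans_le ?_
        exact Nat.pow_le_pow_right (by norm_num) (by omega)
      · rw [write_ne _ _ _ (by decide), write_same, hv]
        simp
    · rintro s' ⟨i1, i2, i3⟩
      refine ⟨i2, ?_⟩
      rw [i3]
      simp [coinValue]
  rintro s3 ⟨g7, g8⟩
  have g9 : Frame fr s s3 := g2.trans g7 (by simp) (by simp [hfr])
  refine wp_seq (wp_trial (D := D) (a := 60) (T := traceMod D) (l := l) (F := F₁) (n := k₁)
    (Gs := tests D (s 1) n j)
    (by rw [g9 0 (by decide), hs]) (by rw [g9 0 (by decide), hnb]) hp hN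
    (by rw [g9 45 (by decide)]; exact hD) hDm hDd (by decide)
    (by rw [g9 60 (by decide)]; exact hT) hl g8
    (g4.congr (g7 40 (by decide)) (g7 41 (by decide))) g5 g6) ?_
  rintro s4 ⟨g10, F₂, k₂, g11, g12, g13⟩
  have g14 : Frame fr s s4 := g9.trans g10 (by simp) (by simp [hfr])
  refine wp_mono ?_ (wp_trial (D := D) (a := 62) (T := normMod D) (l := l') (F := F₂) (n := k₂)
    (c := coinValue (s 1) n j)
    (by rw [g14 0 (by decide), hs]) (by rw [g14 0 (by decide), hnb]) hp hN
    (by rw [g14 45 (by decide)]; exact hD) hDm hDd (by decide)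
    (by rw [g14 62 (by decide)]; exact hT') hl' (by rw [g10 56 (by decide), g8])
    g11 g12 g13)
  rintro s5 ⟨g15, F₃, k₃, g16, g17, g18⟩
  have g19 : Frame fr s s5 := g14.trans g15 (by simp) (by simp [hfr])
  refine ⟨?_, by simp, g19.write (by simp [hfr]) _ _, ?_, F₃, k₃, g16.congr (by simp) (by simp), g17,
    fun g hg i hi => ?_⟩
  · rw [g15 55 (by decide), g10 55 (by decide), g7 55 (by decide), g1]
  · rw [write_ne _ _ _ (by decide), g15 54 (by decide), g10 54 (by decide), g7 54 (by decide), g3]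
  · refine g18 g ?_ i hi
    rcases hg with rfl | ⟨t, ht, h⟩
    · exact Or.inr (Or.inr (Or.inl rfl))
    · rcases Nat.lt_or_ge t j with htj | htj
      · exact Or.inr (Or.inr (Or.inr ⟨t, htj, h⟩))
      · obtain rfl : t = j := by omega
        rcases h with rfl | rfl
        · exact Or.inr (Or.inl rfl)
        · exact Or.inl rfl

/-! ### Certifying irreducibility -/

/-- Set `var 58` to `1` or `0`, according as all factors in the list are constant or irreducible of
degree at most two or not. -/
def check (lam : ℕ) : Prog :=
  .store 58 0 1 ;;
  forDo 42 (var 41) (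
    copy 12 10 0 40 (var 42 * width lam) ;; copy 12 11 0 49 0 ;; .store 59 0 (var 10) ;; gcd ;;
    -- With truncated subtraction this vanishes exactly if the piece has degree at most one, or
    -- degree two and a constant gcd with `splitter D`, that is, no linear factor.
    .cond ((var 59 - 3) + (var 59 - 2) * (var 10 - 1)) (.store 58 0 0) .skip)

theorem wp_check {N p lam nb k l : ℕ} [Fact p.Prime] {s : State} {E G : (ZMod p)[X]}
    {F : ℕ → (ZMod p)[X]} (hs : s 0 1 = p)
    (hnb : s 0 2 = nb) (hp : p < 2 ^ N) (hN : 4 * (nb + lam + 5) ≤ N)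
    (hEd : E.natDegree < nb + lam + 1) (hl : l ≤ nb + lam + 4) (hG : Rep (s 49) G l)
    (hP : Pieces (nb + lam + 3) s F k) (hF : Factorization E F k) :
    wp N (check lam) (fun s' =>
      Frame [10, 11, 12, 15, 16, 17, 42, 58, 59] s s' ∧
      (s' 58 0 ≠ 0 ↔ ∀ i < k, plen (F i) ≤ 2 ∨ plen (F i) = 3 ∧ plen (mgcd (F i) G) ≤ 1)) s := by
  have hN2 : N < 2 ^ N := Nat.lt_two_pow_self
  set fr := [10, 11, 12, 15, 16, 17, 42, 58, 59] with hfr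
  have hk := hF.le
  have hplen : ∀ i < k, plen (F i) ≤ nb + lam + 1 := fun i hi => by
    rw [plen_of_ne (hF.monic i hi).ne_zero]
    have := natDegree_le_of_dvd (hF.dvd hi) hF.monic_prod.ne_zero
    omega
  refine ⟨by simp; omega, ?_⟩
  refine wp_forDo (fun j s' => s' 42 0 = j ∧ Frame fr s s' ∧ (s' 58 0 ≠ 0 ↔
    ∀ i < j, plen (F i) ≤ 2 ∨ plen (F i) = 3 ∧ plen (mgcd (F i) G) ≤ 1)) k (by omega) ?_ ?_ ?_ ?_
  · exact ⟨by simp, ((Frame.refl _ _).write (by simp [hfr]) _ _).write (by simp [hfr]) _ _, by simp⟩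
  · rintro j s' hj ⟨g1, g2, -⟩
    exact ⟨g1, by simp [g2 41 (by decide), hP.len]⟩
  swap
  · rintro s' ⟨-, h⟩
    exact h
  rintro j s1 hj ⟨g1, g2, g3⟩ -
  refine wp_seq (P := fun s2 => Frame [10, 12] s1 s2 ∧ Rep (s2 10) (F j) (plen (F j))) ?_ ?_
  · refine wp_copy (n := plen (F j)) (oA := 0) (oB := j * (nb + lam + 3)) hp
      (by have := hplen j hj; omega) (by decide) (by decide)
      (by decide) (fun _ _ => rfl) (fun s2 hs2 => ?_)
      (by rw [g2 40 (by decide)]; exact hP.rep j hj)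
      fun s2 g1 g2 _ => ⟨g1.mono (by simp), by simpa using g2⟩
    simp [hs2 42 (by decide), hs2 0 (by decide), g1, g2 0 (by decide), hnb]
    left; omega
  rintro s2 ⟨f2, r10⟩
  refine wp_seq (wp_copy_zero (f := G) (n := l)
    (by rw [f2 49 (by decide), g2 49 (by decide)]; exact hG) hp (by omega) (by decide)
    (by decide) (by decide)) ?_
  rintro s3 ⟨f3, r11⟩
  have h3 : Frame [10, 11, 12] s1 s3 := f2.trans f3 (by simp) (by simp)
  have r10' : Rep (s3 10) (F j) (plen (F j)) := by rw [f3 10 (by decide)]; exact r10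
  have hpj := hplen j hj
  refine ⟨by simp [r10'.len]; omega, ?_⟩
  refine wp_seq (wp_gcd (f := F j) (g := G) (n := plen (F j)) (m := l)
    (by rw [write_ne _ _ _ (by decide), h3 0 (by decide), g2 0 (by decide), hs]) hp (by omega)
    (by simpa using r10') (by simpa using r11)) ?_
  rintro s4 ⟨f4, r10⟩
  have h4 : Frame [10, 11, 12, 15, 16, 17, 59] s1 s4 :=
    h3.write_trans f4 (by simp) (by simp) (by simp)
  have h59 : s4 59 0 = plen (F j) := by
    rw [f4 59 (by decide)]; simp [r10'.len]
  have hg : plen (mgcd (F j) G) ≠ 0 := fun h => by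
    have h0 := plen_eq_zero.1 h
    exact (hF.monic j hj).ne_zero (zero_dvd_iff.1 (h0 ▸ (dvd_mgcd.1 dvd_rfl).1))
  have hv : ((var 59 - 3) + (var 59 - 2) * (var 10 - 1) : Term).value s4 =
      (plen (F j) - 3) + (plen (F j) - 2) * (plen (mgcd (F j) G) - 1) := by
    simp [h59, r10.len]
  have hv0 : (plen (F j) - 3) + (plen (F j) - 2) * (plen (mgcd (F j) G) - 1) = 0 ↔
      plen (F j) ≤ 2 ∨ plen (F j) = 3 ∧ plen (mgcd (F j) G) ≤ 1 := by
    rw [Nat.add_eq_zero_iff, Nat.mul_eq_zero]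
    omega
  have h5 : Frame fr s s4 := g2.trans h4 (by simp) (by simp [hfr])
  have h42 : s4 42 0 = j := by rw [h4 42 (by decide), g1]
  have h58 : s4 58 0 = s1 58 0 := by rw [h4 58 (by decide)]
  have hsucc : (∀ i < j + 1, plen (F i) ≤ 2 ∨ plen (F i) = 3 ∧ plen (mgcd (F i) G) ≤ 1) ↔
      (∀ i < j, plen (F i) ≤ 2 ∨ plen (F i) = 3 ∧ plen (mgcd (F i) G) ≤ 1) ∧
      (plen (F j) ≤ 2 ∨ plen (F j) = 3 ∧ plen (mgcd (F j) G) ≤ 1) := by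
    refine ⟨fun h => ⟨fun i hi => h i (by omega), h j (by omega)⟩, fun h i hi => ?_⟩
    rcases Nat.lt_or_ge i j with hij | hij
    · exact h.1 i hij
    · obtain rfl : i = j := by omega
      exact h.2
  refine ⟨fun hc => ?_, fun hc => ?_⟩
  · rw [hv, ne_eq, hv0] at hc
    refine ⟨by simp, by simp [h42], by simp, (h5.write (by simp [hfr]) _ _).write (by simp [hfr]) _ _,
      ?_⟩
    rw [hsucc]
    simp [hc]
  · rw [hv, hv0] at hc
    refine ⟨h42, by simp, h5.write (by simp [hfr]) _ _, ?_⟩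
    rw [hsucc, write_ne _ _ _ (by decide), h58, g3]
    simp [hc]

/-! ### Writing the candidates -/

theorem toList_append {A A' : ℕ → ℕ} {e : List ℕ} (h0 : A' 0 = A 0 + e.length)
    (h1 : ∀ i < A 0, A' (i + 1) = A (i + 1))
    (h2 : ∀ i (hi : i < e.length), A' (A 0 + i + 1) = e[i]) :
    toList A' = toList A ++ e := by
  unfold toList
  rw [h0, List.range_add, List.map_append, List.map_map]
  congr 1
  · exact List.map_congr_left fun i hi => h1 i (List.mem_range.1 hi)
  · refine List.ext_getElem (by simp) fun i hi hi' => ?_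
    simpa using h2 i hi'

/-- The vector of the lowest `lam + 1` coefficients. -/
def coeffVec {p : ℕ} (lam : ℕ) (f : (ZMod p)[X]) : Fin (lam + 1) → ZMod p := fun i => f.coeff i

/-- The pair of coefficient vectors of `e * u` and `e * v`. -/
noncomputable def pairOf {p : ℕ} (lam : ℕ) (u v e : (ZMod p)[X]) :
    (Fin (lam + 1) → ZMod p) × (Fin (lam + 1) → ZMod p) :=
  (coeffVec lam (e * u), coeffVec lam (e * v))

theorem length_encodePair {p k : ℕ} (g : (Fin k → ZMod p) × (Fin k → ZMod p)) :
    (HPPK.encodePair g).length = k + k := by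
  simp [HPPK.encodePair, HPPK.encodeVec]

/-- Write the lowest `lam + 1` coefficients of the polynomial in the array `25` behind the end of
the output, with an offset. -/
def writeCoeffs (lam o : ℕ) : Prog :=
  -- The extra 1 in the offset skips the length in entry 0. That length is raised only after both
  -- vectors of a pair have been written.
  vec 12 (.const (lam + 1)) 2 (var 2 + .const (o + 1))
    ((1 - (1 - (var 25 - var 12))) * .get 25 (var 12 + 1))

theorem wp_writeCoeffs {N p lam o n : ℕ} [NeZero p] {s : State} {f : (ZMod p)[X]} (hp : p < 2 ^ N)
    (hN : lam + 1 ≤ N) (hf : Rep (s 25) f n) :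
    wp N (writeCoeffs lam o) (fun s' => Frame [2, 12] s s' ∧ ∀ j, s' 2 j =
      if s 2 0 + (o + 1) ≤ j ∧ j < s 2 0 + (o + 1) + (lam + 1) then
        (f.coeff (j - (s 2 0 + (o + 1)))).val else s 2 j) s := by
  refine wp_vec (lam + 1) (s 2 0 + (o + 1)) (fun i => (f.coeff i).val) hN (by decide) ?_
    fun s' h1 h2 => ⟨h1.mono (by simp), h2⟩
  intro k s' hk h1 h2 h3
  have h4 : s' 2 0 = s 2 0 := h3 0 (by omega)
  refine ⟨rfl, by simp [h4], fun hk' => ⟨?_, (ZMod.val_lt _).trans hp⟩⟩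
  simp only [value_mul, value_sub, value_ofNat, value_get, value_add, h1 25 (by decide), h2, hf.len]
  rcases Nat.lt_or_ge k n with hkn | hkn
  · rw [hf.coeff k hkn, show 1 - (1 - (n - k)) = 1 by omega, one_mul]
  · rw [hf.zero k hkn, show 1 - (1 - (n - k)) = 0 by omega, zero_mul, ZMod.val_zero]

/-- Append the multiples by the polynomial in the array `26` of the polynomials in the arrays `46`
and `47` to the output. -/
def emit (lam : ℕ) : Prog :=
  mul 26 46 ;; writeCoeffs lam 0 ;; mul 26 47 ;; writeCoeffs lam (lam + 1) ;;
  .store 2 0 (var 2 + .const (lam + 1 + (lam + 1)))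

theorem wp_emit {N p lam n m l : ℕ} [NeZero p] {s : State} {e u v : (ZMod p)[X]} (hs : s 0 1 = p)
    (hp : p < 2 ^ N) (hN : lam + 1 ≤ N) (hn : n + m ≤ N) (hl : n + l ≤ N)
    (h2 : s 2 0 + (lam + 1 + (lam + 1)) ≤ N) (he : Rep (s 26) e n)
    (hu : Rep (s 46) u m) (hv : Rep (s 47) v l) :
    wp N (emit lam) (fun s' => Frame [2, 12, 23, 24, 25] s s' ∧
      s' 2 0 = s 2 0 + (lam + 1 + (lam + 1)) ∧
      toList (s' 2) = toList (s 2) ++ HPPK.encodePair (pairOf lam u v e)) s := by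
  have hN2 : N < 2 ^ N := Nat.lt_two_pow_self
  set fr := [2, 12, 23, 24, 25] with hfr
  refine wp_seq (wp_mul hs hp hn (by decide) (by decide) he hu) ?_
  rintro s1 ⟨f1, r1⟩
  refine wp_seq (wp_writeCoeffs hp hN r1) ?_
  rintro s2 ⟨f2, w2⟩
  rw [f1 2 (by decide)] at w2
  have g2 : Frame fr s s2 := f1.trans f2 (by simp [hfr]) (by simp [hfr])
  refine wp_seq (wp_mul (by rw [g2 0 (by decide), hs]) hp hl (by decide) (by decide)
    (by rw [g2 26 (by decide)]; exact he) (by rw [g2 47 (by decide)]; exact hv)) ?_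
  rintro s3 ⟨f3, r3⟩
  refine wp_seq (wp_writeCoeffs hp hN r3) ?_
  rintro s4 ⟨f4, w4⟩
  have h20 : s2 2 0 = s 2 0 := by rw [w2, if_neg (by omega)]
  rw [f3 2 (by decide), h20] at w4
  have g4 : Frame fr s s4 := (g2.trans f3 (m := fr) (by simp) (by simp [hfr])).trans f4 (by simp)
    (by simp [hfr])
  have h40 : s4 2 0 = s 2 0 := by rw [w4, if_neg (by omega), h20]
  refine ⟨by simp [h40]; omega, g4.write (by simp [hfr]) _ _, by simp [h40], ?_⟩
  refine toList_append ?_ (fun i hi => ?_) fun i hi => ?_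
  · simp [h40, length_encodePair]
  · simp only [write_same, value_ofNat]
    rw [Function.update_of_ne (by omega), w4, if_neg (by omega), w2, if_neg (by omega)]
  · simp only [write_same, value_ofNat]
    rw [length_encodePair] at hi
    rw [Function.update_of_ne (by omega), w4]
    simp only [HPPK.encodePair, HPPK.encodeVec, pairOf, coeffVec]
    by_cases h : i < lam + 1
    · rw [if_neg (by omega), w2, if_pos (by omega), List.getElem_append_left (by simpa using h)]
      simp only [List.getElem_ofFn]
      congr 2
      omega
    · rw [if_pos (by omega), List.getElem_append_right (by simpa using h)]
      simp only [List.getElem_ofFn, List.length_ofFn]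
      congr 2
      omega

/-- The conditions on `e` for the multiples of `u` and `v` by `e` to be a key, if `D` is the
greatest common divisor of the input polynomials, and `M` the maximum of their lengths. -/
def Admissible {p : ℕ} (lam nb M : ℕ) (D u v e : (ZMod p)[X]) : Prop :=
  -- The length of a nonzero product is one less than the sum of the lengths. The second condition
  -- therefore says that e u and e v have degree at most lam, and the third one that the cofactors
  -- of the columns have degree at most nb.
  e ∣ D ∧ plen e + max (plen u) (plen v) ≤ lam + 2 ∧ M + 1 ≤ nb + plen e + max (plen u) (plen v)

/-- Append a pair to the output, if the product of the factors with the indices `var 42` and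
`var 43` is admissible. -/
def candidate (lam : ℕ) : Prog :=
  copy 12 66 0 40 (var 42 * width lam) ;; copy 12 67 0 40 (var 43 * width lam) ;; mul 66 67 ;;
  -- The product of D and 1 is reduced modulo the candidate, which tests divisibility.
  copy 12 26 0 25 0 ;; mulMod 45 68 ;; trim 25 ;;
  -- A sum of three natural numbers that vanish exactly under the three conditions of admissibility.
  .cond (var 25 + (var 26 + var 53 - .const (lam + 2)) + (var 51 + 1 - (.get 0 2 + var 26 + var 53)))
    .skip (emit lam)

set_option maxHeartbeats 1000000 in
theorem wp_candidate {N p lam nb M n i j : ℕ} [Fact p.Prime] {s : State} {D E u v : (ZMod p)[X]}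
    {F : ℕ → (ZMod p)[X]} (hs : s 0 1 = p) (hnb : s 0 2 = nb) (hp : p < 2 ^ N)
    (hN : 4 * (nb + lam + 5) ≤ N) (hD : Rep (s 45) D (plen D)) (hDd : plen D ≤ nb + lam + 1)
    (hEd : E.natDegree < nb + lam + 1)
    (h68 : Rep (s 68) (1 : (ZMod p)[X]) 1) (hu : Rep (s 46) u (plen u)) (hv : Rep (s 47) v (plen v))
    (hul : plen u ≤ nb + lam + 1) (hvl : plen v ≤ nb + lam + 1)
    (h53 : s 53 0 = max (plen u) (plen v)) (h51 : s 51 0 = M)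
    (hP : Pieces (nb + lam + 3) s F n) (hF : Factorization E F n) (hi : i < n) (hj : j < n)
    (h42 : s 42 0 = i) (h43 : s 43 0 = j) (h2 : s 2 0 + (lam + 1 + (lam + 1)) ≤ N) :
    wp N (candidate lam) (fun s' => Frame [2, 12, 23, 24, 25, 26, 27, 28, 29, 66, 67] s s' ∧
      (Admissible lam nb M D u v (F i * F j) → s' 2 0 = s 2 0 + (lam + 1 + (lam + 1)) ∧
        toList (s' 2) = toList (s 2) ++ HPPK.encodePair (pairOf lam u v (F i * F j))) ∧
      (¬ Admissible lam nb M D u v (F i * F j) → s' 2 = s 2)) s := by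
  have hN2 : N < 2 ^ N := Nat.lt_two_pow_self
  set fr := [2, 12, 23, 24, 25, 26, 27, 28, 29, 66, 67] with hfr
  have hplen : ∀ i < n, plen (F i) ≤ nb + lam + 1 := fun i hi => by
    rw [plen_of_ne (hF.monic i hi).ne_zero]
    have := natDegree_le_of_dvd (hF.dvd hi) hF.monic_prod.ne_zero
    omega
  have hmi := hF.monic i hi
  have hmj := hF.monic j hj
  have hm : (F i * F j).Monic := hmi.mul hmj
  have hil := hplen i hi
  have hjl := hplen j hj
  have hpi := plen_of_ne hmi.ne_zero
  have hpj := plen_of_ne hmj.ne_zero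
  have hpe : plen (F i * F j) = plen (F i) + plen (F j) - 1 := by
    rw [plen_of_ne hm.ne_zero, hmi.natDegree_mul hmj, hpi, hpj]; omega
  refine wp_seq (P := fun s2 => Frame [66, 12] s s2 ∧ Rep (s2 66) (F i) (plen (F i))) ?_ ?_
  · refine wp_copy (n := plen (F i)) (oA := 0) (oB := i * (nb + lam + 3)) hp
      (by omega) (by decide) (by decide) (by decide) (fun _ _ => rfl) (fun s2 hs2 => ?_)
      (hP.rep i hi) fun s2 g1 g2 _ => ⟨g1.mono (by simp), by simpa using g2⟩
    simp [hs2 42 (by decide), hs2 0 (by decide), h42, hnb]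
    left; omega
  rintro s1 ⟨f1, r66⟩
  refine wp_seq (P := fun s2 => Frame [67, 12] s1 s2 ∧ Rep (s2 67) (F j) (plen (F j))) ?_ ?_
  · refine wp_copy (n := plen (F j)) (oA := 0) (oB := j * (nb + lam + 3)) hp
      (by omega) (by decide) (by decide) (by decide) (fun _ _ => rfl) (fun s2 hs2 => ?_)
      (by rw [f1 40 (by decide)]; exact hP.rep j hj)
      fun s2 g1 g2 _ => ⟨g1.mono (by simp), by simpa using g2⟩
    simp [hs2 43 (by decide), hs2 0 (by decide), h43, hnb, f1 43 (by decide), f1 0 (by decide)]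
    left; omega
  rintro s2 ⟨f2, r67⟩
  have g2 : Frame [12, 66, 67] s s2 := f1.trans f2 (by simp) (by simp)
  refine wp_seq (wp_mul (by rw [g2 0 (by decide), hs]) hp
    (show plen (F i) + plen (F j) ≤ N by omega) (by decide) (by decide)
    (by rw [f2 66 (by decide)]; exact r66) r67) ?_
  rintro s3 ⟨f3, r25⟩
  refine wp_seq (wp_copy_zero r25 hp (by omega) (by decide) (by decide) (by decide)) ?_
  rintro s4 ⟨f4, r26⟩
  have g4 : Frame [12, 23, 24, 25, 26, 66, 67] s s4 :=
    (g2.trans f3 (m := [12, 23, 24, 25, 66, 67]) (by simp) (by simp)).trans f4 (by simp) (by simp)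
  rw [← hpe] at r26
  refine wp_seq (wp_mulMod (f := D) (g := 1) (n := plen D) (m := 1) (d := (F i * F j).natDegree)
    (h := F i * F j) (by rw [g4 0 (by decide), hs]) hp (by omega)
    (by rw [plen_of_ne hm.ne_zero] at hpe; omega) (by decide) (by decide)
    (by rw [g4 45 (by decide)]; exact hD) (by rw [g4 68 (by decide)]; exact h68)
    (by rw [← plen_of_ne hm.ne_zero]; exact r26) hm rfl) ?_
  rintro s5 ⟨f5, r25⟩
  rw [mul_one] at r25
  refine wp_seq (wp_trim (by omega) r25) ?_
  rintro s6 ⟨f6, r25⟩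
  have f56 : Frame [23, 24, 25, 27, 28, 29] s4 s6 := f5.trans f6 (by simp) (by simp)
  have g6 : Frame [12, 23, 24, 25, 26, 27, 28, 29, 66, 67] s s6 := g4.trans f56 (by simp) (by simp)
  have g6' : Frame fr s s6 := g6.mono (by simp [hfr])
  have r26' : Rep (s6 26) (F i * F j) (plen (F i * F j)) := by rw [f56 26 (by decide)]; exact r26
  have hc : (var 25 + (var 26 + var 53 - .const (lam + 2)) +
      (var 51 + 1 - (.get 0 2 + var 26 + var 53)) : Term).value s6 = 0 ↔
      Admissible lam nb M D u v (F i * F j) := by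
    simp only [value_add, value_sub, value_get, value_ofNat, value_const, r25.len, r26'.len,
      g6 53 (by decide), g6 51 (by decide), g6 0 (by decide), h53, h51, hnb]
    unfold Admissible
    rw [← modByMonic_eq_zero_iff_dvd hm, ← plen_eq_zero]
    omega
  refine ⟨fun h => ⟨g6', fun h' => absurd (hc.2 h') h, fun _ => g6 2 (by decide)⟩, fun h => ?_⟩
  have hA := hc.1 h
  have hl : plen (F i * F j) + max (plen u) (plen v) ≤ lam + 2 := hA.2.1
  refine wp_mono ?_ (wp_emit (n := plen (F i * F j)) (m := plen u) (l := plen v) (lam := lam)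
    (by rw [g6 0 (by decide), hs]) hp (by omega) (by omega) (by omega)
    (by rw [g6 2 (by decide)]; exact h2) r26' (by rw [g6 46 (by decide)]; exact hu)
    (by rw [g6 47 (by decide)]; exact hv))
  rintro s7 ⟨f7, h7, h8⟩
  rw [g6 2 (by decide)] at h7 h8
  exact ⟨g6'.trans f7 (by simp) (by simp [hfr]), fun _ => ⟨h7, h8⟩, fun h' => absurd hA h'⟩

/-- The pairs that belong to the admissible products of two of the polynomials `F i`. -/
structure Candidates {p : ℕ} (lam nb M : ℕ) (D u v : (ZMod p)[X]) (F : ℕ → (ZMod p)[X]) (n : ℕ)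
    (L : List ((Fin (lam + 1) → ZMod p) × (Fin (lam + 1) → ZMod p))) : Prop where
  sound : ∀ g ∈ L, ∃ i < n, ∃ j < n, Admissible lam nb M D u v (F i * F j) ∧
    g = pairOf lam u v (F i * F j)
  complete : ∀ i < n, ∀ j < n, Admissible lam nb M D u v (F i * F j) →
    pairOf lam u v (F i * F j) ∈ L

/-- Write the pairs that belong to all admissible products of two factors to the output. -/
def enumerate (lam : ℕ) : Prog :=
  forDo 42 (var 41) (forDo 43 (var 41) (candidate lam))

set_option maxHeartbeats 1000000 in
theorem wp_enumerate {N p lam nb M n : ℕ} [Fact p.Prime] {s : State} {D E u v : (ZMod p)[X]}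
    {F : ℕ → (ZMod p)[X]} (hs : s 0 1 = p) (hnb : s 0 2 = nb) (hp : p < 2 ^ N)
    (hN : 4 * (nb + lam + 5) ≤ N) (hN' : (nb + lam + 2) ^ 2 * (lam + 1 + (lam + 1)) ≤ N)
    (hD : Rep (s 45) D (plen D)) (hDd : plen D ≤ nb + lam + 1)
    (hEd : E.natDegree < nb + lam + 1)
    (h68 : Rep (s 68) (1 : (ZMod p)[X]) 1) (hu : Rep (s 46) u (plen u)) (hv : Rep (s 47) v (plen v))
    (hul : plen u ≤ nb + lam + 1) (hvl : plen v ≤ nb + lam + 1)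
    (h53 : s 53 0 = max (plen u) (plen v)) (h51 : s 51 0 = M)
    (hP : Pieces (nb + lam + 3) s F n) (hF : Factorization E F n) (h2 : s 2 0 = 0) :
    wp N (enumerate lam) (fun s' => ∃ L, Candidates lam nb M D u v F n L ∧
      L.length ≤ (nb + lam + 2) ^ 2 ∧ toList (s' 2) = (L.map HPPK.encodePair).flatten) s := by
  have hN2 : N < 2 ^ N := Nat.lt_two_pow_self
  set fr := [2, 12, 23, 24, 25, 26, 27, 28, 29, 42, 43, 66, 67] with hfr
  have hn : n ≤ nb + lam + 2 := by have := hF.le; omega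
  -- The pairs (i, j) are treated in lexicographic order; `I k l` describes the output when exactly
  -- those before (k, l) have been treated.
  let I : ℕ → ℕ → State → Prop := fun k l s' => s' 42 0 = k ∧ Frame fr s s' ∧
    ∃ L : List ((Fin (lam + 1) → ZMod p) × (Fin (lam + 1) → ZMod p)),
      (∀ g ∈ L, ∃ i < n, ∃ j < n, Admissible lam nb M D u v (F i * F j) ∧
        g = pairOf lam u v (F i * F j)) ∧
      (∀ i < n, ∀ j < n, (i < k ∨ i = k ∧ j < l) → Admissible lam nb M D u v (F i * F j) →
        pairOf lam u v (F i * F j) ∈ L) ∧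
      L.length ≤ k * n + l ∧ s' 2 0 = L.length * (lam + 1 + (lam + 1)) ∧
      toList (s' 2) = (L.map HPPK.encodePair).flatten
  refine wp_forDo (fun k => I k 0) n (by omega) ?_ ?_ ?_ ?_
  · refine ⟨by simp, (Frame.refl _ _).write (by simp [hfr]) _ _, [], by simp, by omega, by simp,
      by simp [h2], by simp [toList, h2]⟩
  · rintro k s' hk ⟨g1, g2, -⟩
    exact ⟨g1, by simp [g2 41 (by decide), hP.len]⟩
  swap
  · rintro s' ⟨-, -, L, h1, h2, h3, -, h4⟩
    refine ⟨L, ⟨h1, fun i hi j hj => h2 i hi j hj (Or.inl hi)⟩, h3.trans ?_, h4⟩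
    rw [add_zero, sq]
    exact Nat.mul_le_mul hn hn
  rintro k s1 hk h1 -
  refine wp_forDo (fun l s' => s' 43 0 = l ∧ I k l s') n (by omega) ?_ ?_ ?_ ?_
  · obtain ⟨g1, g2, L, g3⟩ := h1
    refine ⟨by simp, by simp [g1], g2.write (by simp [hfr]) _ _, L, ?_⟩
    rw [write_ne _ _ _ (by decide)]
    exact g3
  · rintro l s' hl ⟨g0, g1, g2, -⟩
    exact ⟨g0, by simp [g2 41 (by decide), hP.len]⟩
  swap
  · rintro s' ⟨-, g1, g2, L, g3, g4, g5, g6⟩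
    refine ⟨g1, by simp, g2.write (by simp [hfr]) _ _, L, g3, ?_, by rw [Nat.succ_mul]; omega, ?_⟩
    · exact fun i hi j hj h => g4 i hi j hj (by omega)
    · rw [write_ne _ _ _ (by decide)]
      exact g6
  rintro l s2 hl ⟨g0, g1, g2, L, g3, g4, g5, g6, g7⟩ -
  have hlen : L.length + 1 ≤ (nb + lam + 2) ^ 2 := by
    have h3 : (k + 1) * n ≤ n * n := Nat.mul_le_mul_right _ hk
    have h4 : n * n ≤ (nb + lam + 2) * (nb + lam + 2) := Nat.mul_le_mul hn hn
    rw [Nat.succ_mul] at h3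
    rw [sq]
    omega
  have h20 : s2 2 0 + (lam + 1 + (lam + 1)) ≤ N := by
    have := Nat.mul_le_mul_right (lam + 1 + (lam + 1)) hlen
    rw [Nat.succ_mul] at this
    rw [g6]
    omega
  refine wp_mono ?_ (wp_candidate (D := D) (u := u) (v := v) (M := M) (nb := nb) (lam := lam)
    (by rw [g2 0 (by decide), hs]) (by rw [g2 0 (by decide), hnb]) hp hN
    (by rw [g2 45 (by decide)]; exact hD) hDd hEd (by rw [g2 68 (by decide)]; exact h68)
    (by rw [g2 46 (by decide)]; exact hu) (by rw [g2 47 (by decide)]; exact hv) hul hvl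
    (by rw [g2 53 (by decide), h53]) (by rw [g2 51 (by decide), h51])
    (hP.congr (g2 40 (by decide)) (g2 41 (by decide))) hF hk hl g1 g0 h20)
  rintro s3 ⟨f3, h3, h4⟩
  refine ⟨by rw [f3 43 (by decide), g0], by simp, ?_, ?_, ?_⟩
  · rw [write_ne _ _ _ (by decide), f3 42 (by decide), g1]
  · exact (g2.trans f3 (m := fr) (by simp) (by simp [hfr])).write (by simp [hfr]) _ _
  rw [write_ne _ _ _ (by decide)]
  by_cases hA : Admissible lam nb M D u v (F k * F l)
  · obtain ⟨h5, h6⟩ := h3 hA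
    refine ⟨L ++ [pairOf lam u v (F k * F l)], fun g hg => ?_, fun i hi j hj hij hA' => ?_,
      by simp; omega, by rw [h5, g6]; simp [Nat.succ_mul], by simp [h6, g7]⟩
    · rw [List.mem_append, List.mem_singleton] at hg
      rcases hg with hg | rfl
      · exact g3 g hg
      · exact ⟨k, hk, l, hl, hA, rfl⟩
    · rw [List.mem_append, List.mem_singleton]
      by_cases h7 : i < k ∨ i = k ∧ j < l
      · exact Or.inl (g4 i hi j hj h7 hA')
      · obtain ⟨rfl, rfl⟩ : i = k ∧ j = l := by omega
        exact Or.inr rfl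
  · refine ⟨L, g3, fun i hi j hj hij hA' => g4 i hi j hj ?_ hA', by omega, by rw [h4 hA, g6],
      by rw [h4 hA, g7]⟩
    by_contra h7
    obtain ⟨rfl, rfl⟩ : i = k ∧ j = l := by omega
    exact hA hA'

/-! ### The two attacks as programs -/

/-- `D` is the greatest common divisor and `M` the maximal length of the polynomials
`cs 0, …, cs (2 m - 1)`, and `u` and `v` are the coprime parts of `cs j` and `cs (m + j)`. -/
structure Reduction {p : ℕ} [Fact p.Prime] (m : ℕ) (cs : ℕ → (ZMod p)[X]) (D u v : (ZMod p)[X])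
    (M j : ℕ) : Prop where
  dvd_iff : ∀ q, q ∣ D ↔ ∀ i < m + m, q ∣ cs i
  monic : D.Monic
  le : ∀ i < m + m, plen (cs i) ≤ M
  attained : M = 0 ∨ ∃ i < m + m, plen (cs i) = M
  lt : j < m
  ne : cs j ≠ 0 ∨ cs (m + j) ≠ 0
  left : u = cs j /ₘ mgcd (cs j) (cs (m + j))
  right : v = cs (m + j) /ₘ mgcd (cs j) (cs (m + j))

/-- The memory holds the data that the enumeration of the keys needs. -/
structure Prepared {p : ℕ} [Fact p.Prime] (s₀ s : State) (lam nb M : ℕ) (D u v : (ZMod p)[X]) :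
    Prop where
  frame : Frame [10, 11, 12, 15, 16, 17, 23, 24, 25, 26, 27, 28, 29, 30, 31, 32, 33, 40, 41, 42, 45,
    46, 47, 48, 49, 50, 51, 52, 53, 60, 61, 62, 63, 64, 68] s₀ s
  rep_gcd : Rep (s 45) D (plen D)
  plen_gcd : plen D ≤ nb + lam + 1
  rep_one : Rep (s 68) (1 : (ZMod p)[X]) 1
  rep_left : Rep (s 46) u (plen u)
  rep_right : Rep (s 47) v (plen v)
  plen_left : plen u ≤ nb + lam + 1
  plen_right : plen v ≤ nb + lam + 1
  max_eq : s 53 0 = max (plen u) (plen v)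
  bound_eq : s 51 0 = M
  rep_splitter : ∃ l ≤ nb + lam + 4, Rep (s 49) (splitter D) l
  rep_trace : ∃ l ≤ nb + lam + 4, Rep (s 60) (traceMod D) l
  rep_norm : ∃ l ≤ nb + lam + 4, Rep (s 62) (normMod D) l

/-- Compute the data that the enumeration of the keys needs. -/
def prepare (lam : ℕ) : Prog := scan lam ;; ratio lam ;; setup lam

set_option maxHeartbeats 1000000 in
theorem wp_prepare {N p lam nb m : ℕ} [Fact p.Prime] {s : State} {cs : ℕ → (ZMod p)[X]}
    (hI : Input lam nb m cs (s 0)) (hp : p < 2 ^ N) (hN : 4 * (nb + lam + m + 5) ≤ N)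
    (hne : ∃ i < m + m, cs i ≠ 0) :
    wp N (prepare lam) (fun s' => ∃ D u v M j, Reduction m cs D u v M j ∧
      Prepared s s' lam nb M D u v ∧ ∃ F n, Pieces (nb + lam + 3) s' F n ∧
        Factorization (smallPart D) F n ∧ ∀ i < n, Resolved (splitter D) (F i)) s := by
  refine wp_seq (wp_scan hI hp hN) ?_
  rintro s1 ⟨f1, D, M, j, r45, h51, h52, hdvd, hmon, hle, hmax, hj⟩
  obtain ⟨hjm, hjn⟩ := hj hne
  have hD0 : D ≠ 0 := by
    rintro rfl
    obtain ⟨i, hi, hi'⟩ := hne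
    exact hi' (zero_dvd_iff.1 ((hdvd 0).1 dvd_rfl i hi))
  have hDm := hmon hD0
  have hDl : plen D ≤ nb + lam + 1 := by
    obtain ⟨i, hi, hi'⟩ := hne
    have h1 := natDegree_le_of_dvd ((hdvd D).1 dvd_rfl i hi) hi'
    have h2 := plen_le (hI.zero i hi)
    rw [plen_of_ne hi'] at h2
    rw [plen_of_ne hD0]
    omega
  refine wp_seq (wp_ratio (j := j) (by rw [f1 0 (by decide)]; exact hI) hp hN h52 hjm hjn) ?_
  rintro s2 ⟨f2, r46, r47, h53⟩
  set u := cs j /ₘ mgcd (cs j) (cs (m + j)) with hu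
  set v := cs (m + j) /ₘ mgcd (cs j) (cs (m + j)) with hv
  have hh : mgcd (cs j) (cs (m + j)) ≠ 0 := fun h0 => by
    have h1 := h0 ▸ dvd_mgcd.1 (dvd_refl (mgcd (cs j) (cs (m + j))))
    exact hjn.elim (fun h => h (zero_dvd_iff.1 h1.1)) fun h => h (zero_dvd_iff.1 h1.2)
  have hlen : ∀ i < m + m, plen (cs i /ₘ mgcd (cs j) (cs (m + j))) ≤ nb + lam + 1 := fun i hi =>
    (plen_divByMonic_le (monic_mgcd hh)).trans (plen_le (hI.zero i hi))
  have g2 : Frame [10, 11, 12, 15, 16, 17, 24, 25, 26, 27, 28, 29, 45, 46, 47, 50, 51, 52, 53]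
    s s2 := f1.trans f2 (by simp) (by simp)
  refine wp_mono ?_ (wp_setup (D := D) (nb := nb) (by rw [g2 0 (by decide), hI.prime_eq])
    (by rw [g2 0 (by decide), hI.nb_eq]) hp (by omega) (by rw [f2 45 (by decide)]; exact r45) hDm
    (by rw [plen_of_ne hD0] at hDl; omega))
  rintro s3 ⟨f3, r68, h49, h60, h62, F, n, h1, h2, h3⟩
  refine ⟨D, u, v, M, j, ⟨hdvd, hDm, hle, hmax, hjm, hjn, hu, hv⟩, ⟨g2.trans f3 (by simp) (by simp),
    ?_, hDl, r68, ?_, ?_, hlen j (by omega), hlen (m + j) (by omega), ?_, ?_, h49, h60, h62⟩, F, n,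
    h1, h2, h3⟩
  · rw [f3 45 (by decide), f2 45 (by decide)]; exact r45
  · rw [f3 46 (by decide)]; exact r46
  · rw [f3 47 (by decide)]; exact r47
  · rw [f3 53 (by decide), h53]
  · rw [f3 51 (by decide), f2 51 (by decide), h51]

theorem Prepared.trans {p : ℕ} [Fact p.Prime] {s₀ s s' : State} {lam nb M : ℕ}
    {D u v : (ZMod p)[X]} (h : Prepared s₀ s lam nb M D u v) {l : List ℕ} (hl : Frame l s s')
    (hd : ∀ a ∈ [45, 46, 47, 49, 51, 53, 68], a ∉ l) :
    Rep (s' 45) D (plen D) ∧ Rep (s' 68) (1 : (ZMod p)[X]) 1 ∧ Rep (s' 46) u (plen u) ∧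
      Rep (s' 47) v (plen v) ∧ s' 53 0 = max (plen u) (plen v) ∧ s' 51 0 = M ∧
      ∃ l ≤ nb + lam + 4, Rep (s' 49) (splitter D) l := by
  have key : ∀ a ∈ [45, 46, 47, 49, 51, 53, 68], s' a = s a := fun a ha => hl a (hd a ha)
  rw [key 45 (by decide), key 46 (by decide), key 47 (by decide), key 49 (by decide),
    key 51 (by decide), key 53 (by decide), key 68 (by decide)]
  exact ⟨h.rep_gcd, h.rep_one, h.rep_left, h.rep_right, h.max_eq, h.bound_eq, h.rep_splitter⟩

/-- The deterministic attack. -/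
def attack (lam : ℕ) : Prog :=
  -- Overwriting the length cuts the output down to its first pair. When the key is unique, any
  -- candidate will do.
  prepare lam ;; enumerate lam ;; .store 2 0 (.const (lam + 1 + (lam + 1)))

theorem toList_truncate {A : ℕ → ℕ} {a b : List ℕ} (h : toList A = a ++ b) :
    toList (Function.update A 0 a.length) = a := by
  have h1 : A 0 = a.length + b.length := by simpa [toList] using congrArg List.length h
  refine List.ext_getElem (by simp [toList]) fun i hi hi' => ?_
  have h2 : (toList A)[i]'(by simp [toList, h1]; omega) = a[i] := by
    simp only [h]
    rw [List.getElem_append_left hi']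
  simpa [toList] using h2

theorem wp_attack {N p lam nb m : ℕ} [Fact p.Prime] {s : State} {cs : ℕ → (ZMod p)[X]}
    (hI : Input lam nb m cs (s 0)) (hp : p < 2 ^ N) (hN : 4 * (nb + lam + m + 5) ≤ N)
    (hN' : (nb + lam + 2) ^ 2 * (lam + 1 + (lam + 1)) ≤ N)
    (hne : ∃ i < m + m, cs i ≠ 0) (h2 : s 2 = fun _ => 0) :
    wp N (attack lam) (fun s' => ∃ D u v M j F n L, Reduction m cs D u v M j ∧
      Factorization (smallPart D) F n ∧ (∀ i < n, Resolved (splitter D) (F i)) ∧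
      Candidates lam nb M D u v F n L ∧
      ∀ g L', L = g :: L' → toList (s' 2) = HPPK.encodePair g) s := by
  have hN2 : N < 2 ^ N := Nat.lt_two_pow_self
  refine wp_seq (wp_prepare hI hp hN hne) ?_
  rintro s1 ⟨D, u, v, M, j, hR, hP, F, n, hF, hF', hres⟩
  have hDd : D.natDegree < nb + lam + 1 := by
    have := hP.plen_gcd
    rw [plen_of_ne hR.monic.ne_zero] at this
    omega
  refine wp_seq (wp_enumerate (D := D) (u := u) (v := v) (M := M) (nb := nb) (lam := lam)
    (by rw [hP.frame 0 (by decide), hI.prime_eq]) (by rw [hP.frame 0 (by decide), hI.nb_eq]) hp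
    (by omega) hN' hP.rep_gcd hP.plen_gcd
    ((natDegree_le_of_dvd (smallPart_dvd D) hR.monic.ne_zero).trans_lt hDd) hP.rep_one hP.rep_left
    hP.rep_right hP.plen_left hP.plen_right hP.max_eq hP.bound_eq hF hF'
    (by rw [hP.frame 2 (by decide), h2])) ?_
  rintro s2 ⟨L, hL, -, h3⟩
  refine ⟨?_, D, u, v, M, j, F, n, L, hR, hF', hres, hL, ?_⟩
  · simp only [value_const]
    have : 1 * (lam + 1 + (lam + 1)) ≤ (nb + lam + 2) ^ 2 * (lam + 1 + (lam + 1)) :=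
      Nat.mul_le_mul_right _ (Nat.one_le_pow _ _ (by omega))
    omega
  · rintro g L' rfl
    rw [List.map_cons, List.flatten_cons] at h3
    have := toList_truncate h3
    rw [length_encodePair] at this
    simpa using this

/-- The randomized attack. -/
def randomizedAttack (lam : ℕ) : Prog :=
  prepare lam ;; randomize lam ;; check lam ;; .cond (var 58) (enumerate lam) .skip

theorem wp_randomizedAttack {N p lam nb m k : ℕ} [Fact p.Prime] {s : State} {cs : ℕ → (ZMod p)[X]}
    (hI : Input lam nb m cs (s 0)) (hp : p < 2 ^ N) (hN : 4 * (nb + lam + m + 5) ≤ N)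
    (hN' : (nb + lam + 2) ^ 2 * (lam + 1 + (lam + 1)) ≤ N)
    (hne : ∃ i < m + m, cs i ≠ 0) (h2 : s 2 = fun _ => 0) (hk : s 1 0 = 16 * k * k)
    (hkN : 16 * k + 1 ≤ N) (hbit : ∀ i, s 1 (i + 1) ≤ 1) :
    wp N (randomizedAttack lam) (fun s' => ∃ D u v M j F n, Reduction m cs D u v M j ∧
      Factorization (smallPart D) F n ∧
      (∀ g ∈ tests D (s 1) k (16 * k), ∀ i < n, Resolved g (F i)) ∧
      ((∀ i < n, plen (F i) ≤ 2 ∨ plen (F i) = 3 ∧ plen (mgcd (F i) (splitter D)) ≤ 1) →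
        ∃ L, Candidates lam nb M D u v F n L ∧ L.length ≤ (nb + lam + 2) ^ 2 ∧
          toList (s' 2) = (L.map HPPK.encodePair).flatten) ∧
      (¬ (∀ i < n, plen (F i) ≤ 2 ∨ plen (F i) = 3 ∧ plen (mgcd (F i) (splitter D)) ≤ 1) →
        toList (s' 2) = [])) s := by
  have hN2 : N < 2 ^ N := Nat.lt_two_pow_self
  refine wp_seq (wp_prepare hI hp hN hne) ?_
  rintro s1 ⟨D, u, v, M, j, hR, hP, F₀, n₀, hF₀, hF₀', hres⟩
  have hDd : D.natDegree < nb + lam + 1 := by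
    have := hP.plen_gcd
    rw [plen_of_ne hR.monic.ne_zero] at this
    omega
  have hEd := (natDegree_le_of_dvd (smallPart_dvd D) hR.monic.ne_zero).trans_lt hDd
  have g0 : s1 0 = s 0 := hP.frame 0 (by decide)
  have g1 : s1 1 = s 1 := hP.frame 1 (by decide)
  obtain ⟨l, hl, hT⟩ := hP.rep_trace
  obtain ⟨l', hl', hT'⟩ := hP.rep_norm
  refine wp_seq (wp_randomize (nb := nb) (by rw [g0, hI.prime_eq]) (by rw [g0, hI.nb_eq]) hp
    (by omega) hP.rep_gcd hR.monic hDd hl hT hl' hT' hF₀ hF₀' hres (by rw [g1, hk]) hkN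
    (by rw [g1]; exact hbit)) ?_
  rintro s2 ⟨f2, F, n, hF, hF', hres⟩
  rw [g1] at hres
  obtain ⟨h45, -, -, -, -, -, l, hl, hG⟩ := hP.trans f2 (by decide)
  refine wp_seq (wp_check (nb := nb) (by rw [f2 0 (by decide), g0, hI.prime_eq])
    (by rw [f2 0 (by decide), g0, hI.nb_eq]) hp (by omega) hEd hl hG hF hF') ?_
  rintro s3 ⟨f3, h58⟩
  have f23 := f2.trans f3 (m := [10, 11, 12, 15, 16, 17, 23, 24, 25, 26, 27, 28, 29, 30, 31, 32, 33,
    40, 41, 42, 54, 55, 56, 57, 58, 59, 63, 64, 65, 66]) (by simp) (by simp)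
  obtain ⟨h45, h68, h46, h47, h53, h51, -⟩ := hP.trans f23 (by decide)
  have g3 : s3 0 = s 0 := by rw [f23 0 (by decide), g0]
  have g32 : s3 2 = fun _ => 0 := by rw [f23 2 (by decide), hP.frame 2 (by decide), h2]
  refine ⟨fun h => ?_, fun h => ⟨D, u, v, M, j, F, n, hR, hF', hres, fun h' => ?_, fun _ => ?_⟩⟩
  · refine wp_mono ?_ (wp_enumerate (D := D) (u := u) (v := v) (M := M) (nb := nb) (lam := lam)
      (by rw [g3, hI.prime_eq]) (by rw [g3, hI.nb_eq]) hp
      (by omega) hN' h45 hP.plen_gcd hEd h68 h46 h47 hP.plen_left hP.plen_right h53 h51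
      (hF.congr (f3 40 (by decide)) (f3 41 (by decide))) hF' (by rw [g32]))
    rintro s4 h4
    exact ⟨D, u, v, M, j, F, n, hR, hF', hres, fun _ => h4, fun h' => absurd (h58.1 h) h'⟩
  · exact absurd h (h58.2 h')
  · rw [g32]
    rfl

/-! ### Keys and the divisors of the gcd -/

section Polynomials

variable {p : ℕ} [Fact p.Prime]

/-- The irreducible divisors of X^(p²) - X are those whose degree divides 2. -/
theorem dvd_smallPart_iff {D q : (ZMod p)[X]} (hq : Irreducible q) (hD : q ∣ D) :
    q ∣ smallPart D ↔ q.natDegree ≤ 2 := by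
  have h := hq.natDegree_dvd_iff_dvd_X_pow_card_pow_sub_X (n := 2)
  rw [Nat.card_zmod] at h
  rw [dvd_smallPart hD, ← h, Nat.dvd_prime Nat.prime_two]
  have := hq.natDegree_pos
  omega

theorem dvd_splitter_iff {D q : (ZMod p)[X]} (hq : Irreducible q) (hD : q ∣ D) :
    q ∣ splitter D ↔ q.natDegree = 1 := by
  have h := hq.natDegree_dvd_iff_dvd_X_pow_card_pow_sub_X (n := 1)
  rw [Nat.card_zmod, pow_one, Nat.dvd_one] at h
  rw [h, splitter, ← dvd_add_right (hD.trans (dvd_sub_modByMonic (X ^ p)))]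
  unfold frob
  ring_nf

/-- Let g be the cofactor of gcd(f, e) in f. An irreducible factor of g also divides the gcd by
hypothesis, so its square divides f; hence g is a unit. -/
theorem dvd_of_squarefree {f e : (ZMod p)[X]} (hf : Squarefree f)
    (h : ∀ q, Irreducible q → q ∣ f → q ∣ e) : f ∣ e := by
  obtain ⟨g, hg⟩ := (dvd_mgcd.1 (dvd_refl (mgcd f e))).1
  have hu : IsUnit g := by
    by_contra hu
    have hg0 : g ≠ 0 := by rintro rfl; exact hf.ne_zero (by rw [hg, mul_zero])
    obtain ⟨q, hq, hqg⟩ := WfDvdMonoid.exists_irreducible_factor hu hg0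
    have h1 : q ∣ f := hg ▸ hqg.mul_left _
    have h2 : q ∣ mgcd f e := dvd_mgcd.2 ⟨h1, h q hq h1⟩
    exact hq.not_isUnit (hf q (hg ▸ mul_dvd_mul h2 hqg))
  have h1 : f ∣ mgcd f e := by
    conv_lhs => rw [hg]
    exact (hu.mul_right_dvd).2 dvd_rfl
  exact (dvd_mgcd.1 h1).2

theorem plen_mul {f g : (ZMod p)[X]} (hf : f ≠ 0) (hg : g ≠ 0) :
    plen (f * g) + 1 = plen f + plen g := by
  rw [plen_of_ne hf, plen_of_ne hg, plen_of_ne (mul_ne_zero hf hg), natDegree_mul hf hg]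
  omega

/-- If all `F i` that have a common factor with `e` divide `e`, then `e` is a product of two of
them, provided that it has degree at most two. -/
theorem Factorization.exists_mul_eq {E e : (ZMod p)[X]} {F : ℕ → (ZMod p)[X]} {n : ℕ}
    (hF : Factorization E F n) (he : e.Monic) (hd : e.natDegree ≤ 2)
    (h : ∀ q, Irreducible q → q ∣ e → q ∣ E)
    (h' : ∀ i < n, ∀ q, Irreducible q → q ∣ e → q ∣ F i → F i ∣ e) :
    ∃ i < n, ∃ j < n, F i * F j = e := by
  have hn := hF.two_le
  have key : ∀ f : (ZMod p)[X], f.Monic → f ∣ e → 1 ≤ f.natDegree →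
      ∃ i < n, 1 ≤ (F i).natDegree ∧ F i ∣ e ∧ ∃ q, Irreducible q ∧ q ∣ f ∧ q ∣ F i := by
    intro f hf hfe hf1
    obtain ⟨q, hq, hqf⟩ := WfDvdMonoid.exists_irreducible_factor
      (fun hu => by rw [natDegree_eq_zero_of_isUnit hu] at hf1; omega) hf.ne_zero
    -- A nonconstant divisor of e meets some piece, and by hypothesis this piece divides e. Below, e
    -- = F i · r for such a piece. If r is not constant, both factors are linear, and a piece F j
    -- that meets r is either all of e or equal to r.
    obtain ⟨i, hi, hqi⟩ := hF.exists_dvd hq (h q hq (hqf.trans hfe))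
    refine ⟨i, hi, ?_, h' i hi q hq (hqf.trans hfe) hqi, q, hq, hqf, hqi⟩
    exact hq.natDegree_pos.trans_le (natDegree_le_of_dvd hqi (hF.monic i hi).ne_zero)
  rcases Nat.eq_zero_or_pos e.natDegree with h0 | h0
  · refine ⟨0, by omega, 0, by omega, ?_⟩
    rw [hF.zero, he.natDegree_eq_zero.1 h0, one_mul]
  obtain ⟨i, hi, hi1, ⟨r, hr⟩, -⟩ := key e he dvd_rfl h0
  have hmi := hF.monic i hi
  have hrm : r.Monic := hmi.of_mul_monic_left (hr ▸ he)
  have hdeg := hmi.natDegree_mul hrm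
  rw [← hr] at hdeg
  rcases Nat.eq_zero_or_pos r.natDegree with h1 | h1
  · refine ⟨i, hi, 0, by omega, ?_⟩
    rw [hF.zero, hr, hrm.natDegree_eq_zero.1 h1]
  obtain ⟨j, hj, hj1, hje, q, hq, hqr, hqj⟩ := key r hrm (hr ▸ dvd_mul_left r _) h1
  have hmj := hF.monic j hj
  have hj2 := natDegree_le_of_dvd hje he.ne_zero
  rcases Nat.lt_or_ge 1 (F j).natDegree with h2 | h2
  · refine ⟨j, hj, 0, by omega, ?_⟩
    rw [hF.zero, mul_one]
    exact (eq_of_monic_of_dvd_of_natDegree_le hmj he hje (by omega)).symm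
  · refine ⟨i, hi, j, hj, ?_⟩
    have hq1 := hq.natDegree_pos
    have h3 : Associated q r := associated_of_dvd_of_natDegree_le hqr hrm.ne_zero (by omega)
    rw [hr, eq_of_monic_of_dvd_of_natDegree_le hrm hmj (h3.dvd_iff_dvd_left.1 hqj) (by omega)]

/-- The polynomials `cs i` and `cs (m + i)`, for `i < m`, are common multiples of `g₁` and `g₂` by
polynomials of degree at most `nb`. -/
def PolyKey (nb m : ℕ) (cs : ℕ → (ZMod p)[X]) (g₁ g₂ : (ZMod p)[X]) : Prop :=
  ∃ β : ℕ → (ZMod p)[X], ∀ i < m, plen (β i) ≤ nb + 1 ∧ cs i = β i * g₁ ∧ cs (m + i) = β i * g₂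

variable {lam nb m M j : ℕ} {cs : ℕ → (ZMod p)[X]} {D u v : (ZMod p)[X]}

theorem Reduction.mul_eq (h : Reduction m cs D u v M j) : mgcd (cs j) (cs (m + j)) ≠ 0 ∧
    mgcd (cs j) (cs (m + j)) * u = cs j ∧ mgcd (cs j) (cs (m + j)) * v = cs (m + j) := by
  have h1 := dvd_mgcd.1 (dvd_refl (mgcd (cs j) (cs (m + j))))
  have h0 : mgcd (cs j) (cs (m + j)) ≠ 0 := fun h0 => by
    rw [h0] at h1
    exact h.ne.elim (fun h => h (zero_dvd_iff.1 h1.1)) fun h => h (zero_dvd_iff.1 h1.2)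
  have key : ∀ f, mgcd (cs j) (cs (m + j)) ∣ f →
      mgcd (cs j) (cs (m + j)) * (f /ₘ mgcd (cs j) (cs (m + j))) = f := fun f hf => by
    have := modByMonic_add_div f (mgcd (cs j) (cs (m + j)))
    rwa [(modByMonic_eq_zero_iff_dvd (monic_mgcd h0)).2 hf, zero_add] at this
  exact ⟨h0, h.left ▸ key _ h1.1, h.right ▸ key _ h1.2⟩

/-- A common divisor of u and v times the gcd of the two columns would be a common divisor of the
columns. -/
theorem Reduction.isCoprime (h : Reduction m cs D u v M j) : IsCoprime u v := by
  obtain ⟨h0, e1, e2⟩ := h.mul_eq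
  refine IsRelPrime.isCoprime fun d hu hv => ?_
  have h2 : mgcd (cs j) (cs (m + j)) * d ∣ mgcd (cs j) (cs (m + j)) :=
    dvd_mgcd.2 ⟨(mul_dvd_mul_left _ hu).trans e1.dvd, (mul_dvd_mul_left _ hv).trans e2.dvd⟩
  obtain ⟨c, hc⟩ := h2
  refine IsUnit.of_mul_eq_one c (mul_left_cancel₀ h0 ?_)
  rw [← mul_assoc, ← hc, mul_one]

/-- In the j-th pair of columns, β j can be cancelled: both (g₁, g₂) and (u, v) are proportional to
it, so g₁ v = g₂ u. With a u + b v = 1 the factor is k = a g₁ + b g₂. -/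
theorem Reduction.exists_eq_mul (h : Reduction m cs D u v M j) {g₁ g₂ : (ZMod p)[X]}
    (hg : PolyKey nb m cs g₁ g₂) : ∃ k, k ≠ 0 ∧ g₁ = k * u ∧ g₂ = k * v := by
  obtain ⟨-, e1, e2⟩ := h.mul_eq
  obtain ⟨β, hβ⟩ := hg
  obtain ⟨-, b1, b2⟩ := hβ j h.lt
  have hβ0 : β j ≠ 0 := fun h0 => by
    rw [h0, zero_mul] at b1 b2
    exact h.ne.elim (fun h => h b1) fun h => h b2
  have h3 : g₁ * v = g₂ * u := by
    refine mul_left_cancel₀ hβ0 ?_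
    linear_combination u * b2 - v * b1 - v * e1 + u * e2
  obtain ⟨a, b, hab⟩ := h.isCoprime
  refine ⟨a * g₁ + b * g₂, fun h0 => ?_, by linear_combination (-g₁) * hab + b * h3,
    by linear_combination (-g₂) * hab - a * h3⟩
  have h4 : g₁ = 0 := by linear_combination (-g₁) * hab + b * h3 + u * h0
  have h5 : g₂ = 0 := by linear_combination (-g₂) * hab - a * h3 + v * h0
  rw [h4, mul_zero] at b1
  rw [h5, mul_zero] at b2
  exact h.ne.elim (fun h => h b1) fun h => h b2

theorem Reduction.max_pos (h : Reduction m cs D u v M j) : 1 ≤ max (plen u) (plen v) := by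
  by_contra! h0
  have hu : u = 0 := plen_eq_zero.1 (by omega)
  have hv : v = 0 := plen_eq_zero.1 (by omega)
  obtain ⟨a, b, hab⟩ := h.isCoprime
  rw [hu, hv] at hab
  simp at hab

/-- The polynomial 0 has length 0, so the length formula for products fails if u or v is zero. It
survives for the maximum as long as one of them is nonzero. -/
theorem max_plen_mul {k : (ZMod p)[X]} (hk : k ≠ 0) (h : 1 ≤ max (plen u) (plen v)) :
    max (plen (k * u)) (plen (k * v)) + 1 = plen k + max (plen u) (plen v) := by
  have h1 : ∀ w : (ZMod p)[X], plen w = 0 ∧ plen (k * w) = 0 ∨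
      plen (k * w) + 1 = plen k + plen w := fun w => by
    rcases eq_or_ne w 0 with rfl | hw
    · simp [plen_zero]
    · exact Or.inr (plen_mul hk hw)
  have h2 : plen k ≠ 0 := fun h => hk (plen_eq_zero.1 h)
  rcases h1 u with h3 | h3 <;> rcases h1 v with h4 | h4 <;> omega

/-- Every key is a multiple of the coprime pair by an admissible polynomial. -/
theorem Reduction.exists_admissible (h : Reduction m cs D u v M j) {g₁ g₂ : (ZMod p)[X]}
    (hg : PolyKey nb m cs g₁ g₂) (h₁ : plen g₁ ≤ lam + 1) (h₂ : plen g₂ ≤ lam + 1) :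
    ∃ (e : (ZMod p)[X]) (c : ZMod p), c ≠ 0 ∧ e.Monic ∧ Admissible lam nb M D u v e ∧
      g₁ = C c * (e * u) ∧ g₂ = C c * (e * v) := by
  classical
  obtain ⟨k, hk, rfl, rfl⟩ := h.exists_eq_mul hg
  have hc : k.leadingCoeff ≠ 0 := leadingCoeff_ne_zero.2 hk
  have hke : k = C k.leadingCoeff * normalize k := by
    rw [normalize_apply, coe_normUnit_of_ne_zero hk, mul_left_comm, ← C_mul, mul_inv_cancel₀ hc,
      C_1, mul_one]
  have hpk : plen (normalize k) = plen k := plen_normalize k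
  have hmax := max_plen_mul hk h.max_pos
  refine ⟨normalize k, k.leadingCoeff, hc, monic_normalize hk, ⟨?_, by omega, ?_⟩,
    by rw [← mul_assoc, ← hke], by rw [← mul_assoc, ← hke]⟩
  -- The factor k divides every column, since each is a multiple of k u or of k v.
  · rw [normalize_dvd_iff, h.dvd_iff]
    obtain ⟨β, hβ⟩ := hg
    intro i hi
    rcases Nat.lt_or_ge i m with him | him
    · rw [(hβ i him).2.1]
      exact (dvd_mul_right _ _).mul_left _
    · obtain ⟨i, rfl⟩ := Nat.exists_eq_add_of_le him
      rw [(hβ i (by omega)).2.2]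
      exact (dvd_mul_right _ _).mul_left _
  -- A column of maximal length M is a product of some β i, of length at most nb + 1, with k u or k
  -- v.
  · rw [hpk]
    have hk1 : plen k ≠ 0 := fun h => hk (plen_eq_zero.1 h)
    have hm := h.max_pos
    rcases h.attained with h0 | ⟨i, hi, hi'⟩
    · omega
    · obtain ⟨β, hβ⟩ := hg
      have h3 : ∀ (b w : (ZMod p)[X]), plen b ≤ nb + 1 → plen w ≤ max (plen (k * u)) (plen (k * v)) →
          plen (b * w) + 1 ≤ nb + plen k + max (plen u) (plen v) := by
        intro b w hb hw
        rcases eq_or_ne b 0 with rfl | hb0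
        · rw [zero_mul, plen_zero]; omega
        rcases eq_or_ne w 0 with rfl | hw0
        · rw [mul_zero, plen_zero]; omega
        have := plen_mul hb0 hw0
        omega
      rw [← hi']
      rcases Nat.lt_or_ge i m with him | him
      · rw [(hβ i him).2.1]
        exact h3 _ _ (hβ i him).1 (le_max_left _ _)
      · obtain ⟨i, rfl⟩ := Nat.exists_eq_add_of_le him
        rw [(hβ i (by omega)).2.2]
        exact h3 _ _ (hβ i (by omega)).1 (le_max_right _ _)

/-- If there is a key, then every multiple of the coprime pair by an admissible polynomial is one. -/
theorem Reduction.polyKey (h : Reduction m cs D u v M j) {f₁ f₂ e : (ZMod p)[X]}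
    (hf : PolyKey nb m cs f₁ f₂) (he : Admissible lam nb M D u v e) :
    PolyKey nb m cs (e * u) (e * v) := by
  obtain ⟨k, hk, rfl, rfl⟩ := h.exists_eq_mul hf
  obtain ⟨β, hβ⟩ := hf
  obtain ⟨heD, -, hM⟩ := he
  have he0 : e ≠ 0 := fun h0 => h.monic.ne_zero (zero_dvd_iff.1 (h0 ▸ heD))
  have hdvd := (h.dvd_iff e).1 heD
  -- The polynomial e divides β i k u and β i k v, hence β i k, because u and v are coprime. The
  -- quotient γ i takes the role of β i.
  have h1 : ∀ i, ∃ γ, i < m → β i * k = γ * e := fun i => by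
    by_cases hi : i < m
    · obtain ⟨a, b, hab⟩ := h.isCoprime
      have d1 := hdvd i (by omega)
      have d2 := hdvd (m + i) (by omega)
      rw [(hβ i hi).2.1] at d1
      rw [(hβ i hi).2.2] at d2
      have d3 : e ∣ β i * k := by
        have := dvd_add (d1.mul_left a) (d2.mul_left b)
        rwa [show a * (β i * (k * u)) + b * (β i * (k * v)) = β i * k * (a * u + b * v) by ring, hab,
          mul_one] at this
      obtain ⟨γ, hγ⟩ := d3
      exact ⟨γ, fun _ => by rw [hγ, mul_comm]⟩
    · exact ⟨0, fun h => absurd h hi⟩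
  choose γ hγ using h1
  refine ⟨γ, fun i hi => ?_⟩
  have e1 : cs i = γ i * (e * u) := by
    rw [(hβ i hi).2.1, ← mul_assoc, hγ i hi, mul_assoc]
  have e2 : cs (m + i) = γ i * (e * v) := by
    rw [(hβ i hi).2.2, ← mul_assoc, hγ i hi, mul_assoc]
  refine ⟨?_, e1, e2⟩
  rcases eq_or_ne (γ i) 0 with h0 | h0
  · rw [h0, plen_zero]; omega
  -- The longer of the two columns γ i e u and γ i e v has length at most M, and the lower bound on
  -- the length of e turns this into a bound for γ i.
  have h2 := max_plen_mul (mul_ne_zero h0 he0) h.max_pos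
  have h3 := plen_mul h0 he0
  rw [mul_assoc, mul_assoc, ← e1, ← e2] at h2
  have h4 := h.le i (by omega)
  have h5 := h.le (m + i) (by omega)
  have h6 : plen (γ i) ≠ 0 := fun h => h0 (plen_eq_zero.1 h)
  omega

end Polynomials

/-! ### Vectors and matrices as polynomials -/

section VecPoly

variable {p : ℕ}

/-- The polynomial with the coefficient vector `f`. -/
noncomputable def vecPoly {k : ℕ} (f : Fin k → ZMod p) : (ZMod p)[X] := ∑ i, C (f i) * X ^ (i : ℕ)

theorem coeff_vecPoly {k : ℕ} (f : Fin k → ZMod p) (n : ℕ) :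
    (vecPoly f).coeff n = if h : n < k then f ⟨n, h⟩ else 0 := by
  simp only [vecPoly, finsetSum_coeff, coeff_C_mul_X_pow]
  split_ifs with h
  · rw [Finset.sum_eq_single ⟨n, h⟩ (fun i _ hi => if_neg fun h' => hi (Fin.ext h'.symm)) (by simp)]
    simp
  · exact Finset.sum_eq_zero fun i _ => if_neg (by omega)

theorem plen_vecPoly_le {k : ℕ} (f : Fin k → ZMod p) : plen (vecPoly f) ≤ k :=
  plen_le fun i hi => by rw [coeff_vecPoly, dif_neg (by omega)]

theorem vecPoly_injective {k : ℕ} : Function.Injective (vecPoly (p := p) (k := k)) := by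
  intro f g h
  ext i
  have := congrArg (fun q => q.coeff (i : ℕ)) h
  simpa [coeff_vecPoly] using this

theorem vecPoly_coeff {k : ℕ} {q : (ZMod p)[X]} (hq : plen q ≤ k) :
    vecPoly (fun i : Fin k => q.coeff i) = q := by
  ext n
  rw [coeff_vecPoly]
  split_ifs with h
  · rfl
  · rw [coeff_eq_zero_of_plen_le (by omega)]

theorem vecPoly_smul {k : ℕ} (c : ZMod p) (f : Fin k → ZMod p) :
    vecPoly (c • f) = C c * vecPoly f := by
  simp [vecPoly, Finset.mul_sum, mul_assoc]

theorem vecPoly_centralMap {nb m lam : ℕ} (b : Matrix (Fin (nb + 1)) (Fin m) (ZMod p))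
    (f : Fin (lam + 1) → ZMod p) (j : Fin m) :
    vecPoly (fun i => HPPK.centralMap b f i j) = vecPoly (fun i => b i j) * vecPoly f := by
  ext n
  rw [coeff_vecPoly, vecPoly, vecPoly, Finset.sum_mul_sum, finsetSum_coeff]
  simp only [finsetSum_coeff, mul_mul_mul_comm _ (X ^ _) _ _, ← C_mul, ← pow_add,
    coeff_C_mul_X_pow]
  split_ifs with h
  · simp only [HPPK.centralMap, eq_comm]
  · exact (Finset.sum_eq_zero fun s _ => Finset.sum_eq_zero fun t _ => if_neg (by omega)).symm

end VecPoly

/-! ### Correctness of the candidate lists -/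

section Keys

variable {p : ℕ} [Fact p.Prime] {lam nb m M j n : ℕ} {D u v : (ZMod p)[X]} {F : ℕ → (ZMod p)[X]}
  {P₁ P₂ : Matrix (Fin (nb + lam + 1)) (Fin m) (ZMod p)} {f₁ f₂ : Fin (lam + 1) → ZMod p}
  {L : List ((Fin (lam + 1) → ZMod p) × (Fin (lam + 1) → ZMod p))}

/-- The columns of two matrices as polynomials. -/
noncomputable def columns {k m : ℕ} (P₁ P₂ : Matrix (Fin k) (Fin m) (ZMod p)) (c : ℕ) :
    (ZMod p)[X] :=
  if h : c < m then vecPoly fun i => P₁ i ⟨c, h⟩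
  else if h : c - m < m then vecPoly fun i => P₂ i ⟨c - m, h⟩ else 0

theorem columns_left {k m : ℕ} (P₁ P₂ : Matrix (Fin k) (Fin m) (ZMod p)) (i : Fin m) :
    columns P₁ P₂ i = vecPoly fun r => P₁ r i := by
  rw [columns, dif_pos i.2]

theorem columns_right {k m : ℕ} (P₁ P₂ : Matrix (Fin k) (Fin m) (ZMod p)) (i : Fin m) :
    columns P₁ P₂ (m + i) = vecPoly fun r => P₂ r i := by
  rw [columns, dif_neg (by omega), dif_pos (by omega)]
  congr 1
  ext r
  congr
  omega

/-- Column by column, the central map is multiplication of polynomials. In the converse direction,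
the bound nb + 1 on the length of β i is what makes these polynomials the columns of a matrix b. -/
theorem isKey_iff : HPPK.IsKey (nb := nb) P₁ P₂ f₁ f₂ ↔
    PolyKey nb m (columns P₁ P₂) (vecPoly f₁) (vecPoly f₂) := by
  refine ⟨?_, ?_⟩
  · rintro ⟨b, rfl, rfl⟩
    refine ⟨fun i => if h : i < m then vecPoly fun r => b r ⟨i, h⟩ else 0, fun i hi => ?_⟩
    have h1 := columns_left (HPPK.centralMap b f₁) (HPPK.centralMap b f₂) ⟨i, hi⟩
    have h2 := columns_right (HPPK.centralMap b f₁) (HPPK.centralMap b f₂) ⟨i, hi⟩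
    rw [vecPoly_centralMap] at h1 h2
    simp only [dif_pos hi]
    exact ⟨plen_vecPoly_le _, h1, h2⟩
  · rintro ⟨β, hβ⟩
    have hb : ∀ (P : Matrix (Fin (nb + lam + 1)) (Fin m) (ZMod p)) (f : Fin (lam + 1) → ZMod p),
        (∀ i : Fin m, vecPoly (fun r => P r i) = β i * vecPoly f) →
        P = HPPK.centralMap (Matrix.of fun (r : Fin (nb + 1)) (i : Fin m) => (β i).coeff r) f := by
      intro P f h
      ext r i
      refine congrFun (g := fun r => HPPK.centralMap _ f r i) (vecPoly_injective ((h i).trans ?_)) r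
      rw [vecPoly_centralMap]
      simp only [Matrix.of_apply]
      rw [vecPoly_coeff (hβ i i.2).1]
    exact ⟨_, hb P₁ f₁ fun i => by rw [← columns_left P₁ P₂, (hβ i i.2).2.1],
      hb P₂ f₂ fun i => by rw [← columns_right P₁ P₂, (hβ i i.2).2.2]⟩

theorem exists_columns_ne_zero (h : P₁ ≠ 0 ∨ P₂ ≠ 0) : ∃ i < m + m, columns P₁ P₂ i ≠ 0 := by
  by_contra! h0
  have key : ∀ (P : Matrix (Fin (nb + lam + 1)) (Fin m) (ZMod p)),
      (∀ i : Fin m, vecPoly (fun r => P r i) = 0) → P = 0 := fun P hP => by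
    ext r i
    refine congrFun (vecPoly_injective ?_ : (fun r => P r i) = fun _ => 0) r
    rw [hP]
    simp [vecPoly]
  rcases h with h | h
  · exact h (key _ fun i => by rw [← columns_left P₁ P₂, h0 i (by omega)])
  · exact h (key _ fun i => by rw [← columns_right P₁ P₂, h0 (m + i) (by omega)])

variable (hR : Reduction m (columns P₁ P₂) D u v M j)

include hR

/-- Admissibility bounds the lengths of e u and e v by lam + 1, so nothing is lost by keeping only
lam + 1 coefficients. -/
theorem vecPoly_pairOf {e : (ZMod p)[X]} (he : Admissible lam nb M D u v e) :
    vecPoly (pairOf lam u v e).1 = e * u ∧ vecPoly (pairOf lam u v e).2 = e * v := by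
  have he0 : e ≠ 0 := fun h0 => hR.monic.ne_zero (zero_dvd_iff.1 (h0 ▸ he.1))
  have h1 := max_plen_mul he0 hR.max_pos
  have h2 := he.2.1
  exact ⟨vecPoly_coeff (q := e * u) (by omega), vecPoly_coeff (q := e * v) (by omega)⟩

theorem isKey_pairOf (hf : HPPK.IsKey (nb := nb) P₁ P₂ f₁ f₂) {e : (ZMod p)[X]}
    (he : Admissible lam nb M D u v e) :
    HPPK.IsKey (nb := nb) P₁ P₂ (pairOf lam u v e).1 (pairOf lam u v e).2 := by
  obtain ⟨h1, h2⟩ := vecPoly_pairOf hR he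
  rw [isKey_iff, h1, h2]
  exact hR.polyKey (isKey_iff.1 hf) he

theorem exists_pairOf (hf : HPPK.IsKey (nb := nb) P₁ P₂ f₁ f₂) :
    ∃ e : (ZMod p)[X], e.Monic ∧ Admissible lam nb M D u v e ∧
      HPPK.ScalarEquiv f₁ f₂ (pairOf lam u v e).1 (pairOf lam u v e).2 := by
  obtain ⟨e, c, hc, hm, he, h1, h2⟩ := hR.exists_admissible (isKey_iff.1 hf) (plen_vecPoly_le f₁)
    (plen_vecPoly_le f₂)
  obtain ⟨h3, h4⟩ := vecPoly_pairOf hR he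
  have key : ∀ f g : Fin (lam + 1) → ZMod p, vecPoly f = C c * vecPoly g → g = c⁻¹ • f :=
    fun f g h => by
    rw [← vecPoly_smul] at h
    rw [vecPoly_injective h, smul_smul, inv_mul_cancel₀ hc, one_smul]
  exact ⟨e, hm, he, c⁻¹, inv_ne_zero hc, key _ _ (by rw [h1, h3]), key _ _ (by rw [h2, h4])⟩

/-- The check makes every nonconstant piece irreducible, so a piece that meets an admissible e
divides it. As deg e ≤ lam ≤ 2, `Factorization.exists_mul_eq` shows that e is among the enumerated
products. -/
theorem isKeyList_of_candidates (hlam : lam ≤ 2) (hF : Factorization (smallPart D) F n)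
    (hsmall : ∀ i < n, plen (F i) ≤ 2 ∨ plen (F i) = 3 ∧ plen (mgcd (F i) (splitter D)) ≤ 1)
    (hL : Candidates lam nb M D u v F n L) (hf : HPPK.IsKey (nb := nb) P₁ P₂ f₁ f₂) :
    HPPK.IsKeyList (nb := nb) P₁ P₂ L := by
  refine ⟨fun g hg => ?_, fun g₁ g₂ hg => ?_⟩
  · obtain ⟨i, -, j, -, hA, rfl⟩ := hL.sound g hg
    exact isKey_pairOf hR hf hA
  obtain ⟨e, hm, he, hs⟩ := exists_pairOf hR hg
  have hmax := hR.max_pos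
  have hed := he.2.1
  rw [plen_of_ne hm.ne_zero] at hed
  have hq2 : ∀ q, q ∣ e → q.natDegree ≤ 2 := fun q hq => by
    have := natDegree_le_of_dvd hq hm.ne_zero
    omega
  obtain ⟨i, hi, j, hj, rfl⟩ := hF.exists_mul_eq hm (hq2 e dvd_rfl)
    (fun q hq hqe => (dvd_smallPart_iff hq (hqe.trans he.1)).2 (hq2 q hqe))
    (fun i hi q hq hqe hqi => by
      have hmi := hF.monic i hi
      have hiD := (hF.dvd hi).trans (smallPart_dvd D)
      have hq1 := hq.natDegree_pos
      have hqd := natDegree_le_of_dvd hqi hmi.ne_zero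
      have hs := hsmall i hi
      rw [plen_of_ne hmi.ne_zero] at hs
      have h1 : Irreducible (F i) := by
        rcases hs with hs | ⟨hs, hs'⟩
        · exact irreducible_of_degree_eq_one
            (by rw [degree_eq_natDegree hmi.ne_zero]; norm_cast; omega)
        -- A quadratic piece is irreducible unless it has a root a, and then X - a divides its gcd
        -- with `splitter D`.
        · rw [hmi.irreducible_iff_roots_eq_zero_of_degree_le_three (by omega) (by omega),
            Multiset.eq_zero_iff_forall_notMem]
          intro a ha
          rw [mem_roots hmi.ne_zero, ← dvd_iff_isRoot] at ha
          have h2 : X - C a ∣ mgcd (F i) (splitter D) := dvd_mgcd.2 ⟨ha,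
            (dvd_splitter_iff (irreducible_X_sub_C a) (ha.trans hiD)).2 (natDegree_X_sub_C a)⟩
          have h0 : mgcd (F i) (splitter D) ≠ 0 := fun h0 =>
            hmi.ne_zero (zero_dvd_iff.1 (h0 ▸ (dvd_mgcd.1 dvd_rfl).1))
          have h3 := natDegree_le_of_dvd h2 h0
          rw [natDegree_X_sub_C] at h3
          rw [plen_of_ne h0] at hs'
          omega
      exact ((hq.associated_of_dvd h1 hqi).dvd_iff_dvd_left).1 hqe)
  exact ⟨_, hL.complete i hi j hj he, hs⟩

/-- Uniqueness replaces the factorization. It implies that e is divisible by every irreducible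
divisor of D that has the same degree as some factor of e, so the pieces obtained by separating
degrees already suffice to build e. -/
theorem exists_cons_of_candidates (hlam : lam ≤ 2) (hF : Factorization (smallPart D) F n)
    (hres : ∀ i < n, Resolved (splitter D) (F i))
    (hL : Candidates lam nb M D u v F n L) (hf : HPPK.IsKey (nb := nb) P₁ P₂ f₁ f₂)
    (huniq : ∀ g₁ g₂, HPPK.IsKey (nb := nb) P₁ P₂ g₁ g₂ → HPPK.ScalarEquiv f₁ f₂ g₁ g₂) :
    ∃ g L', L = g :: L' ∧ HPPK.ScalarEquiv f₁ f₂ g.1 g.2 := by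
  obtain ⟨e, hm, he, c, hc, hs₁, hs₂⟩ := exists_pairOf hR hf
  have hmax := hR.max_pos
  have hed := he.2.1
  rw [plen_of_ne hm.ne_zero] at hed
  have hq2 : ∀ q, q ∣ e → q.natDegree ≤ 2 := fun q hq => by
    have := natDegree_le_of_dvd hq hm.ne_zero
    omega
  -- Admissibility depends only on the length once e' divides D. Thus (e' u, e' v) is a key as well,
  -- and coprimality of u and v cancels them from the two proportionalities.
  have huniq' : ∀ e', e' ∣ D → plen e' = plen e → e' ∣ e := fun e' h1 h2 => by
    have h3 : Admissible lam nb M D u v e' := ⟨h1, by rw [h2]; exact he.2.1, by rw [h2]; exact he.2.2⟩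
    obtain ⟨a, ha, ha₁, ha₂⟩ := huniq _ _ (isKey_pairOf hR hf h3)
    obtain ⟨h4, h5⟩ := vecPoly_pairOf hR he
    obtain ⟨h6, h7⟩ := vecPoly_pairOf hR h3
    rw [ha₁, vecPoly_smul] at h6
    rw [ha₂, vecPoly_smul] at h7
    rw [hs₁, vecPoly_smul] at h4
    rw [hs₂, vecPoly_smul] at h5
    obtain ⟨r, t, hrt⟩ := hR.isCoprime
    have h8 : C c * e' = C a * e := by
      linear_combination (-(C c * e') + C a * e) * hrt - C c * r * h6 - C c * t * h7 +
        C a * r * h4 + C a * t * h5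
    have h9 : C a * e ∣ e := ⟨C a⁻¹, by rw [mul_right_comm, ← C_mul, mul_inv_cancel₀ ha, C_1, one_mul]⟩
    exact ((dvd_mul_left e' (C c)).trans h8.dvd).trans h9
  obtain ⟨i, hi, j, hj, hij⟩ := hF.exists_mul_eq hm (hq2 e dvd_rfl)
    (fun q hq hqe => (dvd_smallPart_iff hq (hqe.trans he.1)).2 (hq2 q hqe))
    (fun i hi l hl hle hli => by
      refine dvd_of_squarefree ((squarefree_smallPart D).squarefree_of_dvd (hF.dvd hi))
        fun q hq hqi => ?_
      have hiD := (hF.dvd hi).trans (smallPart_dvd D)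
      -- Both degrees are 1 or 2, and `splitter D` tells these two cases apart.
      have hdeg : q.natDegree = l.natDegree := by
        have h1 := hres i hi q l hq hl hqi hli
        rw [dvd_splitter_iff hq (hqi.trans hiD), dvd_splitter_iff hl (hli.trans hiD)] at h1
        have h2 := (dvd_smallPart_iff hq (hqi.trans hiD)).1 (hqi.trans (hF.dvd hi))
        have h3 := hq2 l hle
        have h4 := hq.natDegree_pos
        have h5 := hl.natDegree_pos
        omega
      obtain ⟨r, hr⟩ := hle
      have hr0 : r ≠ 0 := by rintro rfl; exact hm.ne_zero (by rw [hr, mul_zero])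
      -- Exchange argument: with e = l r, the product q r is again a divisor of D, of the same
      -- length as e, so it divides e.
      by_contra hqe
      have hqr : ¬ q ∣ r := fun h => hqe (hr ▸ h.mul_left l)
      have h1 : q * r ∣ D := ((hq.coprime_iff_not_dvd).2 hqr).mul_dvd (hqi.trans hiD)
        ((hr ▸ dvd_mul_left r l : r ∣ e).trans he.1)
      refine hqe ((dvd_mul_right q r).trans (huniq' _ h1 ?_))
      have h2 := plen_mul hq.ne_zero hr0
      have h3 := plen_mul hl.ne_zero hr0
      rw [plen_of_ne hq.ne_zero] at h2
      rw [plen_of_ne hl.ne_zero] at h3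
      rw [hr]
      omega)
  have hmem := hL.complete i hi j hj (hij ▸ he)
  rcases L with _ | ⟨g, L'⟩
  · simp at hmem
  · obtain ⟨i, -, j, -, hA, hg⟩ := hL.sound g List.mem_cons_self
    -- The first candidate need not come from e itself: every candidate is a key, hence a scalar
    -- multiple of (f₁, f₂).
    exact ⟨g, L', rfl, huniq _ _ (hg ▸ isKey_pairOf hR hf hA)⟩

omit hR

/-- With base polynomial 0 every pair is a key for the zero matrices, and these pairs do not form a
single class. -/
theorem exists_ne_zero_of_unique
    (huniq : ∀ g₁ g₂, HPPK.IsKey (nb := nb) P₁ P₂ g₁ g₂ → HPPK.ScalarEquiv f₁ f₂ g₁ g₂) :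
    P₁ ≠ 0 ∨ P₂ ≠ 0 := by
  by_contra! h
  obtain ⟨rfl, rfl⟩ := h
  have hk : ∀ g₁ g₂ : Fin (lam + 1) → ZMod p, HPPK.IsKey (nb := nb)
      (0 : Matrix (Fin (nb + lam + 1)) (Fin m) (ZMod p)) 0 g₁ g₂ := fun g₁ g₂ => by
    refine ⟨0, ?_, ?_⟩ <;> ext i j <;> simp [HPPK.centralMap]
  obtain ⟨c, hc, h1, -⟩ := huniq _ _ (hk 0 0)
  obtain ⟨c', hc', h2, -⟩ := huniq _ _ (hk 1 0)
  have h3 : f₁ = 0 := (smul_eq_zero_iff_right hc).1 h1.symm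
  rw [h3, smul_zero] at h2
  exact one_ne_zero (congrFun h2 0)

end Keys

/-- The case p = 2: the two sums are the two elements of the field in some order. -/
theorem not_add_eq_one_iff : ∀ t t' c : ZMod 2, t ≠ t' → ¬ (t + c = 1 ↔ t' + c = 1) := by decide

/-! ### Trace, norm and the quadratic character -/

section Invariants

variable {p : ℕ} [Fact p.Prime] {D : (ZMod p)[X]}

theorem X_pow_sub_X_eq_prod : (X ^ p - X : (ZMod p)[X]) = ∏ a : ZMod p, (X - C a) := by
  have hp := (Fact.out : p.Prime).one_lt
  have hm : (X ^ p - X : (ZMod p)[X]).Monic := monic_X_pow_sub (by simpa using hp)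
  have h := FiniteField.roots_X_pow_card_sub_X (ZMod p)
  rw [ZMod.card] at h
  have h1 := prod_multiset_X_sub_C_of_monic_of_roots_card_eq hm (by
    rw [h, FiniteField.X_pow_card_sub_X_natDegree_eq _ hp]
    exact ZMod.card p)
  rw [h] at h1
  exact h1.symm

/-- An element of the field `𝔽_p[X] / q` that is fixed by the Frobenius map lies in the prime
field. -/
theorem exists_dvd_sub_C {q T : (ZMod p)[X]} (hq : Irreducible q) (h : q ∣ T ^ p - T) :
    ∃ t, q ∣ T - C t := by
  have h1 := congrArg (fun f => f.comp T) (X_pow_sub_X_eq_prod (p := p))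
  simp only [sub_comp, pow_comp, X_comp, prod_comp, C_comp] at h1
  rw [h1, hq.prime.dvd_finsetProd_iff] at h
  obtain ⟨t, -, ht⟩ := h
  exact ⟨t, ht⟩

/-- A root x of q satisfies x^(p²) = x, so x + x^p and x · x^p are fixed by the Frobenius map and
lie in the prime field, and x is a root of X² - tX + n. For a linear factor this is the square of
that factor. -/
theorem exists_trace_norm {q : (ZMod p)[X]} (hq : Irreducible q) (h : q ∣ smallPart D) :
    ∃ t n, q ∣ traceMod D - C t ∧ q ∣ normMod D - C n ∧ q ∣ X ^ 2 - C t * X + C n := by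
  have hD := h.trans (smallPart_dvd D)
  have h2 : q ∣ X ^ p ^ 2 - X := (dvd_smallPart hD).1 h
  have hf : q ∣ X ^ p - frob D := hD.trans (dvd_sub_modByMonic _)
  have hn : q ∣ frob D * X - normMod D := hD.trans (dvd_sub_modByMonic _)
  have hT : q ∣ (X ^ p + X) - traceMod D := by
    rw [traceMod, add_sub_add_right_eq_sub]; exact hf
  have hN : q ∣ X ^ p * X - normMod D := by
    have := dvd_add (hf.mul_right X) hn
    rwa [sub_mul, sub_add_sub_cancel] at this
  obtain ⟨t, ht⟩ := exists_dvd_sub_C (T := X ^ p + X) hq (by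
    rw [add_pow_char, ← pow_mul, ← sq]
    rwa [show (X ^ p ^ 2 + X ^ p - (X ^ p + X) : (ZMod p)[X]) = X ^ p ^ 2 - X by ring])
  obtain ⟨n, hn⟩ := exists_dvd_sub_C (T := X ^ p * X) hq (by
    rw [mul_pow, ← pow_mul, ← sq]
    have := h2.mul_right (X ^ p)
    rwa [show (X ^ p ^ 2 - X) * X ^ p = (X ^ p ^ 2 * X ^ p - X ^ p * X : (ZMod p)[X]) by ring] at this)
  refine ⟨t, n, ?_, ?_, ?_⟩
  · have := dvd_sub ht hT
    rwa [sub_sub_sub_cancel_left, ← neg_sub, neg_sub] at this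
  · have := dvd_sub hn hN
    rwa [sub_sub_sub_cancel_left, ← neg_sub, neg_sub] at this
  · have := dvd_sub (ht.mul_right X) hn
    rwa [show ((X ^ p + X - C t) * X - (X ^ p * X - C n) : (ZMod p)[X]) = X ^ 2 - C t * X + C n by
      ring] at this

/-- The trace and the norm of the root determine an irreducible factor. -/
theorem eq_of_trace_norm_eq {q q' : (ZMod p)[X]} (hq : Irreducible q) (hq' : Irreducible q')
    (hm : q.Monic) (hm' : q'.Monic) (h : q ∣ smallPart D) {t n : ZMod p}
    (ht : q ∣ traceMod D - C t) (h1 : q ∣ X ^ 2 - C t * X + C n)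
    (h1' : q' ∣ X ^ 2 - C t * X + C n) : q = q' := by
  by_contra hne
  have hD := h.trans (smallPart_dvd D)
  have hco : IsCoprime q q' := hq.coprime_iff_not_dvd.2 fun hd =>
    hne (eq_of_monic_of_associated hm hm' (hq.associated_of_dvd hq' hd))
  have hdeg : (X ^ 2 - C t * X + C n : (ZMod p)[X]).natDegree ≤ 2 := by compute_degree
  have hne0 : (X ^ 2 - C t * X + C n : (ZMod p)[X]) ≠ 0 := fun h0 => by
    have := congrArg (fun f => f.coeff 2) h0
    simp at this
  have h2 := natDegree_le_of_dvd (hco.mul_dvd h1 h1') hne0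
  rw [hm.natDegree_mul hm'] at h2
  have hq1 := hq.natDegree_pos
  have hq1' := hq'.natDegree_pos
  have key : ∀ f : (ZMod p)[X], f.Monic → f.natDegree = 1 → ∃ a, f = X - C a := fun f hf hf1 =>
    ⟨-f.coeff 0, by rw [hf.eq_X_add_C hf1]; simp⟩
  obtain ⟨a, rfl⟩ := key q hm (by omega)
  obtain ⟨b, rfl⟩ := key q' hm' (by omega)
  rw [dvd_iff_isRoot] at h1 h1'
  -- By degrees, two different factors are both linear, with roots a and b. Subtracting the splitter
  -- from the trace gives t = 2a, so a is a double root of X² - tX + n, and b = a.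
  have h3 : X - C a ∣ splitter D := (dvd_splitter_iff hq hD).2 (natDegree_X_sub_C a)
  have h4 := dvd_sub ht h3
  rw [traceMod, splitter, dvd_iff_isRoot] at h4
  simp only [IsRoot.def, eval_sub, eval_add, eval_mul, eval_pow, eval_X, eval_C] at h1 h1' h4
  have h5 : (a - b) ^ 2 = 0 := by linear_combination h1' - h1 + (a - b) * h4
  exact hne (by rw [sub_eq_zero.1 (pow_eq_zero_iff two_ne_zero |>.1 h5)])

/-- Modulo q the polynomial T is the constant t, so the test polynomial becomes a constant, which q
divides only if it is zero. -/
theorem dvd_testPoly_iff {q T : (ZMod p)[X]} (hq : Irreducible q) (hD : q ∣ D) {t : ZMod p}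
    (ht : q ∣ T - C t) (c : ℕ) :
    q ∣ testPoly D T c ↔ (t + (c : ZMod p)) ^ charExp p = 1 := by
  have h1 : q ∣ (T + C (c : ZMod p)) ^ charExp p - (T + C (c : ZMod p)) ^ charExp p %ₘ D :=
    hD.trans (dvd_sub_modByMonic _)
  have h2 : q ∣ (T + C (c : ZMod p)) ^ charExp p - C ((t + c) ^ charExp p) := by
    rw [C_pow]
    refine dvd_trans ?_ (sub_dvd_pow_sub_pow _ _ _)
    rwa [C_add, add_sub_add_right_eq_sub]
  have h3 : q ∣ testPoly D T c ↔ q ∣ C ((t + c) ^ charExp p) - C 1 := by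
    rw [testPoly, ← dvd_add_right (dvd_sub h1 h2), C_1]
    ring_nf
  rw [h3, ← C_sub]
  refine ⟨fun h => ?_, fun h => by rw [h]; simp⟩
  by_contra hne
  exact hq.not_isUnit (isUnit_of_dvd_unit h (isUnit_C.2 (sub_ne_zero.2 hne).isUnit))

theorem pow_charExp {x : ZMod p} (hp : p ≠ 2) (hx : x ≠ 0) :
    x ^ charExp p = 1 ∨ x ^ charExp p = -1 := by
  have h2 : charExp p + charExp p = p - 1 := by
    have := (Fact.out : p.Prime).two_le
    have := (Fact.out : p.Prime).eq_two_or_odd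
    unfold charExp
    omega
  rw [← sq_eq_one_iff, sq, ← pow_add, h2]
  exact ZMod.pow_card_sub_one_eq_one hx

/-- At least a third of the elements of the prime field distinguish two given elements. -/
theorem card_distinguishing {t t' : ZMod p} (h : t ≠ t') :
    p ≤ 3 * {c : ZMod p | ¬ ((t + c) ^ charExp p = 1 ↔ (t' + c) ^ charExp p = 1)}.ncard := by
  set G := {c : ZMod p | ¬ ((t + c) ^ charExp p = 1 ↔ (t' + c) ^ charExp p = 1)} with hG
  rcases eq_or_ne p 2 with rfl | hp
  · have : G = Set.univ := by
      ext c
      simp only [hG, Set.mem_ofPred_eq, Set.mem_univ, iff_true, show charExp 2 = 1 from rfl, pow_one]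
      exact not_add_eq_one_iff t t' c h
    rw [this, Set.ncard_univ, Nat.card_zmod]
    norm_num
  have hpp := (Fact.out : p.Prime)
  have h2 : charExp p + charExp p = p - 1 := by
    have := hpp.two_le
    have := hpp.eq_two_or_odd
    unfold charExp
    omega
  have hp3 : 3 ≤ p := by have := hpp.two_le; omega
  -- The nonsquares. There are at least (p - 1) / 2 of them, because the equation y^((p - 1) / 2) =
  -- 1 has at most (p - 1) / 2 solutions; and (p - 1) / 2 ≥ p / 3 for p ≥ 3.
  let Y : Finset (ZMod p) := (Finset.univ.erase 0) \ (nthRoots (charExp p) (1 : ZMod p)).toFinset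
  have hY : p - 1 ≤ Y.card + charExp p := by
    have h3 : _ ≤ Y.card + _ := Finset.card_le_card_sdiff_add_card (t := (nthRoots (charExp p) (1 : ZMod p)).toFinset)
      (s := Finset.univ.erase 0)
    rw [Finset.card_erase_of_mem (Finset.mem_univ _), Finset.card_univ, ZMod.card] at h3
    have h4 := (Multiset.toFinset_card_le _).trans (card_nthRoots (charExp p) (1 : ZMod p))
    omega
  have hYG : Y.card ≤ G.ncard := by
    rw [← Set.ncard_coe_finset]
    have hmem : ∀ y ∈ (Y : Set (ZMod p)), y ≠ 0 ∧ y ^ charExp p = -1 ∧ y - 1 ≠ 0 := fun y hy => by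
      simp only [Y, Finset.coe_sdiff, Set.mem_sdiff, Finset.mem_coe, Finset.mem_erase,
        Finset.mem_univ, and_true, Multiset.mem_toFinset,
        mem_nthRoots (show 0 < charExp p by omega)] at hy
      refine ⟨hy.1, (pow_charExp hp hy.1).resolve_left hy.2, fun h1 => hy.2 ?_⟩
      rw [sub_eq_zero.1 h1, one_pow]
    -- The value c is the solution of t + c = y (t' + c). For a nonsquare y, exactly one of t + c
    -- and t' + c is then a nonzero square.
    refine Set.ncard_le_ncard_of_injOn (fun y => (t - y * t') / (y - 1)) (fun y hy => ?_)
      (fun y hy z hz hyz => ?_) (Set.toFinite _)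
    · obtain ⟨h3, h4, h5⟩ := hmem y hy
      have h6 : t' + (t - y * t') / (y - 1) = (t - t') / (y - 1) := by field_simp; ring
      have h7 : t + (t - y * t') / (y - 1) = y * ((t - t') / (y - 1)) := by field_simp; ring
      have h8 : (t - t') / (y - 1) ≠ 0 := div_ne_zero (sub_ne_zero.2 h) h5
      have : Fact (2 < p) := ⟨by omega⟩
      have h9 : (-1 : ZMod p) ≠ 1 := ZMod.neg_one_ne_one
      simp only [hG, Set.mem_ofPred_eq]
      rw [h6, h7, mul_pow, h4]
      rcases pow_charExp hp h8 with h | h <;> rw [h] <;> simp [h9]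
    · obtain ⟨-, -, h5⟩ := hmem y hy
      obtain ⟨-, -, h5'⟩ := hmem z hz
      simp only at hyz
      rw [div_eq_div_iff h5 h5'] at hyz
      have h6 : (t - t') * (z - y) = 0 := by linear_combination hyz
      exact (sub_eq_zero.1 ((mul_eq_zero.1 h6).resolve_left (sub_ne_zero.2 h))).symm
  omega

/-- At least a sixth of the numbers with `k` binary digits distinguish two given elements. -/
theorem card_not_distinguishing_le {t t' : ZMod p} (h : t ≠ t') {k : ℕ} (hk : p < 2 ^ k) :
    6 * (Finset.univ.filter fun r : Fin (2 ^ k) => ((t + ((r : ℕ) : ZMod p)) ^ charExp p = 1 ↔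
      (t' + ((r : ℕ) : ZMod p)) ^ charExp p = 1)).card ≤ 5 * 2 ^ k := by
  classical
  have hp := (Fact.out : p.Prime).pos
  have h1 := card_distinguishing h
  set G := {c : ZMod p | ¬ ((t + c) ^ charExp p = 1 ↔ (t' + c) ^ charExp p = 1)} with hG
  have h2 := Finset.card_filter_add_card_filter_not (s := (Finset.univ : Finset (Fin (2 ^ k))))
    (fun r : Fin (2 ^ k) => ((t + ((r : ℕ) : ZMod p)) ^ charExp p = 1 ↔
      (t' + ((r : ℕ) : ZMod p)) ^ charExp p = 1))
  rw [Finset.card_univ, Fintype.card_fin] at h2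
  -- Every residue class has at least ⌊2^k / p⌋ representatives a + p i below 2^k.
  have h3 : G.ncard * (2 ^ k / p) ≤ (Finset.univ.filter fun r : Fin (2 ^ k) =>
      ¬ ((t + ((r : ℕ) : ZMod p)) ^ charExp p = 1 ↔
        (t' + ((r : ℕ) : ZMod p)) ^ charExp p = 1)).card := by
    rw [← Nat.card_coe_set_eq, Nat.card_eq_fintype_card, ← Fintype.card_fin (2 ^ k / p),
      ← Fintype.card_prod, ← Fintype.card_coe]
    have hval : ∀ x : G × Fin (2 ^ k / p), (x.1 : ZMod p).val + p * x.2 < 2 ^ k := fun x => by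
      have h4 := ZMod.val_lt (x.1 : ZMod p)
      have h5 := Nat.mul_le_mul_left p (show (x.2 : ℕ) + 1 ≤ 2 ^ k / p from x.2.2)
      have h6 := Nat.mul_div_le (2 ^ k) p
      rw [Nat.mul_succ] at h5
      omega
    have h4 : ∀ c ∈ G, ¬ ((t + c) ^ charExp p = 1 ↔ (t' + c) ^ charExp p = 1) := fun c hc => by
      simpa only [hG, Set.mem_ofPred_eq] using hc
    refine Fintype.card_le_of_injective (fun x => ⟨⟨(x.1 : ZMod p).val + p * x.2, hval x⟩, ?_⟩) ?_
    · have h5 := h4 _ x.1.2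
      simpa using h5
    · rintro ⟨a, i⟩ ⟨b, j⟩ hab
      simp only [Subtype.mk.injEq, Fin.mk.injEq] at hab
      have h4 := congrArg (· % p) hab
      simp only [Nat.add_mul_mod_self_left, Nat.mod_eq_of_lt (ZMod.val_lt _)] at h4
      rw [h4] at hab
      have h5 : (i : ℕ) = j := Nat.eq_of_mul_eq_mul_left hp (by omega)
      exact Prod.ext (Subtype.ext (ZMod.val_injective p h4)) (Fin.ext h5)
  -- As p < 2^k, the multiple p ⌊2^k / p⌋ exceeds half of 2^k. This loses a factor of two against
  -- the proportion 1/3 in the field.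
  have h4 : 1 ≤ 2 ^ k / p := Nat.div_pos hk.le hp
  have h5 : 2 ^ k < p * (2 ^ k / p + 1) := Nat.lt_mul_div_succ _ hp
  have h6 : p * (2 ^ k / p) ≤ 3 * G.ncard * (2 ^ k / p) := Nat.mul_le_mul_right _ h1
  have h7 : p * 1 ≤ p * (2 ^ k / p) := Nat.mul_le_mul_left _ h4
  rw [mul_assoc] at h6
  rw [mul_add] at h5
  omega

end Invariants

/-! ### Independence and the union bound -/

/-- Coin flips as a family of independent uniform numbers with `k` binary digits. -/
def coinEquiv (k : ℕ) : (Fin (16 * k * k) → Bool) ≃ (Fin (16 * k) → Fin (2 ^ k)) :=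
  ((finProdFinEquiv.symm.arrowCongr finTwoEquiv.symm).trans (Equiv.curry _ _ _)).trans
    ((Equiv.refl _).arrowCongr finFunctionFinEquiv)

theorem ofList_coins {K : ℕ} (w : Fin K → Bool) {i : ℕ} (hi : i < K) :
    ofList (coins w) (i + 1) = (w ⟨i, hi⟩).toNat := by
  simp [ofList, coins, List.getD_eq_getElem?_getD, hi]

/-- The numbers that the program reads from the coin flips are the independent uniform ones. -/
theorem coinEquiv_apply {k : ℕ} (w : Fin (16 * k * k) → Bool) (j : Fin (16 * k)) :
    (coinEquiv k w j : ℕ) = coinValue (ofList (coins w)) k j := by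
  have hb : ∀ b : Bool, ((finTwoEquiv.symm b : Fin 2) : ℕ) = b.toNat := by decide
  simp only [coinEquiv, Equiv.trans_apply, Equiv.arrowCongr_apply, Function.comp_apply,
    Equiv.refl_symm, Equiv.coe_refl, id_eq, finFunctionFinEquiv_apply, Equiv.symm_symm,
    Equiv.curry_apply, Function.curry_apply, hb]
  rw [coinValue, Finset.sum_range]
  refine Finset.sum_congr rfl fun i _ => ?_
  have h1 : j * k + i = (finProdFinEquiv (j, i) : Fin (16 * k * k)) := by
    simp [finProdFinEquiv]; ring
  rw [ofList_coins w (by rw [h1]; exact Fin.is_lt _)]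
  simp only [h1]

/-- The union bound for at most `k ^ 2` events, each of which requires that `16 k` independent
numbers lie in a set of probability at most `5 / 6`. -/
theorem two_mul_card_le {ι : Type*} {k : ℕ} (I : Finset ι) (hI : I.card ≤ k ^ 2)
    (B : ι → Finset (Fin (2 ^ k))) (hB : ∀ i ∈ I, 6 * (B i).card ≤ 5 * 2 ^ k)
    (P : (Fin (16 * k * k) → Bool) → Prop)
    (hP : ∀ w, P w → ∃ i ∈ I, ∀ j, coinEquiv k w j ∈ B i) :
    2 * Nat.card {w // P w} ≤ 2 ^ (16 * k * k) := by
  classical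
  have h1 : Nat.card {w // P w} ≤
      (I.biUnion fun i => Fintype.piFinset fun _ : Fin (16 * k) => B i).card := by
    rw [← Fintype.card_coe, ← Nat.card_eq_fintype_card]
    refine Nat.card_le_card_of_injective (fun w => ⟨coinEquiv k w, ?_⟩) fun w w' h => ?_
    · obtain ⟨i, hi, h⟩ := hP w w.2
      exact Finset.mem_biUnion.2 ⟨i, hi, Fintype.mem_piFinset.2 h⟩
    · exact Subtype.ext ((coinEquiv k).injective (congrArg Subtype.val h))
  have h2 : ∀ i ∈ I, (Fintype.piFinset fun _ : Fin (16 * k) => B i).card * 16 ^ k ≤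
      2 ^ (16 * k * k) := fun i hi => by
    rw [Fintype.card_piFinset_const]
    have h3 := Nat.pow_le_pow_left (hB i hi) (16 * k)
    rw [mul_pow, mul_pow, ← pow_mul, show k * (16 * k) = 16 * k * k by ring] at h3
    -- This is 16 · 5^16 ≤ 6^16, raised to the power k. It makes the probability of each event at
    -- most 16^(-k).
    have h4 : (16 ^ k * 5 ^ (16 * k) : ℕ) ≤ 6 ^ (16 * k) := by
      rw [pow_mul, pow_mul, ← mul_pow]
      exact Nat.pow_le_pow_left (by norm_num) k
    have h5 := Nat.mul_le_mul_right ((B i).card ^ (16 * k)) h4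
    refine Nat.le_of_mul_le_mul_left ?_ (show 0 < 5 ^ (16 * k) by positivity)
    calc 5 ^ (16 * k) * ((B i).card ^ (16 * k) * 16 ^ k)
        = 16 ^ k * 5 ^ (16 * k) * (B i).card ^ (16 * k) := by ring
      _ ≤ _ := h5.trans h3
  have h3 : Nat.card {w // P w} * 16 ^ k ≤ k ^ 2 * 2 ^ (16 * k * k) := by
    refine (Nat.mul_le_mul_right _ (h1.trans Finset.card_biUnion_le)).trans ?_
    rw [Finset.sum_mul]
    refine (Finset.sum_le_card_nsmul I _ _ h2).trans ?_
    exact Nat.mul_le_mul_right _ hI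
  -- Here 2k² ≤ (k + 1)⁴ ≤ (2^k)⁴.
  have h4 : 2 * k ^ 2 ≤ 16 ^ k := by
    have h5 : k + 1 ≤ 2 ^ k := Nat.lt_two_pow_self
    have h6 := Nat.pow_le_pow_left h5 4
    rw [← pow_mul, mul_comm k 4, pow_mul] at h6
    norm_num at h6
    nlinarith [sq_nonneg k]
  refine Nat.le_of_mul_le_mul_right ?_ (show 0 < 16 ^ k by positivity)
  calc 2 * Nat.card {w // P w} * 16 ^ k ≤ 2 * (k ^ 2 * 2 ^ (16 * k * k)) := by
        rw [mul_assoc]; exact Nat.mul_le_mul_left _ h3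
    _ = 2 * k ^ 2 * 2 ^ (16 * k * k) := by ring
    _ ≤ 16 ^ k * 2 ^ (16 * k * k) := Nat.mul_le_mul_right _ h4
    _ = _ := mul_comm _ _

/-! ### The failure probability -/

section Failure

variable {p : ℕ} [Fact p.Prime] {D : (ZMod p)[X]}

/-- A factor passes the check if it does not have two different irreducible factors. -/
theorem plen_le_of_unique {f : (ZMod p)[X]} (hm : f.Monic) (hf : f ∣ smallPart D)
    (h : ∀ q q', Irreducible q → Irreducible q' → q.Monic → q'.Monic → q ∣ f → q' ∣ f → q = q') :
    plen f ≤ 2 ∨ plen f = 3 ∧ plen (mgcd f (splitter D)) ≤ 1 := by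
  classical
  have hD := smallPart_dvd D
  have norm : ∀ g : (ZMod p)[X], g ≠ 0 → 1 ≤ g.natDegree →
      ∃ q, Irreducible q ∧ q.Monic ∧ q ∣ g := fun g hg hg1 => by
    obtain ⟨q, hq, hqg⟩ := WfDvdMonoid.exists_irreducible_factor
      (fun hu => by rw [natDegree_eq_zero_of_isUnit hu] at hg1; omega) hg
    exact ⟨normalize q, (normalize_associated q).symm.irreducible hq, monic_normalize hq.ne_zero,
      normalize_dvd_iff.2 hqg⟩
  rw [plen_of_ne hm.ne_zero]
  by_cases h2 : f.natDegree ≤ 1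
  · exact Or.inl (by omega)
  obtain ⟨q, hq, hqm, hqf⟩ := norm f hm.ne_zero (by omega)
  have hq2 := (dvd_smallPart_iff hq ((hqf.trans hf).trans hD)).1 (hqf.trans hf)
  -- All irreducible factors of the squarefree f are associated to q, so f is q up to a unit.
  have hfq : f ∣ q := dvd_of_squarefree ((squarefree_smallPart D).squarefree_of_dvd hf)
    fun r hr hrf => by
      rw [← normalize_dvd_iff]
      rw [h _ q ((normalize_associated r).symm.irreducible hr) hq (monic_normalize hr.ne_zero) hqm
        (normalize_dvd_iff.2 hrf) hqf]
  have h3 := natDegree_le_of_dvd hfq hqm.ne_zero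
  have h4 := natDegree_le_of_dvd hqf hm.ne_zero
  refine Or.inr ⟨by omega, ?_⟩
  have h0 : mgcd f (splitter D) ≠ 0 := fun h0 =>
    hm.ne_zero (zero_dvd_iff.1 (h0 ▸ (dvd_mgcd.1 dvd_rfl).1))
  rw [plen_of_ne h0]
  by_contra h5
  obtain ⟨r, hr, hrm, hrg⟩ := norm _ h0 (by omega)
  obtain ⟨h6, h7⟩ := dvd_mgcd.1 hrg
  obtain rfl := h q r hq hr hqm hrm hqf h6
  rw [dvd_splitter_iff hq ((hqf.trans hf).trans hD)] at h7
  omega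

/-- Distinct monic irreducible factors are pairwise coprime, so their product divides f, and each
contributes at least 1 to the degree. -/
theorem card_normalizedFactors_le [DecidableEq (ZMod p)] {f : (ZMod p)[X]} (hf : f ≠ 0) :
    (UniqueFactorizationMonoid.normalizedFactors f).toFinset.card ≤ f.natDegree := by
  set S := (UniqueFactorizationMonoid.normalizedFactors f).toFinset with hS
  have hmem : ∀ q ∈ S, Irreducible q ∧ q.Monic ∧ q ∣ f := fun q hq => by
    rwa [hS, Multiset.mem_toFinset, Polynomial.mem_normalizedFactors_iff hf] at hq
  have h1 : ∏ q ∈ S, q ∣ f := Finset.prod_dvd_of_coprime (fun q hq q' hq' hne =>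
    (hmem q hq).1.coprime_iff_not_dvd.2 fun hd => hne (eq_of_monic_of_associated (hmem q hq).2.1
      (hmem q' hq').2.1 ((hmem q hq).1.associated_of_dvd (hmem q' hq').1 hd)))
    fun q hq => (hmem q hq).2.2
  have h2 := natDegree_le_of_dvd h1 hf
  rw [natDegree_prod_of_monic _ _ fun q hq => (hmem q hq).2.1] at h2
  refine le_trans ?_ h2
  rw [Finset.card_eq_sum_ones]
  exact Finset.sum_le_sum fun q hq => (hmem q hq).1.natDegree_pos

/-- The probability that the trials do not separate all irreducible factors is at most one half. -/
theorem two_mul_card_failure_le {k : ℕ} (hD : D.Monic) (hk : D.natDegree ≤ k) (hp : p < 2 ^ k)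
    (P : (Fin (16 * k * k) → Bool) → Prop)
    (hP : ∀ w, P w → ∃ (F : ℕ → (ZMod p)[X]) (n : ℕ), Factorization (smallPart D) F n ∧
      (∀ g ∈ tests D (ofList (coins w)) k (16 * k), ∀ i < n, Resolved g (F i)) ∧
      ¬ ∀ i < n, plen (F i) ≤ 2 ∨ plen (F i) = 3 ∧ plen (mgcd (F i) (splitter D)) ≤ 1) :
    2 * Nat.card {w // P w} ≤ 2 ^ (16 * k * k) := by
  classical
  have hE : smallPart D ≠ 0 := (squarefree_smallPart D).ne_zero
  set S := (UniqueFactorizationMonoid.normalizedFactors (smallPart D)).toFinset with hS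
  have hmem : ∀ q, q ∈ S ↔ Irreducible q ∧ q.Monic ∧ q ∣ smallPart D := fun q => by
    rw [hS, Multiset.mem_toFinset, Polynomial.mem_normalizedFactors_iff hE]
  have hcard : S.card ≤ k := (card_normalizedFactors_le hE).trans
    ((natDegree_le_of_dvd (smallPart_dvd D) hD.ne_zero).trans hk)
  -- The events are indexed by ordered pairs of distinct factors. A number is bad for a pair if
  -- neither the trace test nor the norm test separates it.
  refine two_mul_card_le S.offDiag ?_ (fun x => Finset.univ.filter fun r : Fin (2 ^ k) =>
    (x.1 ∣ testPoly D (traceMod D) r ↔ x.2 ∣ testPoly D (traceMod D) r) ∧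
    (x.1 ∣ testPoly D (normMod D) r ↔ x.2 ∣ testPoly D (normMod D) r)) ?_ P ?_
  · rw [Finset.offDiag_card, sq]
    exact (Nat.sub_le _ _).trans (Nat.mul_le_mul hcard hcard)
  · rintro ⟨q, q'⟩ hx
    obtain ⟨hq, hq', hne⟩ := Finset.mem_offDiag.1 hx
    obtain ⟨hqi, hqm, hqd⟩ := (hmem q).1 hq
    obtain ⟨hqi', hqm', hqd'⟩ := (hmem q').1 hq'
    obtain ⟨t, n, ht, hn, h1⟩ := exists_trace_norm hqi hqd
    obtain ⟨t', n', ht', hn', h1'⟩ := exists_trace_norm hqi' hqd'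
    have hqD := hqd.trans (smallPart_dvd D)
    have hqD' := hqd'.trans (smallPart_dvd D)
    simp only [dvd_testPoly_iff hqi hqD ht, dvd_testPoly_iff hqi hqD hn,
      dvd_testPoly_iff hqi' hqD' ht', dvd_testPoly_iff hqi' hqD' hn']
    -- Different factors differ in the trace or in the norm, and one of the two tests alone gives
    -- the bound.
    by_cases htt : t = t'
    · have hnn : n ≠ n' := by
        rintro rfl
        subst htt
        exact hne (eq_of_trace_norm_eq hqi hqi' hqm hqm' hqd ht h1 h1')
      refine le_trans (Nat.mul_le_mul_left 6 (Finset.card_le_card ?_))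
        (card_not_distinguishing_le hnn hp)
      exact Finset.monotone_filter_right _ fun r _ h => h.2
    · refine le_trans (Nat.mul_le_mul_left 6 (Finset.card_le_card ?_))
        (card_not_distinguishing_le htt hp)
      exact Finset.monotone_filter_right _ fun r _ h => h.1
  · intro w hw
    obtain ⟨F, n, hF, hres, hbad⟩ := hP w hw
    -- If each pair of factors were separated by some test, a piece resolved by all tests could not
    -- contain two of them, and every piece would pass the check.
    by_contra! hgood
    refine hbad fun i hi => plen_le_of_unique (hF.monic i hi) (hF.dvd hi)
      fun q q' hq hq' hqm hqm' hqf hqf' => ?_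
    by_contra hne
    obtain ⟨j, hj⟩ := hgood (q, q') (Finset.mem_offDiag.2
      ⟨(hmem q).2 ⟨hq, hqm, hqf.trans (hF.dvd hi)⟩, (hmem q').2 ⟨hq', hqm', hqf'.trans (hF.dvd hi)⟩,
        hne⟩)
    refine hj (Finset.mem_filter.2 ⟨Finset.mem_univ _, ?_⟩)
    rw [coinEquiv_apply]
    exact ⟨hres _ (Or.inr ⟨j, j.2, Or.inl rfl⟩) i hi q q' hq hq' hqf hqf',
      hres _ (Or.inr ⟨j, j.2, Or.inr rfl⟩) i hi q q' hq hq' hqf hqf'⟩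

end Failure

/-! ### Sizes of inputs and outputs -/

theorem length_le_bitSize (l : List ℕ) : l.length ≤ bitSize l := by
  induction l with
  | nil => simp
  | cons a l ih => simp only [bitSize, List.map_cons, List.sum_cons, List.length_cons] at *; omega

theorem lt_two_pow_bitSize {l : List ℕ} {a : ℕ} (h : a ∈ l) : a < 2 ^ bitSize l := by
  have h1 : a.size + 1 ≤ bitSize l :=
    List.single_le_sum (by simp) _ (List.mem_map_of_mem (f := fun n : ℕ => n.size + 1) h)
  exact Nat.size_le.1 (by omega)

theorem bitSize_le {l : List ℕ} {b : ℕ} (h : ∀ a ∈ l, a < 2 ^ b) :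
    bitSize l ≤ l.length * (b + 1) := by
  refine (List.sum_le_card_nsmul _ (b + 1) fun x hx => ?_).trans (by simp)
  obtain ⟨a, ha, rfl⟩ := List.mem_map.1 hx
  exact Nat.succ_le_succ (Nat.size_le.2 (h a ha))

theorem ofList_lt {l : List ℕ} {N : ℕ} (hl : l.length < 2 ^ N) (h : ∀ a ∈ l, a < 2 ^ N) (i : ℕ) :
    ofList l i < 2 ^ N := by
  rcases i with _ | i
  · exact hl
  · simp only [ofList, List.getD_eq_getElem?_getD]
    by_cases hi : i < l.length
    · simpa [hi] using h _ (List.getElem_mem hi)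
    · simp [hi]

theorem mem_coins {K : ℕ} {w : Fin K → Bool} {a : ℕ} (h : a ∈ coins w) : a ≤ 1 := by
  obtain ⟨i, rfl⟩ := (List.mem_ofFn' _ _).1 h
  exact Bool.toNat_le _

theorem length_coins {K : ℕ} (w : Fin K → Bool) : (coins w).length = K := by simp [coins]

theorem bdd_initState {x r : List ℕ} {N : ℕ} (hx : bitSize x ≤ N) (hr : r.length ≤ N) (hN : 1 ≤ N)
    (hr' : ∀ a ∈ r, a ≤ 1) : Bdd N (initState x r) := by
  have h1 : 2 ^ 1 ≤ 2 ^ N := Nat.pow_le_pow_right (by norm_num) hN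
  have h2 : N < 2 ^ N := Nat.lt_two_pow_self
  rintro (_ | _ | a) i
  · exact ofList_lt (((length_le_bitSize x).trans hx).trans_lt h2) (fun a ha =>
      (lt_two_pow_bitSize ha).trans_le (Nat.pow_le_pow_right (by norm_num) hx)) i
  · exact ofList_lt (hr.trans_lt h2) (fun a ha => (hr' a ha).trans_lt (by omega)) i
  · exact Nat.two_pow_pos N

section Encoding

variable {p lam nb m : ℕ}

theorem encodeMatrix_eq {k : ℕ} (M : Matrix (Fin k) (Fin m) (ZMod p)) :
    HPPK.encodeMatrix M = List.ofFn fun x : Fin (k * m) => (M x.divNat x.modNat).val := by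
  rw [List.ofFn_mul]
  simp only [HPPK.encodeMatrix, HPPK.encodeVec]
  congr 2
  ext1 i
  congr 1
  ext1 j
  have hj := j.2
  have h1 : (i * m + j : ℕ) / m = i := by
    rw [mul_comm, Nat.mul_add_div (by omega), Nat.div_eq_of_lt hj, add_zero]
  have h2 : (i * m + j : ℕ) % m = j := by
    rw [mul_comm, Nat.mul_add_mod, Nat.mod_eq_of_lt hj]
  congr 2
  · exact Fin.ext h1.symm
  · exact Fin.ext h2.symm

theorem length_encodeMatrix {k : ℕ} (M : Matrix (Fin k) (Fin m) (ZMod p)) :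
    (HPPK.encodeMatrix M).length = k * m := by simp [encodeMatrix_eq]

theorem getD_encodeMatrix {k : ℕ} (M : Matrix (Fin k) (Fin m) (ZMod p)) (i : Fin k) (j : Fin m) :
    (HPPK.encodeMatrix M).getD (i * m + j) 0 = (M i j).val := by
  have hj := j.2
  have h : i * m + j < k * m := by
    have := Nat.mul_le_mul_right m (show (i : ℕ) + 1 ≤ k from i.2)
    rw [Nat.succ_mul] at this
    omega
  have h1 : (i * m + j : ℕ) / m = i := by
    rw [mul_comm, Nat.mul_add_div (by omega), Nat.div_eq_of_lt hj, add_zero]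
  have h2 : (i * m + j : ℕ) % m = j := by
    rw [mul_comm, Nat.mul_add_mod, Nat.mod_eq_of_lt hj]
  rw [encodeMatrix_eq, List.getD_eq_getElem _ _ (by simpa using h), List.getElem_ofFn]
  congr 2
  · exact Fin.ext h1
  · exact Fin.ext h2

theorem input_encodeInput [Fact p.Prime] (P₁ P₂ : Matrix (Fin (nb + lam + 1)) (Fin m) (ZMod p)) :
    Input lam nb m (columns P₁ P₂) (ofList (HPPK.encodeInput nb m P₁ P₂)) := by
  refine ⟨rfl, rfl, rfl, fun c hc i hi => ?_, fun c hc i hi => ?_⟩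
  · have h0 : ∀ t, ofList (HPPK.encodeInput nb m P₁ P₂) (4 + t) =
        (HPPK.encodeMatrix P₁ ++ HPPK.encodeMatrix P₂).getD t 0 := fun t => by
      rw [show 4 + t = (t + 3) + 1 by omega]
      simp [ofList, HPPK.encodeInput]
    have hcol : ∀ (P : Matrix (Fin (nb + lam + 1)) (Fin m) (ZMod p)) (j : Fin m),
        (HPPK.encodeMatrix P).getD (i * m + j) 0 = ((vecPoly fun r => P r j).coeff i).val :=
      fun P j => by rw [coeff_vecPoly, dif_pos hi, ← getD_encodeMatrix P ⟨i, hi⟩ j]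
    have hlt : ∀ j : Fin m, i * m + j < (nb + lam + 1) * m := fun j => by
      have := Nat.mul_le_mul_right m (show i + 1 ≤ nb + lam + 1 from hi)
      rw [Nat.succ_mul] at this
      omega
    rcases Nat.lt_or_ge c m with hcm | hcm
    · rw [Nat.div_eq_of_lt hcm, Nat.mod_eq_of_lt hcm,
        show 4 + 0 * ((nb + lam + 1) * m) + c + i * m = 4 + (i * m + c) by ring, h0]
      have h1 := hlt ⟨c, hcm⟩
      rw [List.getD_append _ _ _ _ (by rw [length_encodeMatrix]; exact h1)]
      rw [hcol P₁ ⟨c, hcm⟩, ← columns_left P₁ P₂]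
    · obtain ⟨c, rfl⟩ := Nat.exists_eq_add_of_le hcm
      have hcm' : c < m := by omega
      have h2 : (m + c) / m = 1 := by
        rw [Nat.add_div_left _ (by omega), Nat.div_eq_of_lt hcm']
      have h3 : (m + c) % m = c := by rw [Nat.add_mod_left, Nat.mod_eq_of_lt hcm']
      rw [h2, h3, show 4 + 1 * ((nb + lam + 1) * m) + c + i * m =
        4 + ((nb + lam + 1) * m + (i * m + c)) by ring, h0]
      rw [List.getD_append_right _ _ _ _ (by rw [length_encodeMatrix]; omega), length_encodeMatrix,
        Nat.add_sub_cancel_left, hcol P₂ ⟨c, hcm'⟩, ← columns_right P₁ P₂]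
  · rw [columns]
    split_ifs
    · rw [coeff_vecPoly, dif_neg (by omega)]
    · rw [coeff_vecPoly, dif_neg (by omega)]
    · simp

/-- The loops need nb and m to be bounded by the bit length and not only by an exponential of it. If
there is a column, the matrix entries themselves provide this: one matrix has at least nb + lam + 1
entries, the other at least m. -/
theorem bounds_encodeInput [Fact p.Prime] (P₁ P₂ : Matrix (Fin (nb + lam + 1)) (Fin m) (ZMod p))
    (hm : 1 ≤ m) :
    p < 2 ^ bitSize (HPPK.encodeInput nb m P₁ P₂) ∧
    nb + lam + 1 + m + 3 ≤ bitSize (HPPK.encodeInput nb m P₁ P₂) := by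
  refine ⟨lt_two_pow_bitSize (by simp [HPPK.encodeInput]), ?_⟩
  refine le_trans ?_ (length_le_bitSize _)
  simp only [HPPK.encodeInput, List.length_append, length_encodeMatrix, List.length_cons,
    List.length_nil]
  have h1 := Nat.mul_le_mul_left (nb + lam + 1) hm
  have h2 := Nat.mul_le_mul_right m (show 1 ≤ nb + lam + 1 by omega)
  omega

theorem bitSize_output_le [Fact p.Prime] {k b : ℕ} (hp : p < 2 ^ b)
    (L : List ((Fin k → ZMod p) × (Fin k → ZMod p))) :
    bitSize (L.map HPPK.encodePair).flatten ≤ L.length * (k + k) * (b + 1) := by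
  refine (bitSize_le (b := b) fun a ha => ?_).trans (Nat.mul_le_mul_right _ (le_of_eq ?_))
  · simp only [List.mem_flatten, List.mem_map] at ha
    obtain ⟨_, ⟨g, -, rfl⟩, ha⟩ := ha
    simp only [HPPK.encodePair, HPPK.encodeVec, List.mem_append, List.mem_ofFn] at ha
    rcases ha with ⟨i, rfl⟩ | ⟨i, rfl⟩ <;> exact (ZMod.val_lt _).trans hp
  · induction L with
    | nil => simp
    | cons g L ih =>
      simp only [List.map_cons, List.flatten_cons, List.length_append, ih, length_encodePair,
        List.length_cons]
      ring

end Encoding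

/-- A bound for the numbers of loop iterations and the lengths of the numbers that occur in the
attacks on an input of `n` bits. -/
noncomputable def sizeBound : Polynomial ℕ := 100 * (X + 1) ^ 2

theorem eval_sizeBound (n : ℕ) : sizeBound.eval n = 100 * (n + 1) ^ 2 := by simp [sizeBound]

theorem bounds_sizeBound {lam nb m n : ℕ} (hlam : lam ≤ 2) (h : nb + lam + 1 + m + 3 ≤ n) :
    4 * (nb + lam + m + 5) ≤ sizeBound.eval n ∧
    (nb + lam + 2) ^ 2 * (lam + 1 + (lam + 1)) ≤ sizeBound.eval n ∧
    16 * n * n ≤ sizeBound.eval n ∧ 16 * n + 1 ≤ sizeBound.eval n ∧ n ≤ sizeBound.eval n := by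
  rw [eval_sizeBound]
  have h1 : (nb + lam + 2) ^ 2 * (lam + 1 + (lam + 1)) ≤ (n + 1) ^ 2 * 6 :=
    Nat.mul_le_mul (Nat.pow_le_pow_left (by omega) 2) (by omega)
  refine ⟨by nlinarith, by omega, by nlinarith, by nlinarith, by nlinarith⟩

/-! ### Correctness and running time of the attacks -/

section Attacks

variable {p : ℕ} [Fact p.Prime] {lam nb m : ℕ}
  {P₁ P₂ : Matrix (Fin (nb + lam + 1)) (Fin m) (ZMod p)} {f₁ f₂ : Fin (lam + 1) → ZMod p}

theorem computes_attack (hlam : lam ≤ 2) {Q : Polynomial ℕ}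
    (hQ : ∀ N s R, 1 ≤ N → Bdd N s → wp N (attack lam) R s →
      ∃ s' t, Exec (attack lam) s s' t ∧ t ≤ Q.eval N ∧ Bdd N s' ∧ R s')
    (hf : HPPK.IsKey (nb := nb) P₁ P₂ f₁ f₂)
    (huniq : ∀ g₁ g₂, HPPK.IsKey (nb := nb) P₁ P₂ g₁ g₂ → HPPK.ScalarEquiv f₁ f₂ g₁ g₂) :
    ∃ g : (Fin (lam + 1) → ZMod p) × (Fin (lam + 1) → ZMod p),
      HPPK.ScalarEquiv f₁ f₂ g.1 g.2 ∧
      Computes (attack lam) (HPPK.encodeInput nb m P₁ P₂) [] (HPPK.encodePair g)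
        ((Q.comp sizeBound + sizeBound * (X + 1)).eval
          (bitSize (HPPK.encodeInput nb m P₁ P₂))) := by
  have hne := exists_columns_ne_zero (exists_ne_zero_of_unique huniq)
  obtain ⟨hp, hn⟩ := bounds_encodeInput P₁ P₂ (by obtain ⟨i, hi, -⟩ := hne; omega)
  set n := bitSize (HPPK.encodeInput nb m P₁ P₂) with hn'
  obtain ⟨b1, b2, -, -, b5⟩ := bounds_sizeBound hlam hn
  obtain ⟨s, t, hE, ht, -, D, u, v, M, j, F, k, L, hR, hF, hres, hL, hout⟩ := hQ (sizeBound.eval n)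
    (initState (HPPK.encodeInput nb m P₁ P₂) []) _ (by omega)
    (bdd_initState b5 (by simp) (by omega) (by simp))
    (wp_attack (input_encodeInput P₁ P₂)
      (hp.trans_le (Nat.pow_le_pow_right (by norm_num) b5)) b1 b2 hne rfl)
  obtain ⟨g, L', rfl, hg⟩ := exists_cons_of_candidates hR hlam hF hres hL hf huniq
  refine ⟨g, hg, s, t, hE, hout g L' rfl, ?_⟩
  have h1 := bitSize_output_le hp [g]
  have h2 : [g].length * (lam + 1 + (lam + 1)) ≤ sizeBound.eval n := by
    rw [eval_sizeBound]
    simp only [List.length_singleton]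
    nlinarith
  simp only [List.map_singleton, List.flatten_singleton] at h1
  simp only [eval_add, eval_comp, eval_mul, eval_X, eval_one]
  exact Nat.add_le_add ht (h1.trans (Nat.mul_le_mul_right _ h2))

/-- Each outcome of the coin flips comes with its own witnesses. The union bound needs the same D
for all of them. -/
theorem Reduction.gcd_unique {cs : ℕ → (ZMod p)[X]} {D D' u u' v v' : (ZMod p)[X]} {M M' j j' : ℕ}
    (h : Reduction m cs D u v M j) (h' : Reduction m cs D' u' v' M' j') : D = D' :=
  eq_of_monic_of_associated h.monic h'.monic (associated_of_dvd_dvd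
    ((h'.dvd_iff D).2 ((h.dvd_iff D).1 dvd_rfl)) ((h.dvd_iff D').2 ((h'.dvd_iff D').1 dvd_rfl)))

theorem computes_randomizedAttack (hlam : lam ≤ 2) {Q : Polynomial ℕ}
    (hQ : ∀ N s R, 1 ≤ N → Bdd N s → wp N (randomizedAttack lam) R s →
      ∃ s' t, Exec (randomizedAttack lam) s s' t ∧ t ≤ Q.eval N ∧ Bdd N s' ∧ R s')
    (hf : HPPK.IsKey (nb := nb) P₁ P₂ f₁ f₂) (hP : P₁ ≠ 0 ∨ P₂ ≠ 0) {n K : ℕ}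
    (hn : n = bitSize (HPPK.encodeInput nb m P₁ P₂)) (hK : K = 16 * n * n) (w : Fin K → Bool) :
    ∃ L : List ((Fin (lam + 1) → ZMod p) × (Fin (lam + 1) → ZMod p)),
      Computes (randomizedAttack lam) (HPPK.encodeInput nb m P₁ P₂) (coins w)
        (L.map HPPK.encodePair).flatten ((Q.comp sizeBound + sizeBound * (X + 1)).eval n) ∧
      (L = [] ∨ HPPK.IsKeyList (nb := nb) P₁ P₂ L) ∧
      (L = [] → ∃ D u v M j F k, Reduction m (columns P₁ P₂) D u v M j ∧
        Factorization (smallPart D) F k ∧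
        (∀ g ∈ tests D (ofList (coins w)) n (16 * n), ∀ i < k, Resolved g (F i)) ∧
        ¬ ∀ i < k, plen (F i) ≤ 2 ∨ plen (F i) = 3 ∧ plen (mgcd (F i) (splitter D)) ≤ 1) := by
  have hne := exists_columns_ne_zero hP
  obtain ⟨hp, hn'⟩ := bounds_encodeInput P₁ P₂ (by obtain ⟨i, hi, -⟩ := hne; omega)
  rw [← hn] at hp hn'
  obtain ⟨b1, b2, b3, b4, b5⟩ := bounds_sizeBound hlam hn'
  obtain ⟨s, t, hE, ht, -, D, u, v, M, j, F, k, hR, hF, hres, hgood, hbad⟩ := hQ (sizeBound.eval n)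
    (initState (HPPK.encodeInput nb m P₁ P₂) (coins w)) _ (by omega)
    (bdd_initState (hn ▸ b5) (by rw [length_coins]; omega) (by omega) fun a => mem_coins)
    (wp_randomizedAttack (k := n) (input_encodeInput P₁ P₂)
      (hp.trans_le (Nat.pow_le_pow_right (by norm_num) b5)) b1 b2 hne rfl
      (by rw [← hK]; exact length_coins w) b4 (fun i => by
        by_cases hi : i < K
        · exact (ofList_coins w hi).trans_le (Bool.toNat_le _)
        · change (coins w).getD i 0 ≤ 1
          rw [List.getD_eq_default _ _ (by rw [length_coins]; omega)]
          omega))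
  simp only [eval_add, eval_comp, eval_mul, eval_X, eval_one]
  by_cases hc : ∀ i < k, plen (F i) ≤ 2 ∨ plen (F i) = 3 ∧ plen (mgcd (F i) (splitter D)) ≤ 1
  · obtain ⟨L, hL, hlen, hout⟩ := hgood hc
    have hkeys := isKeyList_of_candidates hR hlam hF hc hL hf
    refine ⟨L, ⟨s, t, hE, hout, ?_⟩, Or.inr hkeys, fun h => ?_⟩
    · refine Nat.add_le_add ht ((bitSize_output_le hp L).trans (Nat.mul_le_mul_right _ ?_))
      exact (Nat.mul_le_mul_right _ hlen).trans b2
    · obtain ⟨g, hg, -⟩ := hkeys.2 f₁ f₂ hf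
      rw [h] at hg
      simp at hg
  · exact ⟨[], ⟨s, t, hE, by simpa using hbad hc, by simpa [bitSize] using Nat.le_add_right_of_le ht⟩,
      Or.inl rfl, fun _ => ⟨D, u, v, M, j, F, k, hR, hF, hres, hc⟩⟩

theorem exists_output_randomizedAttack (hlam : lam ≤ 2) {Q : Polynomial ℕ}
    (hQ : ∀ N s R, 1 ≤ N → Bdd N s → wp N (randomizedAttack lam) R s →
      ∃ s' t, Exec (randomizedAttack lam) s s' t ∧ t ≤ Q.eval N ∧ Bdd N s' ∧ R s')
    (hf : HPPK.IsKey (nb := nb) P₁ P₂ f₁ f₂) (hP : P₁ ≠ 0 ∨ P₂ ≠ 0) {n K : ℕ}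
    (hn : n = bitSize (HPPK.encodeInput nb m P₁ P₂)) (hK : K = 16 * n * n) :
    ∃ out : (Fin K → Bool) → List ((Fin (lam + 1) → ZMod p) × (Fin (lam + 1) → ZMod p)),
      (∀ w, Computes (randomizedAttack lam) (HPPK.encodeInput nb m P₁ P₂) (coins w)
        ((out w).map HPPK.encodePair).flatten
        ((Q.comp sizeBound + sizeBound * (X + 1)).eval n)) ∧
      (∀ w, out w = [] ∨ HPPK.IsKeyList (nb := nb) P₁ P₂ (out w)) ∧
      2 * Nat.card {w // out w = []} ≤ 2 ^ K := by
  choose out h1 h2 h3 using computes_randomizedAttack hlam hQ hf hP hn hK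
  refine ⟨out, h1, h2, ?_⟩
  by_cases h : ∃ w, out w = []
  · obtain ⟨w₀, hw₀⟩ := h
    obtain ⟨D, u, v, M, j, -, -, hR, -⟩ := h3 w₀ hw₀
    have hne := exists_columns_ne_zero hP
    obtain ⟨hp, hn'⟩ := bounds_encodeInput P₁ P₂ (by obtain ⟨i, hi, -⟩ := hne; omega)
    rw [← hn] at hp hn'
    have hD : D.natDegree ≤ n := by
      obtain ⟨i, hi, hi'⟩ := hne
      have h4 := natDegree_le_of_dvd ((hR.dvd_iff D).1 dvd_rfl i hi) hi'
      have h5 := plen_le ((input_encodeInput P₁ P₂).zero i hi)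
      rw [plen_of_ne hi'] at h5
      omega
    subst hK
    refine two_mul_card_failure_le hR.monic hD hp _ fun w hw => ?_
    obtain ⟨D', u', v', M', j', F, k, hR', hF, hres, hc⟩ := h3 w hw
    obtain rfl := hR.gcd_unique hR'
    exact ⟨F, k, hF, hres, hc⟩
  · have : IsEmpty {w // out w = []} := ⟨fun w => h ⟨w.1, w.2⟩⟩
    simp

end Attacks

end Ram

theorem mainTheorem5 (lam : ℕ) (hlam : lam ≤ 2) :
    (∃ (A : Ram.Prog) (T : Polynomial ℕ),
      ∀ (p : ℕ) [Fact p.Prime] (nb m : ℕ) (b : Matrix (Fin (nb + 1)) (Fin m) (ZMod p))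
        (f₁ f₂ : Fin (lam + 1) → ZMod p)
        (P₁ P₂ : Matrix (Fin (nb + lam + 1)) (Fin m) (ZMod p)),
        P₁ = HPPK.centralMap b f₁ → P₂ = HPPK.centralMap b f₂ →
        (∀ g₁ g₂ : Fin (lam + 1) → ZMod p,
          HPPK.IsKey (nb := nb) P₁ P₂ g₁ g₂ → HPPK.ScalarEquiv f₁ f₂ g₁ g₂) →
        ∃ g : (Fin (lam + 1) → ZMod p) × (Fin (lam + 1) → ZMod p),
          HPPK.ScalarEquiv f₁ f₂ g.1 g.2 ∧
          Ram.Computes A (HPPK.encodeInput nb m P₁ P₂) [] (HPPK.encodePair g)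
            (T.eval (Ram.bitSize (HPPK.encodeInput nb m P₁ P₂)))) ∧
    (∃ (A : Ram.Prog) (T q : Polynomial ℕ),
      ∀ (p : ℕ) [Fact p.Prime] (nb m : ℕ) (b : Matrix (Fin (nb + 1)) (Fin m) (ZMod p))
        (f₁ f₂ : Fin (lam + 1) → ZMod p)
        (P₁ P₂ : Matrix (Fin (nb + lam + 1)) (Fin m) (ZMod p)),
        P₁ = HPPK.centralMap b f₁ → P₂ = HPPK.centralMap b f₂ → (P₁ ≠ 0 ∨ P₂ ≠ 0) →
        ∃ out : (Fin (q.eval (Ram.bitSize (HPPK.encodeInput nb m P₁ P₂))) → Bool) →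
            List ((Fin (lam + 1) → ZMod p) × (Fin (lam + 1) → ZMod p)),
          (∀ w, Ram.Computes A (HPPK.encodeInput nb m P₁ P₂) (Ram.coins w)
            ((out w).map HPPK.encodePair).flatten
            (T.eval (Ram.bitSize (HPPK.encodeInput nb m P₁ P₂)))) ∧
          (∀ w, out w = [] ∨ HPPK.IsKeyList (nb := nb) P₁ P₂ (out w)) ∧
          2 * Nat.card {w // out w = []} ≤
            2 ^ (q.eval (Ram.bitSize (HPPK.encodeInput nb m P₁ P₂)))) := by

  refine ⟨?_, ?_⟩
  · obtain ⟨Q, hQ⟩ := Ram.wp_sound (Ram.attack lam)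
    refine ⟨Ram.attack lam, Q.comp Ram.sizeBound + Ram.sizeBound * (X + 1), ?_⟩
    intro p _ nb m b f₁ f₂ P₁ P₂ h₁ h₂ huniq
    exact Ram.computes_attack hlam hQ ⟨b, h₁, h₂⟩ huniq
  · obtain ⟨Q, hQ⟩ := Ram.wp_sound (Ram.randomizedAttack lam)
    -- The coin flips make 16 n numbers of n binary digits each, where n is the bit length of the
    -- input; p < 2^n holds because p is part of the input.
    refine ⟨Ram.randomizedAttack lam, Q.comp Ram.sizeBound + Ram.sizeBound * (X + 1), 16 * X * X, ?_⟩
    intro p _ nb m b f₁ f₂ P₁ P₂ h₁ h₂ hP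
    exact Ram.exists_output_randomizedAttack hlam hQ ⟨b, h₁, h₂⟩ hP rfl (by simp)
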